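/- Let $x_1,x_2,\dots$ be i.i.d. real random variables with distribution function $F$ and (topological) support $\mathcal X$, let $\mathsf x\in\mathcal X$, and let $\hat F(u)=\frac1n\sum_{i=1}^n\mathbf 1(x_i\le u)$. Write $|\cdot|$ for the Euclidean norm (of vectors, and of matrices as arrays of entries). Assume: (a) For some $\delta>0$, $F$ is absolutely continuous on $[\mathsf x-\delta,\mathsf x+\delta]$ with a density $f\ge 0$, and there are constants $f(\mathsf x\pm),\dot f(\mathsf x\pm)$ with $$\sup_{u\in[-\delta,0)}\frac{f(\mathsf x+u)-f(\mathsf x-)-u\dot f(\mathsf x-)}{u^2}+\sup_{u\in(0,\delta]}\frac{f(\mathsf x+u)-f(\mathsf x+)-u\dot f(\mathsf x+)}{u^2}<\infty .$$ (b) $K:\mathbb R\to\mathbb R$ is nonnegative, symmetric, has support $[-1,1]$, is continuous on $[-1,1]$, and integrates to $1$. (c) $R:\mathbb R\to\mathbb R^d$ is measurable and locally bounded, and for every $h>0$ there is a positive-definite diagonal matrix $\Upsilon_h$ with $\Upsilon_hR(u)=R(u/h)$ for all $u$. (d) Put $S_h=(\mathcal X-\mathsf x)/h$ and $$\Gamma_h=\int_{S_h}R(u)R(u)'K(u)f(\mathsf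 x+hu)\,du,$$ $$\Sigma_h=\int_{S_h}\!\int_{S_h}R(u)R(v)'\big[F(\mathsf x+h(u\wedge v))-F(\mathsf x+hu)F(\mathsf x+hv)\big]K(u)K(v)f(\mathsf x+hu)f(\mathsf x+hv)\,du\,dv .$$ For all sufficiently small $h>0$, the minimum eigenvalues of $\Gamma_h$ and of $h^{-1}\Sigma_h$ are bounded away from zero. For $\theta\in\mathbb R^d$ let $\varrho(h)=\sup\{|F(x)-R(x-\mathsf x)'\theta| : x\in\mathcal X,\ |x-\mathsf x|\le h\}$. Let $h=h_n>0$ satisfy $h\to0$, $nh^2\to\infty$ and $n\varrho(h)^2/h\to0$ as $n\to\infty$. Let $\hat\theta$ and $\hat\theta_F$ be random vectors that almost surely minimize over $t\in\mathbb R^d$, respectively, $$\sum_{i=1}^n\big(\hat F(x_i)-R(x_i-\mathsf x)'t\big)^2\tfrac1hK\big(\tfrac{x_i-\mathsf x}h\big)\quad\text{and}\quad\int_{\mathcal X}\big(\hat F(u)-R(u-\mathsf x)'t\big)^2\tfrac1hK\big(\tfrac{u-\mathsf x}h\big)\,dF(u).$$ Then: (i) with $\hat\Gamma_h=\frac1n\sum_{i=1}^n\Upsilon_hR(x_i-\mathsf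 x)R(x_i-\mathsf x)'\Upsilon_h\frac1hK(\frac{x_i-\mathsf x}h)$, $$|\hat\Gamma_h-\Gamma_h|=O_{\mathbb P}\big(\sqrt{1/(nh)}\big);$$ (ii) the leave-in bias and the approximation bias satisfy $$\frac1{n^2}\sum_{j=1}^n\Upsilon_hR(x_j-\mathsf x)[1-F(x_j)]\tfrac1hK\big(\tfrac{x_j-\mathsf x}h\big)=O_{\mathbb P}(1/n),$$ $$\frac1n\sum_{j=1}^n\Upsilon_hR(x_j-\mathsf x)\big[F(x_j)-R(x_j-\mathsf x)'\theta\big]\tfrac1hK\big(\tfrac{x_j-\mathsf x}h\big)=O_{\mathbb P}(\varrho(h));$$ (iii) the degenerate U-statistic remainder satisfies $$\frac1{n^2}\sum_{\substack{i,j=1\\ i\ne j}}^n\Big\{\Upsilon_hR(x_j-\mathsf x)[\mathbf 1(x_i\le x_j)-F(x_j)]\tfrac1hK\big(\tfrac{x_j-\mathsf x}h\big)-\int_{S_h}R(u)[\mathbf 1(x_i\le\mathsf x+hu)-F(\mathsf x+hu)]K(u)f(\mathsf x+hu)\,du\Big\}=O_{\mathbb P}\big(\sqrt{1/(n^2h)}\big);$$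 (iv) $$\sqrt n\,(\Gamma_h^{-1}\Sigma_h\Gamma_h^{-1})^{-1/2}\Upsilon_h^{-1}(\hat\theta-\theta)=\sqrt n\,(\Gamma_h^{-1}\Sigma_h\Gamma_h^{-1})^{-1/2}\Upsilon_h^{-1}(\hat\theta_F-\theta)+o_{\mathbb P}(1)\rightsquigarrow\mathcal N(0,I_d).$$ -/

import Mathlib

open MeasureTheory ProbabilityTheory Filter Topology
open scoped Matrix

noncomputable section

namespace LocalDistribution

/-- The Euclidean space of column vectors of length `d`. -/
abbrev Vec (d : ℕ) := EuclideanSpace ℝ (Fin d)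

/-- Matrix times column vector. -/
def mv {d : ℕ} (A : Matrix (Fin d) (Fin d) ℝ) (v : Vec d) : Vec d :=
  WithLp.toLp 2 (A *ᵥ WithLp.ofLp v)

/-- The Euclidean norm of a matrix, i.e. of the vector of its entries. -/
def matrixNorm {d : ℕ} (A : Matrix (Fin d) (Fin d) ℝ) : ℝ :=
  Real.sqrt (∑ k, ∑ l, (A k l) ^ 2)

/-- The power `A^{-1/2}` of a symmetric positive definite matrix, by the spectral calculus. -/
def invSqrt {d : ℕ} (A : Matrix (Fin d) (Fin d) ℝ) : Matrix (Fin d) (Fin d) ℝ :=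
  cfc (fun t : ℝ => t ^ (-(1 / 2) : ℝ)) A

/-- Stochastic boundedness: `Y n = O_P (a n)` as `n → ∞`. -/
def IsBigOP {Ω : Type*} [MeasurableSpace Ω] (P : Measure Ω) (Y : ℕ → Ω → ℝ) (a : ℕ → ℝ) : Prop :=
  ∀ ε : ℝ, 0 < ε → ∃ M : ℝ, 0 < M ∧
    ∀ᶠ n in atTop, P {ω | M * a n < |Y n ω|} ≤ ENNReal.ofReal ε

/-- The indicator `𝟙(a ≤ b)`. -/
def indLe (a b : ℝ) : ℝ := if a ≤ b then 1 else 0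

/-- The empirical distribution function of the first `n` entries of the data sequence `xs`. -/
def empCDF (n : ℕ) (xs : ℕ → ℝ) (u : ℝ) : ℝ :=
  (1 / (n : ℝ)) * ∑ i ∈ Finset.range n, indLe (xs i) u

/-- The kernel weight `h⁻¹ K ((u - x) / h)`. -/
def kernelWeight (K : ℝ → ℝ) (h x u : ℝ) : ℝ := (1 / h) * K ((u - x) / h)

/-- The rescaled support `(𝒳 - x) / h`, where `𝒳` is the support of `μ`. -/
def scaledSupport (μ : Measure ℝ) (x h : ℝ) : Set ℝ := {u | x + h * u ∈ μ.support}

/-- The approximation error `ϱ(h)`: the supremum of `|F(y) - R(y - x)'θ|` over the points `y` of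
the support with `|y - x| ≤ h`. -/
def approxError {d : ℕ} (μ : Measure ℝ) (x : ℝ) (R : ℝ → Vec d) (θ : Vec d) (h : ℝ) : ℝ :=
  sSup ((fun y => |cdf μ y - inner ℝ (R (y - x)) θ|) '' {y | y ∈ μ.support ∧ |y - x| ≤ h})

/-- The matrix `Γ_h` for the design density `g`. -/
def Gam {d : ℕ} (μ : Measure ℝ) (x : ℝ) (K : ℝ → ℝ) (R : ℝ → Vec d) (g : ℝ → ℝ) (h : ℝ) :
    Matrix (Fin d) (Fin d) ℝ :=
  Matrix.of fun k l => ∫ u in scaledSupport μ x h, R u k * R u l * K u * g (x + h * u)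

/-- The matrix `Σ_h` for the design density `g`. -/
def Sig {d : ℕ} (μ : Measure ℝ) (x : ℝ) (K : ℝ → ℝ) (R : ℝ → Vec d) (g : ℝ → ℝ) (h : ℝ) :
    Matrix (Fin d) (Fin d) ℝ :=
  Matrix.of fun k l => ∫ u in scaledSupport μ x h, ∫ v in scaledSupport μ x h,
    R u k * R v l
      * (cdf μ (x + h * min u v) - cdf μ (x + h * u) * cdf μ (x + h * v))
      * (K u * K v) * (g (x + h * u) * g (x + h * v))

/-- The assumptions on the distribution `μ` of an observation (with distribution function
`F = cdf μ` and support `𝒳 = μ.support`), the evaluation point `x`, the local density `f`, the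
kernel `K`, the basis `R` and the diagonals `Υ h` of the scaling matrices. -/
structure PointwiseAssumption {d : ℕ} (μ : Measure ℝ) (x : ℝ) (f K : ℝ → ℝ) (R : ℝ → Vec d)
    (Υ : ℝ → Fin d → ℝ) : Prop where
  mem_support : x ∈ μ.support
  /-- `F` is absolutely continuous on `[x - δ, x + δ]` with density `f`, which has one-sided
  expansions at `x`; only the upper bounds are required. -/
  density : ∃ δ : ℝ, 0 < δ ∧
    IntegrableOn f (Set.Icc (x - δ) (x + δ)) ∧
    (∀ y ∈ Set.Icc (x - δ) (x + δ), 0 ≤ f y) ∧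
    (∀ y ∈ Set.Icc (x - δ) (x + δ), cdf μ y = cdf μ (x - δ) + ∫ t in (x - δ)..y, f t) ∧
    ∃ fm fp dfm dfp : ℝ,
      BddAbove ((fun u => (f (x + u) - fm - u * dfm) / u ^ 2) '' Set.Ico (-δ) 0) ∧
      BddAbove ((fun u => (f (x + u) - fp - u * dfp) / u ^ 2) '' Set.Ioc 0 δ)
  kernel_nonneg : ∀ u, 0 ≤ K u
  kernel_symm : ∀ u, K (-u) = K u
  kernel_support : tsupport K = Set.Icc (-1) 1
  kernel_continuousOn : ContinuousOn K (Set.Icc (-1) 1)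
  kernel_integral : ∫ u, K u = 1
  basis_measurable : Measurable R
  basis_locallyBounded : ∀ u₀, ∃ C : ℝ, ∀ᶠ u in 𝓝 u₀, ‖R u‖ ≤ C
  scaling_pos : ∀ h, 0 < h → ∀ k, 0 < Υ h k
  scaling : ∀ h, 0 < h → ∀ u, mv (Matrix.diagonal (Υ h)) (R u) = R (u / h)
  /-- For all small `h > 0` the eigenvalues of `Γ_h` and `h⁻¹ Σ_h` (for the design `F`) are
  bounded away from zero. -/
  eigenvalues : ∃ c : ℝ, 0 < c ∧ ∀ᶠ h in 𝓝[>] (0 : ℝ),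
    (∀ l ∈ spectrum ℝ (Gam μ x K R f h), c ≤ l) ∧
    (∀ l ∈ spectrum ℝ (h⁻¹ • Sig μ x K R f h), c ≤ l)

/-- The criterion that the local `L²` estimator with design measure `G` minimizes. -/
def localL2Criterion {d : ℕ} (μ G : Measure ℝ) (x : ℝ) (K : ℝ → ℝ) (R : ℝ → Vec d) (h : ℝ)
    (n : ℕ) (xs : ℕ → ℝ) (t : Vec d) : ℝ :=
  ∫ u in μ.support, (empCDF n xs u - inner ℝ (R (u - x)) t) ^ 2 * kernelWeight K h x u ∂G

/-- The criterion that the local regression estimator minimizes. -/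
def localRegressionCriterion {d : ℕ} (x : ℝ) (K : ℝ → ℝ) (R : ℝ → Vec d) (h : ℝ)
    (n : ℕ) (xs : ℕ → ℝ) (t : Vec d) : ℝ :=
  ∑ i ∈ Finset.range n,
    (empCDF n xs (xs i) - inner ℝ (R (xs i - x)) t) ^ 2 * kernelWeight K h x (xs i)

/-- The sample Gram matrix. -/
def GamHat {d : ℕ} (x : ℝ) (K : ℝ → ℝ) (R : ℝ → Vec d) (Υ : ℝ → Fin d → ℝ) (h : ℝ)
    (n : ℕ) (xs : ℕ → ℝ) : Matrix (Fin d) (Fin d) ℝ :=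
  (1 / (n : ℝ)) • ∑ i ∈ Finset.range n,
    kernelWeight K h x (xs i) •
      (Matrix.diagonal (Υ h)
        * Matrix.vecMulVec (WithLp.ofLp (R (xs i - x))) (WithLp.ofLp (R (xs i - x)))
        * Matrix.diagonal (Υ h))

/-- The leave-in bias. -/
def leaveInBias {d : ℕ} (μ : Measure ℝ) (x : ℝ) (K : ℝ → ℝ) (R : ℝ → Vec d)
    (Υ : ℝ → Fin d → ℝ) (h : ℝ) (n : ℕ) (xs : ℕ → ℝ) : Vec d :=
  (1 / (n : ℝ) ^ 2) • ∑ j ∈ Finset.range n,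
    ((1 - cdf μ (xs j)) * kernelWeight K h x (xs j)) •
      mv (Matrix.diagonal (Υ h)) (R (xs j - x))

/-- The approximation bias. -/
def approxBias {d : ℕ} (μ : Measure ℝ) (x : ℝ) (K : ℝ → ℝ) (R : ℝ → Vec d)
    (Υ : ℝ → Fin d → ℝ) (θ : Vec d) (h : ℝ) (n : ℕ) (xs : ℕ → ℝ) : Vec d :=
  (1 / (n : ℝ)) • ∑ j ∈ Finset.range n,
    ((cdf μ (xs j) - inner ℝ (R (xs j - x)) θ) * kernelWeight K h x (xs j)) •
      mv (Matrix.diagonal (Υ h)) (R (xs j - x))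

/-- The contribution `∫ R(u) [𝟙(a ≤ x + h u) - F(x + h u)] K(u) f(x + h u) du` of an observation
`a` to the linear term. -/
def influence {d : ℕ} (μ : Measure ℝ) (x : ℝ) (f K : ℝ → ℝ) (R : ℝ → Vec d) (h a : ℝ) : Vec d :=
  ∫ u in scaledSupport μ x h,
    ((indLe a (x + h * u) - cdf μ (x + h * u)) * K u * f (x + h * u)) • R u

/-- The degenerate second-order U-statistic remainder. -/
def quadraticTerm {d : ℕ} (μ : Measure ℝ) (x : ℝ) (f K : ℝ → ℝ) (R : ℝ → Vec d)
    (Υ : ℝ → Fin d → ℝ) (h : ℝ) (n : ℕ) (xs : ℕ → ℝ) : Vec d :=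
  (1 / (n : ℝ) ^ 2) • ∑ i ∈ Finset.range n, ∑ j ∈ (Finset.range n).erase i,
    (((indLe (xs i) (xs j) - cdf μ (xs j)) * kernelWeight K h x (xs j)) •
        mv (Matrix.diagonal (Υ h)) (R (xs j - x))
      - influence μ x f K R h (xs i))

/-- The standardized estimator `√n (Γ_h⁻¹ Σ_h Γ_h⁻¹)^{-1/2} Υ_h⁻¹ (t - θ)`, for the design `F`. -/
def standardized {d : ℕ} (μ : Measure ℝ) (x : ℝ) (f K : ℝ → ℝ) (R : ℝ → Vec d)
    (Υ : ℝ → Fin d → ℝ) (θ : Vec d) (h : ℝ) (n : ℕ) (t : Vec d) : Vec d :=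
  Real.sqrt n •
    mv (invSqrt ((Gam μ x K R f h)⁻¹ * Sig μ x K R f h * (Gam μ x K R f h)⁻¹)
        * (Matrix.diagonal (Υ h))⁻¹) (t - θ)

end LocalDistribution

end

/-!
# Local regression distribution estimators at a point

The local regression estimator regresses the empirical distribution function on a scaled basis,
with kernel weights in a window of width `h` around `x`. The one-sided expansions in the hypothesis
give a density of `μ` near `x` that is bounded above, so the window has mass `O(h)`. The
substitution `y = x + h u` turns `Γ_h`, `Σ_h` and the influence of an observation into integrals
against `μ` (`integral_scaledSupport`), and Fubini's theorem identifies `Σ_h` with the covariance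
matrix of the influence (`LocalSubstitution.sig_apply`). The mass bound then controls all moments,
and the stochastic orders follow from Markov's inequality; for the double sum the point is that two
terms of a degenerate U-statistic are orthogonal unless they involve the same two observations
(`integral_sq_degenerate_le`).

For the estimator, the normal equations read `Γ̂ D = L + E`, where `D = Υ⁻¹ (θ̂ - θ)`, where `L` is
the average influence, and where `E` collects the U-statistic, the two biases and a fraction `1/n`
of `L` (`sampleScore_eq`). The estimator `θ̂_F` satisfies `Γ D_F = L + O(ϱ)`. With
`M = (Γ⁻¹ Σ Γ⁻¹)^{-1/2} Γ⁻¹` one has `M Σ Mᵀ = 1`, hence `‖M‖ ≤ (c h)^{-1/2}` because `Σ_h ≥ c h`.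
Writing `Γ D = L + E - (Γ̂ - Γ) D` shows that the standardized estimator differs from `√n M L` by at
most a constant times `√(n/h) (‖E‖ + ‖Γ̂ - Γ‖ (‖L‖ + ‖E‖))` as soon as `‖Γ̂ - Γ‖ ≤ c/2`
(`RegularBandwidth.norm_standardized_sub_le`). As `L` is of order `n^{-1/2}` only, this is where
`n h² → ∞` is needed.

Finally `√n M L` is a normalized sum of i.i.d. vectors with identity covariance and norm
`O(h^{-1/2})`, which is negligible against `√n`. A third-order Taylor bound for characteristic
functions and Lévy's continuity theorem give the normal limit
(`tendstoInDistribution_stdGaussian_of_rows`), and Slutsky's theorem transfers it to the estimator.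
-/

noncomputable section

namespace LocalDistribution

/-! ### Stochastic boundedness -/

section BigOP

variable {Ω : Type*} [MeasurableSpace Ω] {P : Measure Ω}

/-- Markov's inequality for a strict superlevel set, as a bound on the measure itself. -/
lemma measure_lt_le_ofReal_div [IsFiniteMeasure P] {Z : Ω → ℝ} (hZ : ∀ ω, 0 ≤ Z ω)
    (hint : Integrable Z P) {A B : ℝ} (hA : 0 < A) (hB : ∫ ω, Z ω ∂P ≤ B) :
    P {ω | A < Z ω} ≤ ENNReal.ofReal (B / A) := by
  have h1 : P {ω | A < Z ω} ≤ P {ω | A ≤ Z ω} := measure_mono fun ω (hω : A < Z ω) => hω.le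
  refine h1.trans ?_
  rw [← ofReal_measureReal (measure_ne_top P _)]
  apply ENNReal.ofReal_le_ofReal
  rw [le_div_iff₀ hA, mul_comm]
  exact (mul_meas_ge_le_integral_of_nonneg (ae_of_all _ hZ) hint A).trans hB

lemma isBigOP_of_integral_le [IsFiniteMeasure P] {Y : ℕ → Ω → ℝ} {a : ℕ → ℝ} (C : ℝ)
    (hY : ∀ n ω, 0 ≤ Y n ω) (ha : ∀ᶠ n in atTop, 0 < a n)
    (h : ∀ᶠ n in atTop, Integrable (Y n) P ∧ ∫ ω, Y n ω ∂P ≤ C * a n) :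
    IsBigOP P Y a := by
  intro ε hε
  refine ⟨(|C| + 1) / ε, by positivity, ?_⟩
  filter_upwards [ha, h] with n han hn
  have hM : 0 < (|C| + 1) / ε * a n := by positivity
  have := measure_lt_le_ofReal_div (hY n) hn.1 hM hn.2
  have heq : {ω | (|C| + 1) / ε * a n < |Y n ω|} = {ω | (|C| + 1) / ε * a n < Y n ω} := by
    ext ω; simp [abs_of_nonneg (hY n ω)]
  rw [heq]
  refine this.trans (ENNReal.ofReal_le_ofReal ?_)
  have hc : C ≤ |C| + 1 := by linarith [le_abs_self C]
  rw [div_le_iff₀ hM]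
  calc C * a n ≤ (|C| + 1) * a n := by gcongr
    _ = ε * ((|C| + 1) / ε * a n) := by field_simp

lemma isBigOP_of_integral_sq_le [IsFiniteMeasure P] {Y : ℕ → Ω → ℝ} {a : ℕ → ℝ} (C : ℝ)
    (ha : ∀ᶠ n in atTop, 0 < a n)
    (h : ∀ᶠ n in atTop, Integrable (fun ω => Y n ω ^ 2) P ∧ ∫ ω, Y n ω ^ 2 ∂P ≤ C * a n ^ 2) :
    IsBigOP P Y a := by
  have key : IsBigOP P (fun n ω => Y n ω ^ 2) (fun n => a n ^ 2) :=
    isBigOP_of_integral_le C (fun n ω => sq_nonneg _) (ha.mono fun n hn => by positivity) h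
  intro ε hε
  obtain ⟨M, hM, hMe⟩ := key ε hε
  refine ⟨Real.sqrt M, Real.sqrt_pos.2 hM, ?_⟩
  filter_upwards [ha, hMe] with n han hn
  refine (measure_mono fun ω hω => ?_).trans hn
  simp only [Set.mem_ofPred_eq, abs_pow, sq_abs] at hω ⊢
  calc M * a n ^ 2 = (Real.sqrt M * a n) ^ 2 := by rw [mul_pow, Real.sq_sqrt hM.le]
    _ < |Y n ω| ^ 2 := by gcongr
    _ = Y n ω ^ 2 := sq_abs _

lemma IsBigOP.mono {Y Z : ℕ → Ω → ℝ} {a : ℕ → ℝ} (hZ : IsBigOP P Z a)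
    (h : ∀ᶠ n in atTop, ∀ᵐ ω ∂P, |Y n ω| ≤ |Z n ω|) : IsBigOP P Y a := by
  intro ε hε
  obtain ⟨M, hM, hMe⟩ := hZ ε hε
  refine ⟨M, hM, ?_⟩
  filter_upwards [h, hMe] with n hn hn2
  refine (measure_mono_ae ?_).trans hn2
  filter_upwards [hn] with ω hω h3
  exact lt_of_lt_of_le h3 hω

lemma IsBigOP.mono_rate {Y : ℕ → Ω → ℝ} {a b : ℕ → ℝ} {C : ℝ} (hC : 0 < C)
    (hY : IsBigOP P Y a) (h : ∀ᶠ n in atTop, a n ≤ C * b n) : IsBigOP P Y b := by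
  intro ε hε
  obtain ⟨M, hM, hMe⟩ := hY ε hε
  refine ⟨M * C, by positivity, ?_⟩
  filter_upwards [h, hMe] with n hn hn2
  refine (measure_mono fun ω hω => ?_).trans hn2
  simp only [Set.mem_ofPred_eq] at hω ⊢
  refine lt_of_le_of_lt ?_ hω
  rw [mul_assoc]
  gcongr

lemma IsBigOP.add {Y Z : ℕ → Ω → ℝ} {a : ℕ → ℝ} (hY : IsBigOP P Y a) (hZ : IsBigOP P Z a) :
    IsBigOP P (fun n ω => Y n ω + Z n ω) a := by
  intro ε hε
  obtain ⟨M, hM, hMe⟩ := hY (ε / 2) (by positivity)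
  obtain ⟨N, hN, hNe⟩ := hZ (ε / 2) (by positivity)
  refine ⟨M + N, by positivity, ?_⟩
  filter_upwards [hMe, hNe] with n hn hn2
  have hsub : {ω | (M + N) * a n < |Y n ω + Z n ω|} ⊆
      {ω | M * a n < |Y n ω|} ∪ {ω | N * a n < |Z n ω|} := by
    intro ω hω
    simp only [Set.mem_ofPred_eq, Set.mem_union] at hω ⊢
    by_contra! hc
    have := abs_add_le (Y n ω) (Z n ω)
    linarith [hc.1, hc.2]
  refine (measure_mono hsub).trans ((measure_union_le _ _).trans ?_)
  refine (add_le_add hn hn2).trans ?_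
  rw [← ENNReal.ofReal_add (by positivity) (by positivity), add_halves]

lemma IsBigOP.mul {Y Z : ℕ → Ω → ℝ} {a b : ℕ → ℝ} (hY : IsBigOP P Y a) (hZ : IsBigOP P Z b)
    (ha : ∀ n, 0 ≤ a n) :
    IsBigOP P (fun n ω => Y n ω * Z n ω) (fun n => a n * b n) := by
  intro ε hε
  obtain ⟨M, hM, hMe⟩ := hY (ε / 2) (by positivity)
  obtain ⟨N, hN, hNe⟩ := hZ (ε / 2) (by positivity)
  refine ⟨M * N, by positivity, ?_⟩
  filter_upwards [hMe, hNe] with n hn hn2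
  have hsub : {ω | (M * N) * (a n * b n) < |Y n ω * Z n ω|} ⊆
      {ω | M * a n < |Y n ω|} ∪ {ω | N * b n < |Z n ω|} := by
    intro ω hω
    simp only [Set.mem_ofPred_eq, Set.mem_union] at hω ⊢
    by_contra! hc
    have h0 : |Y n ω * Z n ω| ≤ (M * a n) * (N * b n) := by
      rw [abs_mul]
      exact mul_le_mul hc.1 hc.2 (abs_nonneg _) (mul_nonneg hM.le (ha n))
    linarith [mul_mul_mul_comm M (a n) N (b n)]
  refine (measure_mono hsub).trans ((measure_union_le _ _).trans ?_)
  refine (add_le_add hn hn2).trans ?_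
  rw [← ENNReal.ofReal_add (by positivity) (by positivity), add_halves]

/-- A deterministic sequence is stochastically bounded by itself. -/
lemma isBigOP_const (P : Measure Ω) {a : ℕ → ℝ} (ha : ∀ n, 0 ≤ a n) :
    IsBigOP P (fun n _ => a n) a := by
  intro ε hε
  refine ⟨1, one_pos, Eventually.of_forall fun n => ?_⟩
  simp [abs_of_nonneg (ha n)]

lemma IsBigOP.tendsto_measure_zero {Y : ℕ → Ω → ℝ} {a : ℕ → ℝ} (hY : IsBigOP P Y a)
    (ha : Tendsto a atTop (𝓝 0)) {η : ℝ} (hη : 0 < η) :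
    Tendsto (fun n => P {ω | η ≤ |Y n ω|}) atTop (𝓝 0) := by
  rw [ENNReal.tendsto_nhds_zero]
  intro ε hε
  obtain ⟨δ, hδ, hδε⟩ : ∃ δ : ℝ, 0 < δ ∧ ENNReal.ofReal δ ≤ ε := by
    rcases eq_or_ne ε ⊤ with rfl | hne
    · exact ⟨1, one_pos, le_top⟩
    · exact ⟨ε.toReal, ENNReal.toReal_pos hε.ne' hne, by rw [ENNReal.ofReal_toReal hne]⟩
  obtain ⟨M, hM, hMe⟩ := hY δ hδ
  have hlim : Tendsto (fun n => M * a n) atTop (𝓝 0) := by simpa using ha.const_mul M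
  filter_upwards [hMe, hlim.eventually (gt_mem_nhds hη)] with n hn hn2
  refine (measure_mono fun ω hω => ?_).trans (hn.trans hδε)
  simp only [Set.mem_ofPred_eq] at hω ⊢
  linarith

end BigOP

/-! ### Moments of averages and degenerate U-statistics -/

section IID

variable {Ω : Type*} [MeasurableSpace Ω] {P : Measure Ω} [IsProbabilityMeasure P]
  {μ : Measure ℝ} [IsProbabilityMeasure μ] {X : ℕ → Ω → ℝ}

omit [IsProbabilityMeasure P] [IsProbabilityMeasure μ] in
lemma integral_comp_law (hX : ∀ i, Measurable (X i)) (hlaw : ∀ i, P.map (X i) = μ)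
    {E : Type*} [NormedAddCommGroup E] [NormedSpace ℝ E] {φ : ℝ → E}
    (hφ : StronglyMeasurable φ) (i : ℕ) :
    ∫ ω, φ (X i ω) ∂P = ∫ a, φ a ∂μ := by
  rw [← hlaw i, integral_map (hX i).aemeasurable hφ.aestronglyMeasurable]

lemma integrable_of_abs_le {α : Type*} [MeasurableSpace α] {ν : Measure α} [IsFiniteMeasure ν]
    {φ : α → ℝ} (hφ : Measurable φ) {b : ℝ} (hb : ∀ a, |φ a| ≤ b) : Integrable φ ν :=
  Integrable.of_bound hφ.aestronglyMeasurable b (ae_of_all _ hb)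

omit [IsProbabilityMeasure μ] in
/-- The mean squared error of a sample average is at most the second moment over `n`. -/
lemma integral_sq_average_sub_le (hX : ∀ i, Measurable (X i)) (hind : iIndepFun X P)
    (hlaw : ∀ i, P.map (X i) = μ) {φ : ℝ → ℝ} (hφ : Measurable φ) {b : ℝ} (hb : ∀ a, |φ a| ≤ b)
    {n : ℕ} (hn : 0 < n) :
    ∫ ω, ((1 / (n : ℝ)) * ∑ i ∈ Finset.range n, φ (X i ω) - ∫ a, φ a ∂μ) ^ 2 ∂P
      ≤ (1 / (n : ℝ)) * ∫ a, φ a ^ 2 ∂μ := by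
  have hn0 : (n : ℝ) ≠ 0 := by positivity
  have hmem : ∀ i, MemLp (fun ω => φ (X i ω)) 2 P := fun i =>
    MemLp.of_bound (hφ.comp (hX i)).aestronglyMeasurable b (ae_of_all _ fun ω => hb _)
  have hmean : ∀ i, ∫ ω, φ (X i ω) ∂P = ∫ a, φ a ∂μ :=
    fun i => integral_comp_law hX hlaw hφ.stronglyMeasurable i
  have hvar : ∀ i, Var[fun ω => φ (X i ω); P] ≤ ∫ a, φ a ^ 2 ∂μ := fun i => by
    refine (variance_le_expectation_sq (hφ.comp (hX i)).aestronglyMeasurable).trans ?_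
    rw [← integral_comp_law hX hlaw (hφ.pow_const 2).stronglyMeasurable i]
    rfl
  have hsum : Var[∑ i ∈ Finset.range n, (fun ω => φ (X i ω)); P]
      = ∑ i ∈ Finset.range n, Var[fun ω => φ (X i ω); P] :=
    IndepFun.variance_sum (fun i _ => hmem i) fun i _ j _ hij =>
      (hind.indepFun hij).comp hφ hφ
  have hS : (fun ω => (1 / (n : ℝ)) * ∑ i ∈ Finset.range n, φ (X i ω))
      = fun ω => (1 / (n : ℝ)) * (∑ i ∈ Finset.range n, (fun ω => φ (X i ω))) ω := by
    ext ω; simp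
  have hSm : Measurable (fun ω => (1 / (n : ℝ)) * ∑ i ∈ Finset.range n, φ (X i ω)) :=
    (Finset.measurable_fun_sum _ fun i _ => hφ.comp (hX i)).const_mul _
  have hES : ∫ ω, (1 / (n : ℝ)) * ∑ i ∈ Finset.range n, φ (X i ω) ∂P = ∫ a, φ a ∂μ := by
    rw [integral_const_mul, integral_finsetSum _ fun i _ => (hmem i).integrable (by norm_num)]
    simp only [hmean, Finset.sum_const, Finset.card_range, nsmul_eq_mul]
    field_simp
  have h := variance_eq_integral (μ := P) hSm.aemeasurable
  rw [hES] at h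
  rw [← h, hS, variance_const_mul, hsum]
  calc (1 / (n : ℝ)) ^ 2 * ∑ i ∈ Finset.range n, Var[fun ω => φ (X i ω); P]
      ≤ (1 / (n : ℝ)) ^ 2 * ∑ i ∈ Finset.range n, ∫ a, φ a ^ 2 ∂μ := by
        gcongr with i _; exact hvar i
    _ = (1 / (n : ℝ)) * ∫ a, φ a ^ 2 ∂μ := by
        simp only [Finset.sum_const, Finset.card_range, nsmul_eq_mul]; field_simp

lemma integral_eq_zero_of_indepFun {α β : Type*} [MeasurableSpace α] [MeasurableSpace β]
    {U : Ω → α} {V : Ω → β} (hU : Measurable U) (hV : Measurable V) (hUV : IndepFun U V P)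
    {Φ : α × β → ℝ} (hΦ : Measurable Φ) {b : ℝ} (hb : ∀ p, |Φ p| ≤ b)
    (h0 : ∀ v, ∫ u, Φ (u, v) ∂(P.map U) = 0) : ∫ ω, Φ (U ω, V ω) ∂P = 0 := by
  have : IsProbabilityMeasure (P.map U) := Measure.isProbabilityMeasure_map hU.aemeasurable
  have : IsProbabilityMeasure (P.map V) := Measure.isProbabilityMeasure_map hV.aemeasurable
  rw [← integral_map (φ := fun ω => (U ω, V ω)) (f := Φ) (hU.prodMk hV).aemeasurable
    hΦ.aestronglyMeasurable, (indepFun_iff_map_prod_eq_prod_map_map hU.aemeasurable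
    hV.aemeasurable).1 hUV, integral_prod_symm _ (integrable_of_abs_le hΦ hb)]
  simp [h0]

omit [IsProbabilityMeasure P] in
/-- An observation is independent of any finite family of the others. -/
lemma indepFun_of_notMem (hX : ∀ i, Measurable (X i)) (hind : iIndepFun X P) {i : ℕ}
    {T : Finset ℕ} (hi : i ∉ T) : IndepFun (X i) (fun ω (m : T) => X m ω) P := by
  have h := hind.indepFun_finset {i} T (by simpa using hi) hX
  exact h.comp (φ := fun v : (({i} : Finset ℕ) → ℝ) => v ⟨i, by simp⟩) (ψ := id)
    (measurable_pi_apply _) measurable_id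

lemma integral_pair_law (hX : ∀ i, Measurable (X i)) (hind : iIndepFun X P)
    (hlaw : ∀ i, P.map (X i) = μ) {Φ : ℝ → ℝ → ℝ} (hΦ : Measurable (Function.uncurry Φ))
    {b : ℝ} (hb : ∀ p q, |Φ p q| ≤ b) {i j : ℕ} (hij : i ≠ j) :
    ∫ ω, Φ (X i ω) (X j ω) ∂P = ∫ a, ∫ y, Φ a y ∂μ ∂μ := by
  have h1 := integral_map (μ := P) (φ := fun ω => (X i ω, X j ω)) (f := Function.uncurry Φ)
    ((hX i).prodMk (hX j)).aemeasurable hΦ.aestronglyMeasurable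
  rw [(indepFun_iff_map_prod_eq_prod_map_map (hX i).aemeasurable
    (hX j).aemeasurable).1 (hind.indepFun hij), hlaw, hlaw,
    integral_prod _ (integrable_of_abs_le hΦ fun p => hb _ _)] at h1
  exact h1.symm

omit [IsProbabilityMeasure μ] in
/-- Two terms of a degenerate U-statistic are orthogonal unless they involve the same two
observations: otherwise some observation enters only one of them, and integrating it out gives
zero. -/
lemma integral_degenerate_mul_eq_zero (hX : ∀ i, Measurable (X i)) (hind : iIndepFun X P)
    (hlaw : ∀ i, P.map (X i) = μ) {W : ℝ → ℝ → ℝ} (hW : Measurable (Function.uncurry W))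
    {b : ℝ} (hb : ∀ p q, |W p q| ≤ b) (hW1 : ∀ y, ∫ a, W a y ∂μ = 0)
    (hW2 : ∀ a, ∫ y, W a y ∂μ = 0) {i j k l : ℕ} (hij : i ≠ j)
    (h1 : ¬(k = i ∧ l = j)) (h2 : ¬(k = j ∧ l = i)) :
    ∫ ω, W (X i ω) (X j ω) * W (X k ω) (X l ω) ∂P = 0 := by
  have hb0 : 0 ≤ b := (abs_nonneg _).trans (hb 0 0)
  have hbb : ∀ p q r s, |W p q * W r s| ≤ b * b := fun p q r s => by
    rw [abs_mul]; exact mul_le_mul (hb _ _) (hb _ _) (abs_nonneg _) hb0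
  have hm : ∀ (T : Finset ℕ), Measurable (fun ω (m : T) => X m ω) := fun T =>
    measurable_pi_lambda _ fun m => hX m
  have hWc : ∀ {T : Finset ℕ} {u v : ℝ × (T → ℝ) → ℝ}, Measurable u → Measurable v →
      Measurable fun c => W (u c) (v c) := fun hu hv => hW.comp (hu.prodMk hv)
  by_cases hi : i = k ∨ i = l
  · have hj : j ≠ k ∧ j ≠ l := by
      constructor <;> rintro rfl <;> rcases hi with rfl | rfl <;> simp_all
    have hnot : j ∉ ({i, k, l} : Finset ℕ) := by simp [hij.symm, hj.1, hj.2]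
    let Φ : ℝ × (({i, k, l} : Finset ℕ) → ℝ) → ℝ := fun p =>
      W (p.2 ⟨i, by simp⟩) p.1 * W (p.2 ⟨k, by simp⟩) (p.2 ⟨l, by simp⟩)
    have hΦ : Measurable Φ :=
      (hWc (by fun_prop) (by fun_prop)).mul (hWc (by fun_prop) (by fun_prop))
    refine integral_eq_zero_of_indepFun (Φ := Φ) (hX j) (hm _)
      (indepFun_of_notMem hX hind hnot) hΦ (fun p => hbb _ _ _ _) fun v => ?_
    simp only [Φ, hlaw]
    rw [integral_mul_const, hW2, zero_mul]
  · push Not at hi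
    have hnot : i ∉ ({j, k, l} : Finset ℕ) := by simp [hij, hi.1, hi.2]
    let Φ : ℝ × (({j, k, l} : Finset ℕ) → ℝ) → ℝ := fun p =>
      W p.1 (p.2 ⟨j, by simp⟩) * W (p.2 ⟨k, by simp⟩) (p.2 ⟨l, by simp⟩)
    have hΦ : Measurable Φ :=
      (hWc (by fun_prop) (by fun_prop)).mul (hWc (by fun_prop) (by fun_prop))
    refine integral_eq_zero_of_indepFun (Φ := Φ) (hX i) (hm _)
      (indepFun_of_notMem hX hind hnot) hΦ (fun p => hbb _ _ _ _) fun v => ?_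
    simp only [Φ, hlaw]
    rw [integral_mul_const, hW1, zero_mul]

/-- The second moment of a degenerate U-statistic is of the order of its number of terms. -/
lemma integral_sq_degenerate_le (hX : ∀ i, Measurable (X i)) (hind : iIndepFun X P)
    (hlaw : ∀ i, P.map (X i) = μ) {W : ℝ → ℝ → ℝ} (hW : Measurable (Function.uncurry W))
    {b : ℝ} (hb : ∀ p q, |W p q| ≤ b) (hW1 : ∀ y, ∫ a, W a y ∂μ = 0)
    (hW2 : ∀ a, ∫ y, W a y ∂μ = 0) (n : ℕ) :
    ∫ ω, (∑ i ∈ Finset.range n, ∑ j ∈ (Finset.range n).erase i, W (X i ω) (X j ω)) ^ 2 ∂P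
      ≤ 2 * (n : ℝ) ^ 2 * ∫ a, ∫ y, W a y ^ 2 ∂μ ∂μ := by
  set V := ∫ a, ∫ y, W a y ^ 2 ∂μ ∂μ with hVdef
  have hV0 : 0 ≤ V := integral_nonneg fun a => integral_nonneg fun y => sq_nonneg _
  have hb0 : 0 ≤ b := (abs_nonneg _).trans (hb 0 0)
  have hmeas : ∀ p : ℕ × ℕ, Measurable (fun ω => W (X p.1 ω) (X p.2 ω)) := fun p =>
    hW.comp ((hX p.1).prodMk (hX p.2))
  have hint : ∀ p q : ℕ × ℕ,
      Integrable (fun ω => W (X p.1 ω) (X p.2 ω) * W (X q.1 ω) (X q.2 ω)) P := fun p q =>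
    integrable_of_abs_le ((hmeas p).mul (hmeas q)) (b := b * b) fun ω => by
      rw [abs_mul]; exact mul_le_mul (hb _ _) (hb _ _) (abs_nonneg _) hb0
  have hsq : ∀ p : ℕ × ℕ, p.1 ≠ p.2 → ∫ ω, W (X p.1 ω) (X p.2 ω) ^ 2 ∂P = V := fun p hp =>
    integral_pair_law (Φ := fun a y => W a y ^ 2) hX hind hlaw (hW.pow_const 2) (b := b ^ 2)
      (fun a y => by rw [abs_pow]; exact pow_le_pow_left₀ (abs_nonneg _) (hb _ _) 2) hp
  have hterm : ∀ p ∈ (Finset.range n).offDiag, ∀ q ∈ (Finset.range n).offDiag,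
      ∫ ω, W (X p.1 ω) (X p.2 ω) * W (X q.1 ω) (X q.2 ω) ∂P
        ≤ (if q = p then V else 0) + (if q = p.swap then V else 0) := by
    intro p hp q hq
    have hp' : p.1 ≠ p.2 := (Finset.mem_offDiag.1 hp).2.2
    have hq' : q.1 ≠ q.2 := (Finset.mem_offDiag.1 hq).2.2
    have hle : ∫ ω, W (X p.1 ω) (X p.2 ω) * W (X q.1 ω) (X q.2 ω) ∂P ≤ V := by
      have hi1 : ∀ p : ℕ × ℕ, Integrable (fun ω => W (X p.1 ω) (X p.2 ω) ^ 2) P := fun p => by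
        simpa [sq] using hint p p
      calc ∫ ω, W (X p.1 ω) (X p.2 ω) * W (X q.1 ω) (X q.2 ω) ∂P
          ≤ ∫ ω, (1 / 2 : ℝ) * (W (X p.1 ω) (X p.2 ω) ^ 2 + W (X q.1 ω) (X q.2 ω) ^ 2) ∂P := by
            refine integral_mono (hint p q) (((hi1 p).add (hi1 q)).const_mul _) fun ω => ?_
            have := sq_nonneg (W (X p.1 ω) (X p.2 ω) - W (X q.1 ω) (X q.2 ω))
            simp only
            nlinarith
        _ = V := by
            rw [integral_const_mul, integral_add (hi1 p) (hi1 q), hsq p hp', hsq q hq']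
            ring
    by_cases e1 : q = p
    · rw [if_pos e1]
      split_ifs <;> linarith
    by_cases e2 : q = p.swap
    · rw [if_pos e2, if_neg e1]
      linarith
    rw [if_neg e1, if_neg e2, add_zero]
    refine (integral_degenerate_mul_eq_zero hX hind hlaw hW hb hW1 hW2 hp' ?_ ?_).le
    · rintro ⟨h1, h2⟩
      exact e1 (Prod.ext h1 h2)
    · rintro ⟨h1, h2⟩
      exact e2 (Prod.ext h1 h2)
  have hrw : ∀ ω, ∑ i ∈ Finset.range n, ∑ j ∈ (Finset.range n).erase i, W (X i ω) (X j ω)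
      = ∑ p ∈ (Finset.range n).offDiag, W (X p.1 ω) (X p.2 ω) := fun ω => by
    rw [Finset.sum_sigma']
    refine Finset.sum_bij' (fun s _ => (s.1, s.2)) (fun p _ => ⟨p.1, p.2⟩) ?_ ?_ ?_ ?_ ?_
    · rintro ⟨i, j⟩ hs
      simp only [Finset.mem_sigma, Finset.mem_erase, Finset.mem_offDiag] at hs ⊢
      exact ⟨hs.1, hs.2.2, hs.2.1.symm⟩
    · rintro ⟨i, j⟩ hs
      simp only [Finset.mem_sigma, Finset.mem_erase, Finset.mem_offDiag] at hs ⊢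
      exact ⟨hs.1, hs.2.2.symm, hs.2.1⟩
    · intros; rfl
    · intros; rfl
    · intros; rfl
  simp only [hrw, sq, Finset.sum_mul_sum]
  rw [integral_finsetSum _ fun p _ => integrable_finsetSum _ fun q _ => hint p q]
  calc ∑ p ∈ (Finset.range n).offDiag, ∫ ω, ∑ q ∈ (Finset.range n).offDiag,
        W (X p.1 ω) (X p.2 ω) * W (X q.1 ω) (X q.2 ω) ∂P
      ≤ ∑ p ∈ (Finset.range n).offDiag, (V + V) := by
        refine Finset.sum_le_sum fun p hp => ?_
        rw [integral_finsetSum _ fun q _ => hint p q]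
        refine (Finset.sum_le_sum fun q hq => hterm p hp q hq).trans ?_
        rw [Finset.sum_add_distrib, Finset.sum_ite_eq', Finset.sum_ite_eq']
        split_ifs <;> linarith
    _ ≤ 2 * ((n : ℝ) * n) * V := by
        rw [Finset.sum_const, nsmul_eq_mul]
        have hc : (((Finset.range n).offDiag.card : ℕ) : ℝ) ≤ (n : ℝ) * n := by
          rw [Finset.offDiag_card, Finset.card_range]
          calc ((n * n - n : ℕ) : ℝ) ≤ ((n * n : ℕ) : ℝ) := by
                exact_mod_cast Nat.sub_le _ _
            _ = (n : ℝ) * n := by push_cast; ring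
        nlinarith [mul_le_mul_of_nonneg_right hc hV0]

end IID

/-! ### The design near the evaluation point -/

section Design

variable {d : ℕ} {μ : Measure ℝ} [IsProbabilityMeasure μ] {x : ℝ} {f K : ℝ → ℝ}
  {R : ℝ → Vec d} {Υ : ℝ → Fin d → ℝ}

lemma restrict_eq_withDensity_of_cdf {a b : ℝ} (hint : IntegrableOn f (Set.Icc a b))
    (hf : ∀ y ∈ Set.Icc a b, 0 ≤ f y)
    (hcdf : ∀ y ∈ Set.Icc a b, cdf μ y = cdf μ a + ∫ t in a..y, f t) :
    μ.restrict (Set.Ioc a b)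
      = (volume.restrict (Set.Ioc a b)).withDensity (fun y => ENNReal.ofReal (f y)) := by
  refine Measure.ext_of_Iic _ _ fun c => ?_
  have hset : Set.Iic c ∩ Set.Ioc a b = Set.Ioc a (min c b) := by
    ext y; simp only [Set.mem_inter_iff, Set.mem_Iic, Set.mem_Ioc, le_min_iff]; tauto
  rw [Measure.restrict_apply measurableSet_Iic, withDensity_apply _ measurableSet_Iic,
    Measure.restrict_restrict measurableSet_Iic, hset]
  rcases le_total (min c b) a with hle | hle
  · simp [Set.Ioc_eq_empty_of_le hle]
  have hsub : Set.Ioc a (min c b) ⊆ Set.Icc a b := fun y hy =>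
    ⟨hy.1.le, hy.2.trans (min_le_right _ _)⟩
  rw [← ofReal_integral_eq_lintegral_ofReal (hint.mono_set hsub)
    ((ae_restrict_iff' measurableSet_Ioc).2 (ae_of_all _ fun y hy => hf y (hsub hy))),
    ← intervalIntegral.integral_of_le hle]
  conv_lhs => rw [← measure_cdf μ]
  rw [StieltjesFunction.measure_Ioc, hcdf _ ⟨hle, min_le_right _ _⟩]
  congr 1
  ring

lemma PointwiseAssumption.exists_local_density (hA : PointwiseAssumption μ x f K R Υ) :
    ∃ δ B : ℝ, 0 < δ ∧ 0 < B ∧ IntegrableOn f (Set.Ioc (x - δ) (x + δ)) ∧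
      (∀ y ∈ Set.Ioc (x - δ) (x + δ), 0 ≤ f y) ∧
      (∀ y ∈ Set.Ioc (x - δ) (x + δ), f y ≤ B) ∧
      μ.restrict (Set.Ioc (x - δ) (x + δ)) = (volume.restrict
        (Set.Ioc (x - δ) (x + δ))).withDensity (fun y => ENNReal.ofReal (f y)) := by
  obtain ⟨δ, hδ, hint, hf, hcdf, fm, fp, dfm, dfp, ⟨Cm, hCm⟩, ⟨Cp, hCp⟩⟩ := hA.density
  have hbd : ∀ (C g0 g1 u : ℝ), 0 < u ^ 2 → |u| ≤ δ → (f (x + u) - g0 - u * g1) / u ^ 2 ≤ C →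
      f (x + u) ≤ |g0| + δ * |g1| + |C| * δ ^ 2 := by
    intro C g0 g1 u hu huδ h
    rw [div_le_iff₀ hu] at h
    have h1 : u * g1 ≤ δ * |g1| := (le_abs_self _).trans (by rw [abs_mul]; gcongr)
    have h2 : C * u ^ 2 ≤ |C| * δ ^ 2 := by
      rw [← sq_abs u]
      exact mul_le_mul (le_abs_self _) (by gcongr) (by positivity) (abs_nonneg _)
    linarith [le_abs_self g0]
  refine ⟨δ, (|fm| + δ * |dfm| + |Cm| * δ ^ 2) + (|fp| + δ * |dfp| + |Cp| * δ ^ 2)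
    + (|f x| + 1), hδ, by positivity, hint.mono_set Set.Ioc_subset_Icc_self,
    fun y hy => hf y (Set.Ioc_subset_Icc_self hy), fun y hy => ?_,
    restrict_eq_withDensity_of_cdf hint hf hcdf⟩
  have hp1 : 0 ≤ |fm| + δ * |dfm| + |Cm| * δ ^ 2 := by positivity
  have hp2 : 0 ≤ |fp| + δ * |dfp| + |Cp| * δ ^ 2 := by positivity
  have hy' : y = x + (y - x) := by ring
  rcases lt_trichotomy y x with h | h | h
  · have h0 : y - x < 0 := by linarith
    have := hbd Cm fm dfm (y - x) (sq_pos_of_ne_zero h0.ne)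
      (abs_le.2 ⟨by linarith [hy.1], by linarith⟩)
      (hCm ⟨y - x, ⟨by linarith [hy.1], h0⟩, rfl⟩)
    rw [← hy'] at this
    linarith [abs_nonneg (f x)]
  · rw [h]; linarith [le_abs_self (f x)]
  · have h0 : 0 < y - x := by linarith
    have := hbd Cp fp dfp (y - x) (by positivity) (abs_le.2 ⟨by linarith, by linarith [hy.2]⟩)
      (hCp ⟨y - x, ⟨h0, by linarith [hy.2]⟩, rfl⟩)
    rw [← hy'] at this
    linarith [abs_nonneg (f x)]

omit [IsProbabilityMeasure μ] in
lemma measure_Icc_le_of_density {δ B h : ℝ} (hB : 0 < B)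
    (hfB : ∀ y ∈ Set.Ioc (x - δ) (x + δ), f y ≤ B)
    (hμ : μ.restrict (Set.Ioc (x - δ) (x + δ)) = (volume.restrict
        (Set.Ioc (x - δ) (x + δ))).withDensity (fun y => ENNReal.ofReal (f y))) (hh : h < δ) :
    μ (Set.Icc (x - h) (x + h)) ≤ ENNReal.ofReal (2 * B * h) := by
  have hsub : Set.Icc (x - h) (x + h) ⊆ Set.Ioc (x - δ) (x + δ) := fun y hy =>
    ⟨by linarith [hy.1], by linarith [hy.2]⟩
  rw [← Measure.restrict_eq_self μ hsub, hμ, withDensity_apply _ measurableSet_Icc,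
    Measure.restrict_restrict measurableSet_Icc, Set.inter_eq_left.2 hsub]
  calc ∫⁻ y in Set.Icc (x - h) (x + h), ENNReal.ofReal (f y)
      ≤ ∫⁻ y in Set.Icc (x - h) (x + h), ENNReal.ofReal B :=
        setLIntegral_mono measurable_const fun y hy => ENNReal.ofReal_le_ofReal (hfB y (hsub hy))
    _ = ENNReal.ofReal (2 * B * h) := by
        rw [setLIntegral_const, Real.volume_Icc, ← ENNReal.ofReal_mul hB.le]
        congr 1; ring

omit [IsProbabilityMeasure μ] in
/-- Substitution `y = x + h u`: an integral against `K(u) f(x + h u) du` over the rescaled support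
is an integral against the design with kernel weight. No measurability of `φ` is needed. -/
lemma integral_scaledSupport {E : Type*} [NormedAddCommGroup E] [NormedSpace ℝ E]
    {δ h : ℝ} (hint : IntegrableOn f (Set.Ioc (x - δ) (x + δ)))
    (hf : ∀ y ∈ Set.Ioc (x - δ) (x + δ), 0 ≤ f y)
    (hμ : μ.restrict (Set.Ioc (x - δ) (x + δ)) = (volume.restrict
        (Set.Ioc (x - δ) (x + δ))).withDensity (fun y => ENNReal.ofReal (f y)))
    (hK : ∀ u, 1 < |u| → K u = 0) (h0 : 0 < h) (hh : h < δ) (φ : ℝ → E) :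
    ∫ u in scaledSupport μ x h, (K u * f (x + h * u)) • φ u
      = ∫ y, kernelWeight K h x y • φ ((y - x) / h) ∂μ := by
  set I := Set.Ioc (x - δ) (x + δ) with hI
  have hsupp : MeasurableSet μ.support := Measure.isClosed_support.measurableSet
  have hscaled : MeasurableSet (scaledSupport μ x h) :=
    hsupp.preimage (f := fun u => x + h * u) (by fun_prop)
  let G : ℝ → E := μ.support.indicator fun y => (K ((y - x) / h) * f y) • φ ((y - x) / h)
  have hG : ∀ u, (scaledSupport μ x h).indicator
      (fun u => (K u * f (x + h * u)) • φ u) u = G (x + h * u) := by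
    intro u
    by_cases hu : x + h * u ∈ μ.support
    · have hu' : u ∈ scaledSupport μ x h := hu
      have : (x + h * u - x) / h = u := by field_simp; ring
      simp only [G, Set.indicator_of_mem hu, Set.indicator_of_mem hu', this]
    · have hu' : u ∉ scaledSupport μ x h := hu
      simp only [G, Set.indicator_of_notMem hu, Set.indicator_of_notMem hu']
  have hK0 : ∀ y, y ∉ I → K ((y - x) / h) = 0 := by
    intro y hy
    apply hK
    rw [abs_div, abs_of_pos h0, one_lt_div h0]
    by_contra! hc
    exact hy ⟨by linarith [(abs_le.1 hc).1], by linarith [(abs_le.1 hc).2]⟩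
  have hae : ∀ᵐ y ∂(μ.restrict I), y ∈ μ.support := ae_restrict_of_ae Measure.support_mem_ae
  calc ∫ u in scaledSupport μ x h, (K u * f (x + h * u)) • φ u
      = ∫ u, G (x + h * u) := by
        rw [← integral_indicator hscaled]; simp only [hG]
    _ = h⁻¹ • ∫ y, G y := by
        rw [Measure.integral_comp_mul_left (fun z => G (x + z)) h,
          integral_add_left_eq_self G x, abs_of_pos (inv_pos.2 h0)]
    _ = h⁻¹ • ∫ y in I, G y := by
        rw [setIntegral_eq_integral_of_forall_compl_eq_zero]
        intro y hy
        by_cases hs : y ∈ μ.support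
        · simp only [G, Set.indicator_of_mem hs, hK0 y hy, zero_mul, zero_smul]
        · simp only [G, Set.indicator_of_notMem hs]
    _ = h⁻¹ • ∫ y in I, (ENNReal.ofReal (f y)).toReal •
          μ.support.indicator (fun y => K ((y - x) / h) • φ ((y - x) / h)) y := by
        congr 1
        refine setIntegral_congr_fun measurableSet_Ioc fun y hy => ?_
        by_cases hs : y ∈ μ.support
        · simp only [G, Set.indicator_of_mem hs, ENNReal.toReal_ofReal (hf y hy)]
          rw [smul_smul, mul_comm]
        · simp only [G, Set.indicator_of_notMem hs, smul_zero]
    _ = h⁻¹ • ∫ y in I,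
          μ.support.indicator (fun y => K ((y - x) / h) • φ ((y - x) / h)) y ∂μ := by
        rw [hμ, integral_withDensity_eq_integral_toReal_smul₀
          hint.aestronglyMeasurable.aemeasurable.ennreal_ofReal
          (ae_of_all _ fun y => ENNReal.ofReal_lt_top)]
    _ = h⁻¹ • ∫ y in I, K ((y - x) / h) • φ ((y - x) / h) ∂μ := by
        congr 1
        refine integral_congr_ae ?_
        filter_upwards [hae] with y hy
        rw [Set.indicator_of_mem hy]
    _ = h⁻¹ • ∫ y, K ((y - x) / h) • φ ((y - x) / h) ∂μ := by
        rw [setIntegral_eq_integral_of_forall_compl_eq_zero]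
        intro y hy
        rw [hK0 y hy, zero_smul]
    _ = ∫ y, kernelWeight K h x y • φ ((y - x) / h) ∂μ := by
        rw [← integral_smul]
        simp only [kernelWeight, smul_smul, one_div]

end Design

/-! ### Kernel weights and the linear term at a fixed bandwidth -/

section LocalDesign

variable {d : ℕ} {μ : Measure ℝ} [IsProbabilityMeasure μ] {x : ℝ} {f K : ℝ → ℝ}
  {R : ℝ → Vec d} {Υ : ℝ → Fin d → ℝ}

/-- The kernel-weighted basis `h⁻¹ K((y - x)/h) R((y - x)/h)`. -/
def weightedBasis (x : ℝ) (K : ℝ → ℝ) (R : ℝ → Vec d) (h y : ℝ) : Vec d :=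
  kernelWeight K h x y • R ((y - x) / h)

/-- The centred indicator `𝟙(a ≤ y) - F(y)`. -/
def centredInd (μ : Measure ℝ) (a y : ℝ) : ℝ := indLe a y - cdf μ y

/-- The linear term of an observation, as an integral against the design. For small `h` it agrees
with `influence`, and it is measurable in the observation for every `h`. -/
def designInfluence (μ : Measure ℝ) (x : ℝ) (K : ℝ → ℝ) (R : ℝ → Vec d) (h a : ℝ) : Vec d :=
  ∫ y, centredInd μ a y • weightedBasis x K R h y ∂μ

/-- What the moment bounds use about the design, the kernel and the basis at bandwidth `h`. -/
structure LocalDesign (μ : Measure ℝ) (x : ℝ) (K : ℝ → ℝ) (R : ℝ → Vec d) (h C : ℝ) : Prop where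
  bandwidth_pos : 0 < h
  const_pos : 0 < C
  measurable_kernel : Measurable K
  measurable_basis : Measurable R
  kernel_eq_zero : ∀ u, 1 < |u| → K u = 0
  kernel_nonneg : ∀ u, 0 ≤ K u
  kernel_le : ∀ u, K u ≤ C
  basis_le : ∀ u, |u| ≤ 1 → ‖R u‖ ≤ C
  measure_le : μ (Set.Icc (x - h) (x + h)) ≤ ENNReal.ofReal (C * h)

/-- The substitution `y = x + h u` turns integrals against `K(u) f(x + h u) du` over the rescaled
support into integrals against the design. -/
def LocalSubstitution (μ : Measure ℝ) (x : ℝ) (f K : ℝ → ℝ) (h : ℝ) : Prop :=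
  ∀ (E : Type) [NormedAddCommGroup E] [NormedSpace ℝ E] (φ : ℝ → E),
    ∫ u in scaledSupport μ x h, (K u * f (x + h * u)) • φ u
      = ∫ y, kernelWeight K h x y • φ ((y - x) / h) ∂μ

lemma exists_bound_of_locally_bounded {R : ℝ → Vec d}
    (hR : ∀ u₀, ∃ C : ℝ, ∀ᶠ u in 𝓝 u₀, ‖R u‖ ≤ C) {s : Set ℝ} (hs : IsCompact s) :
    ∃ C : ℝ, ∀ u ∈ s, ‖R u‖ ≤ C := by
  refine hs.induction_on (p := fun s => ∃ C : ℝ, ∀ u ∈ s, ‖R u‖ ≤ C) ⟨0, by simp⟩ ?_ ?_ ?_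
  · rintro s t hst ⟨C, hC⟩
    exact ⟨C, fun u hu => hC u (hst hu)⟩
  · rintro s t ⟨C, hC⟩ ⟨D, hD⟩
    refine ⟨max C D, fun u hu => ?_⟩
    rcases hu with hu | hu
    · exact (hC u hu).trans (le_max_left _ _)
    · exact (hD u hu).trans (le_max_right _ _)
  · intro u _
    obtain ⟨C, hC⟩ := hR u
    exact ⟨_, mem_nhdsWithin_of_mem_nhds hC, C, fun v hv => hv⟩

omit [IsProbabilityMeasure μ] in
lemma PointwiseAssumption.kernel_eq_zero (hA : PointwiseAssumption μ x f K R Υ) (u : ℝ)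
    (hu : 1 < |u|) : K u = 0 := by
  apply image_eq_zero_of_notMem_tsupport
  rw [hA.kernel_support, Set.mem_Icc, ← abs_le]
  exact not_le.2 hu

omit [IsProbabilityMeasure μ] in
lemma PointwiseAssumption.kernel_measurable (hA : PointwiseAssumption μ x f K R Υ) :
    Measurable K := by
  classical
  have h := hA.kernel_continuousOn.measurable_piecewise (g := fun _ => (0 : ℝ))
    continuousOn_const measurableSet_Icc
  convert h using 1
  ext u
  by_cases hu : u ∈ Set.Icc (-1 : ℝ) 1
  · simp only [Set.piecewise_eq_of_mem _ _ _ hu]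
  · rw [Set.piecewise_eq_of_notMem _ _ _ hu]
    refine hA.kernel_eq_zero u ?_
    rw [Set.mem_Icc, ← abs_le] at hu
    exact not_le.1 hu

lemma PointwiseAssumption.exists_localDesign (hA : PointwiseAssumption μ x f K R Υ) :
    ∃ C δ : ℝ, 0 < C ∧ 0 < δ ∧ ∀ h, 0 < h → h < δ → LocalDesign μ x K R h C ∧
      LocalSubstitution μ x f K h := by
  obtain ⟨δ, B, hδ, hB, hint, hf, hfB, hμ⟩ := hA.exists_local_density
  obtain ⟨C1, hC1⟩ := isCompact_Icc.exists_bound_of_continuousOn hA.kernel_continuousOn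
  obtain ⟨C2, hC2⟩ := exists_bound_of_locally_bounded hA.basis_locallyBounded
    (isCompact_Icc (a := (-1 : ℝ)) (b := 1))
  have hC : 0 < |C1| + |C2| + 2 * B := by positivity
  refine ⟨|C1| + |C2| + 2 * B, δ, hC, hδ, fun h h0 hh => ⟨⟨h0, hC, hA.kernel_measurable,
    hA.basis_measurable, hA.kernel_eq_zero, hA.kernel_nonneg, fun u => ?_, fun u hu => ?_, ?_⟩,
    fun _ _ _ φ => integral_scaledSupport hint hf hμ hA.kernel_eq_zero h0 hh φ⟩⟩
  · rcases le_or_gt |u| 1 with hu | hu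
    · have := (le_abs_self _).trans (hC1 u (abs_le.1 hu))
      linarith [le_abs_self C1, abs_nonneg C2]
    · rw [hA.kernel_eq_zero u hu]; exact hC.le
  · have := hC2 u (abs_le.1 hu)
    linarith [le_abs_self C2, abs_nonneg C1]
  · refine (measure_Icc_le_of_density hB hfB hμ hh).trans (ENNReal.ofReal_le_ofReal ?_)
    gcongr
    linarith [abs_nonneg C1, abs_nonneg C2]

omit [IsProbabilityMeasure μ] in
lemma measurable_centredInd : Measurable (Function.uncurry (centredInd μ)) := by
  have h1 : Measurable (fun p : ℝ × ℝ => indLe p.1 p.2) :=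
    Measurable.ite (measurableSet_le measurable_fst measurable_snd) measurable_const
      measurable_const
  exact h1.sub ((monotone_cdf μ).measurable.comp measurable_snd)

omit [IsProbabilityMeasure μ] in
lemma abs_centredInd_le (a y : ℝ) : |centredInd μ a y| ≤ 1 := by
  have h0 := cdf_nonneg μ y
  have h1 := cdf_le_one μ y
  unfold centredInd indLe
  split_ifs <;> rw [abs_le] <;> constructor <;> linarith

lemma integral_indLe (y : ℝ) : ∫ a, indLe a y ∂μ = cdf μ y := by
  have : (fun a => indLe a y) = (Set.Iic y).indicator fun _ => (1 : ℝ) := by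
    ext a; simp [indLe, Set.indicator_apply]
  rw [this, integral_indicator measurableSet_Iic, cdf_eq_real]
  simp

lemma integrable_indLe (y : ℝ) : Integrable (fun a => indLe a y) μ := by
  refine integrable_of_abs_le (b := 1) (Measurable.ite (measurableSet_le measurable_id
    measurable_const) measurable_const measurable_const) fun a => ?_
  unfold indLe
  split_ifs <;> simp

lemma integral_centredInd (y : ℝ) : ∫ a, centredInd μ a y ∂μ = 0 := by
  unfold centredInd
  rw [integral_sub (integrable_indLe y) (integrable_const _), integral_indLe]
  simp

lemma integral_centredInd_mul (y z : ℝ) :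
    ∫ a, centredInd μ a y * centredInd μ a z ∂μ
      = cdf μ (min y z) - cdf μ y * cdf μ z := by
  have : ∀ a, centredInd μ a y * centredInd μ a z
      = indLe a (min y z) - cdf μ z * indLe a y - cdf μ y * indLe a z
        + cdf μ y * cdf μ z := fun a => by
    have hmin : indLe a (min y z) = indLe a y * indLe a z := by
      unfold indLe
      by_cases h1 : a ≤ y <;> by_cases h2 : a ≤ z <;> simp [h1, h2]
    rw [hmin]; unfold centredInd; ring
  simp only [this]
  rw [integral_add, integral_sub, integral_sub, integral_const_mul, integral_const_mul,
    integral_indLe, integral_indLe, integral_indLe]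
  · simp; ring
  · exact integrable_indLe _
  · exact (integrable_indLe _).const_mul _
  · exact (integrable_indLe _).sub ((integrable_indLe _).const_mul _)
  · exact (integrable_indLe _).const_mul _
  · exact ((integrable_indLe _).sub ((integrable_indLe _).const_mul _)).sub
      ((integrable_indLe _).const_mul _)
  · exact integrable_const _

omit [IsProbabilityMeasure μ] in
lemma integral_vec_apply {α : Type*} [MeasurableSpace α] {ν : Measure α} {φ : α → Vec d}
    (hφ : Integrable φ ν) (k : Fin d) : (∫ a, φ a ∂ν) k = ∫ a, φ a k ∂ν :=
  ((EuclideanSpace.proj k : Vec d →L[ℝ] ℝ).integral_comp_comm hφ).symm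

lemma measurable_kernelWeight (hK : Measurable K) (h x : ℝ) : Measurable (kernelWeight K h x) :=
  (hK.comp (by fun_prop)).const_mul _

lemma measurable_weightedBasis (hK : Measurable K) (hR : Measurable R) (h x : ℝ) :
    Measurable (weightedBasis x K R h) :=
  (measurable_kernelWeight hK h x).smul (hR.comp (by fun_prop))

lemma measurable_designInfluence (hK : Measurable K) (hR : Measurable R) (h x : ℝ) :
    Measurable (designInfluence μ x K R h) := by
  have : StronglyMeasurable (fun p : ℝ × ℝ => centredInd μ p.1 p.2 • weightedBasis x K R h p.2) :=
    (measurable_centredInd.smul ((measurable_weightedBasis hK hR h x).comp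
      measurable_snd)).stronglyMeasurable
  exact this.integral_prod_right'.measurable

namespace LocalDesign

variable {h C : ℝ}

omit [IsProbabilityMeasure μ] in
lemma measurable_kernelWeight (hD : LocalDesign μ x K R h C) : Measurable (kernelWeight K h x) :=
  LocalDistribution.measurable_kernelWeight hD.measurable_kernel h x

omit [IsProbabilityMeasure μ] in
lemma kernelWeight_nonneg (hD : LocalDesign μ x K R h C) (y : ℝ) : 0 ≤ kernelWeight K h x y :=
  mul_nonneg (one_div_nonneg.2 hD.bandwidth_pos.le) (hD.kernel_nonneg _)

omit [IsProbabilityMeasure μ] in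
lemma kernelWeight_eq_zero (hD : LocalDesign μ x K R h C) {y : ℝ}
    (hy : y ∉ Set.Icc (x - h) (x + h)) : kernelWeight K h x y = 0 := by
  have : K ((y - x) / h) = 0 := by
    apply hD.kernel_eq_zero
    rw [abs_div, abs_of_pos hD.bandwidth_pos, one_lt_div hD.bandwidth_pos]
    by_contra! hc
    exact hy ⟨by linarith [(abs_le.1 hc).1], by linarith [(abs_le.1 hc).2]⟩
  simp [kernelWeight, this]

omit [IsProbabilityMeasure μ] in
lemma norm_basis_le (hD : LocalDesign μ x K R h C) {y : ℝ}
    (hy : y ∈ Set.Icc (x - h) (x + h)) : ‖R ((y - x) / h)‖ ≤ C := by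
  apply hD.basis_le
  rw [abs_div, abs_of_pos hD.bandwidth_pos, div_le_one hD.bandwidth_pos, abs_le]
  exact ⟨by linarith [hy.1], by linarith [hy.2]⟩

omit [IsProbabilityMeasure μ] in
lemma kernelWeight_le (hD : LocalDesign μ x K R h C) (y : ℝ) : kernelWeight K h x y ≤ C / h := by
  have := hD.kernel_le ((y - x) / h)
  have h0 := hD.bandwidth_pos
  rw [kernelWeight, one_div, inv_mul_eq_div]
  gcongr

omit [IsProbabilityMeasure μ] in
lemma measurable_weightedBasis (hD : LocalDesign μ x K R h C) :
    Measurable (weightedBasis x K R h) :=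
  LocalDistribution.measurable_weightedBasis hD.measurable_kernel hD.measurable_basis h x

omit [IsProbabilityMeasure μ] in
lemma norm_weightedBasis_le (hD : LocalDesign μ x K R h C) (y : ℝ) :
    ‖weightedBasis x K R h y‖ ≤ (Set.Icc (x - h) (x + h)).indicator (fun _ => C ^ 2 / h) y := by
  by_cases hy : y ∈ Set.Icc (x - h) (x + h)
  · rw [Set.indicator_of_mem hy, weightedBasis, norm_smul, Real.norm_of_nonneg
      (hD.kernelWeight_nonneg y)]
    calc kernelWeight K h x y * ‖R ((y - x) / h)‖ ≤ C / h * C :=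
          mul_le_mul (hD.kernelWeight_le y) (hD.norm_basis_le hy) (norm_nonneg _)
            (div_nonneg hD.const_pos.le hD.bandwidth_pos.le)
      _ = C ^ 2 / h := by ring
  · rw [Set.indicator_of_notMem hy, weightedBasis, hD.kernelWeight_eq_zero hy]
    simp

/-- A function bounded by `c` on the bandwidth window and vanishing off it has integral at most
`c C h`, because the design has bounded density near the evaluation point. -/
lemma integral_le_of_le_indicator (hD : LocalDesign μ x K R h C) {φ : ℝ → ℝ}
    (hφ0 : ∀ y, 0 ≤ φ y) {c : ℝ} (hc : 0 ≤ c)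
    (hφ : ∀ y, φ y ≤ (Set.Icc (x - h) (x + h)).indicator (fun _ => c) y) :
    ∫ y, φ y ∂μ ≤ c * (C * h) := by
  calc ∫ y, φ y ∂μ ≤ ∫ y, (Set.Icc (x - h) (x + h)).indicator (fun _ => c) y ∂μ :=
        integral_mono_of_nonneg (ae_of_all _ hφ0)
          ((integrable_const c).indicator measurableSet_Icc) (ae_of_all _ hφ)
    _ = c * μ.real (Set.Icc (x - h) (x + h)) := by
        rw [integral_indicator measurableSet_Icc]; simp [mul_comm]
    _ ≤ c * (C * h) := by
        gcongr
        exact ENNReal.toReal_le_of_le_ofReal (mul_nonneg hD.const_pos.le hD.bandwidth_pos.le)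
          hD.measure_le

omit [IsProbabilityMeasure μ] in
lemma norm_weightedBasis_le_const (hD : LocalDesign μ x K R h C) (y : ℝ) :
    ‖weightedBasis x K R h y‖ ≤ C ^ 2 / h :=
  (hD.norm_weightedBasis_le y).trans (Set.indicator_le_self' (fun _ _ =>
    div_nonneg (sq_nonneg _) hD.bandwidth_pos.le) y)

lemma integral_norm_weightedBasis_le (hD : LocalDesign μ x K R h C) :
    ∫ y, ‖weightedBasis x K R h y‖ ∂μ ≤ C ^ 3 := by
  have h0 := hD.bandwidth_pos
  refine (hD.integral_le_of_le_indicator (fun y => norm_nonneg _) (by positivity)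
    hD.norm_weightedBasis_le).trans (le_of_eq ?_)
  field_simp

lemma integral_norm_sq_weightedBasis_le (hD : LocalDesign μ x K R h C) :
    ∫ y, ‖weightedBasis x K R h y‖ ^ 2 ∂μ ≤ C ^ 5 / h := by
  have h0 := hD.bandwidth_pos
  refine (hD.integral_le_of_le_indicator (c := (C ^ 2 / h) ^ 2) (fun y => by positivity)
    (by positivity) fun y => ?_).trans (le_of_eq ?_)
  · have := hD.norm_weightedBasis_le y
    by_cases hy : y ∈ Set.Icc (x - h) (x + h)
    · rw [Set.indicator_of_mem hy] at this ⊢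
      gcongr
    · rw [Set.indicator_of_notMem hy] at this ⊢
      have h1 := norm_nonneg (weightedBasis x K R h y)
      rw [le_antisymm this h1]; norm_num
  · field_simp

lemma integrable_centredInd_smul (hD : LocalDesign μ x K R h C) (a : ℝ) :
    Integrable (fun y => centredInd μ a y • weightedBasis x K R h y) μ := by
  refine Integrable.of_bound ((measurable_centredInd.of_uncurry_left (x := a)).smul
    hD.measurable_weightedBasis).aestronglyMeasurable (C ^ 2 / h) (ae_of_all _ fun y => ?_)
  rw [norm_smul]
  exact (mul_le_of_le_one_left (norm_nonneg _) (abs_centredInd_le a y)).trans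
    (hD.norm_weightedBasis_le_const y)

lemma measurable_designInfluence (hD : LocalDesign μ x K R h C) :
    Measurable (designInfluence μ x K R h) :=
  LocalDistribution.measurable_designInfluence hD.measurable_kernel hD.measurable_basis h x

lemma norm_designInfluence_le (hD : LocalDesign μ x K R h C) (a : ℝ) :
    ‖designInfluence μ x K R h a‖ ≤ C ^ 3 := by
  refine (norm_integral_le_integral_norm _).trans (le_trans ?_ hD.integral_norm_weightedBasis_le)
  refine integral_mono (hD.integrable_centredInd_smul a).norm (Integrable.of_bound
    hD.measurable_weightedBasis.norm.aestronglyMeasurable (C ^ 2 / h) (ae_of_all _ fun y => ?_))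
    fun y => ?_
  · rw [norm_norm]; exact hD.norm_weightedBasis_le_const y
  · simp only [norm_smul]
    exact mul_le_of_le_one_left (norm_nonneg _) (abs_centredInd_le a y)

lemma designInfluence_apply (hD : LocalDesign μ x K R h C) (a : ℝ) (k : Fin d) :
    designInfluence μ x K R h a k = ∫ y, centredInd μ a y * weightedBasis x K R h y k ∂μ := by
  rw [designInfluence, integral_vec_apply (hD.integrable_centredInd_smul a)]
  simp

omit [IsProbabilityMeasure μ] in
lemma measurable_weightedBasis_apply (hD : LocalDesign μ x K R h C) (k : Fin d) :
    Measurable (fun y => weightedBasis x K R h y k) :=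
  (measurable_pi_apply k).comp ((WithLp.measurable_ofLp 2 _).comp hD.measurable_weightedBasis)

lemma measurable_designInfluence_apply (hD : LocalDesign μ x K R h C) (k : Fin d) :
    Measurable (fun a => designInfluence μ x K R h a k) :=
  (measurable_pi_apply k).comp ((WithLp.measurable_ofLp 2 _).comp hD.measurable_designInfluence)

omit [IsProbabilityMeasure μ] in
lemma abs_weightedBasis_apply_le (hD : LocalDesign μ x K R h C) (y : ℝ) (k : Fin d) :
    |weightedBasis x K R h y k| ≤ C ^ 2 / h :=
  (PiLp.norm_apply_le _ k).trans (hD.norm_weightedBasis_le_const y)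

lemma abs_designInfluence_apply_le (hD : LocalDesign μ x K R h C) (a : ℝ) (k : Fin d) :
    |designInfluence μ x K R h a k| ≤ C ^ 3 :=
  (PiLp.norm_apply_le _ k).trans (hD.norm_designInfluence_le a)

/-- Integrating the linear term against a bounded function of the observation exchanges the two
integrals. -/
lemma integral_mul_designInfluence (hD : LocalDesign μ x K R h C) {ψ : ℝ → ℝ}
    (hψ : Measurable ψ) {b : ℝ} (hb : ∀ a, |ψ a| ≤ b) (k : Fin d) :
    ∫ a, ψ a * designInfluence μ x K R h a k ∂μ
      = ∫ y, weightedBasis x K R h y k * ∫ a, ψ a * centredInd μ a y ∂μ ∂μ := by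
  have hmeas : Measurable (fun p : ℝ × ℝ =>
      ψ p.1 * (centredInd μ p.1 p.2 * weightedBasis x K R h p.2 k)) :=
    (hψ.comp measurable_fst).mul (measurable_centredInd.mul
      ((hD.measurable_weightedBasis_apply k).comp measurable_snd))
  have hint : Integrable (fun p : ℝ × ℝ =>
      ψ p.1 * (centredInd μ p.1 p.2 * weightedBasis x K R h p.2 k)) (μ.prod μ) := by
    refine integrable_of_abs_le hmeas (b := b * (1 * (C ^ 2 / h))) fun p => ?_
    rw [abs_mul, abs_mul]
    have h1 := hD.abs_weightedBasis_apply_le p.2 k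
    have h2 := abs_centredInd_le (μ := μ) p.1 p.2
    have h3 := hb p.1
    exact mul_le_mul h3 (mul_le_mul h2 h1 (abs_nonneg _) zero_le_one) (by positivity)
      ((abs_nonneg _).trans h3)
  simp only [hD.designInfluence_apply, ← integral_const_mul]
  rw [integral_integral_swap hint]
  refine integral_congr_ae (ae_of_all _ fun y => ?_)
  refine integral_congr_ae (ae_of_all _ fun a => ?_)
  simp only
  ring

lemma integral_designInfluence_apply (hD : LocalDesign μ x K R h C) (k : Fin d) :
    ∫ a, designInfluence μ x K R h a k ∂μ = 0 := by
  have := hD.integral_mul_designInfluence (ψ := fun _ => 1) measurable_const (b := 1)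
    (by simp) k
  simpa [integral_centredInd] using this

/-- The covariance matrix of the linear term of an observation. -/
lemma integral_designInfluence_mul (hD : LocalDesign μ x K R h C) (k l : Fin d) :
    ∫ a, designInfluence μ x K R h a k * designInfluence μ x K R h a l ∂μ
      = ∫ y, ∫ z, weightedBasis x K R h y k * (weightedBasis x K R h z l
        * (cdf μ (min y z) - cdf μ y * cdf μ z)) ∂μ ∂μ := by
  have h1 := hD.integral_mul_designInfluence (hD.measurable_designInfluence_apply l)
    (fun a => hD.abs_designInfluence_apply_le a l) k
  simp only [mul_comm (designInfluence μ x K R h _ k)]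
  rw [h1]
  refine integral_congr_ae (ae_of_all _ fun y => ?_)
  simp only [mul_comm (designInfluence μ x K R h _ l)]
  rw [hD.integral_mul_designInfluence (measurable_centredInd.of_uncurry_right (y := y))
    (fun a => abs_centredInd_le a y) l, ← integral_const_mul]
  simp only [integral_centredInd_mul]

end LocalDesign

end LocalDesign

/-! ### The population matrices as integrals against the design -/

section Population

variable {d : ℕ} {μ : Measure ℝ} [IsProbabilityMeasure μ] {x : ℝ} {f K : ℝ → ℝ}
  {R : ℝ → Vec d} {Υ : ℝ → Fin d → ℝ} {h C : ℝ}

omit [IsProbabilityMeasure μ] in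
lemma LocalSubstitution.gam_apply (hS : LocalSubstitution μ x f K h) (k l : Fin d) :
    Gam μ x K R f h k l
      = ∫ y, kernelWeight K h x y * (R ((y - x) / h) k * R ((y - x) / h) l) ∂μ := by
  have := hS ℝ (fun u => R u k * R u l)
  simp only [smul_eq_mul] at this
  rw [← this]
  simp only [Gam, Matrix.of_apply]
  congr 1; ext u; ring

omit [IsProbabilityMeasure μ] in
lemma LocalSubstitution.influence_eq (hS : LocalSubstitution μ x f K h) (h0 : 0 < h) (a : ℝ) :
    influence μ x f K R h a = designInfluence μ x K R h a := by
  have := hS (Vec d) (fun u => centredInd μ a (x + h * u) • R u)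
  have hy : ∀ y, x + h * ((y - x) / h) = y := fun y => by field_simp; ring
  simp only [hy] at this
  rw [designInfluence]
  simp only [weightedBasis, smul_comm (centredInd μ a _)]
  rw [← this, influence]
  congr 1; ext1 u
  rw [smul_smul, centredInd]
  congr 1; ring

lemma LocalSubstitution.sig_apply (hS : LocalSubstitution μ x f K h)
    (hD : LocalDesign μ x K R h C) (k l : Fin d) :
    Sig μ x K R f h k l
      = ∫ a, designInfluence μ x K R h a k * designInfluence μ x K R h a l ∂μ := by
  have h0 := hD.bandwidth_pos
  have hy : ∀ y, x + h * ((y - x) / h) = y := fun y => by field_simp; ring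
  have hmin : ∀ y z, x + h * min ((y - x) / h) ((z - x) / h) = min y z := fun y z => by
    rw [mul_min_of_nonneg _ _ h0.le, ← min_add_add_left, hy, hy]
  have hinner : ∀ u, (∫ v in scaledSupport μ x h, R u k * R v l
      * (cdf μ (x + h * min u v) - cdf μ (x + h * u) * cdf μ (x + h * v))
      * (K u * K v) * (f (x + h * u) * f (x + h * v)))
      = (K u * f (x + h * u)) • ∫ z, kernelWeight K h x z * (R u k * (R ((z - x) / h) l *
        (cdf μ (x + h * min u ((z - x) / h)) - cdf μ (x + h * u) * cdf μ z))) ∂μ := fun u => by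
    have := hS ℝ (fun v => R u k * (R v l *
        (cdf μ (x + h * min u v) - cdf μ (x + h * u) * cdf μ (x + h * v))))
    simp only [smul_eq_mul, hy] at this
    rw [← this, smul_eq_mul, ← integral_const_mul]
    congr 1; ext v; ring
  rw [hD.integral_designInfluence_mul]
  simp only [Sig, Matrix.of_apply, hinner]
  rw [hS ℝ]
  refine integral_congr_ae (ae_of_all _ fun y => ?_)
  simp only [hy, hmin, smul_eq_mul, ← integral_const_mul]
  refine integral_congr_ae (ae_of_all _ fun z => ?_)
  simp only [weightedBasis, PiLp.smul_apply, smul_eq_mul]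
  ring

end Population

/-! ### Moments of the statistics -/

section Statistics

variable {Ω : Type*} [MeasurableSpace Ω] {P : Measure Ω} [IsProbabilityMeasure P]
  {d : ℕ} {μ : Measure ℝ} [IsProbabilityMeasure μ] {X : ℕ → Ω → ℝ} {x : ℝ} {f K : ℝ → ℝ}
  {R : ℝ → Vec d} {Υ : ℝ → Fin d → ℝ} {h C : ℝ}

/-- The average of the linear terms of the observations. -/
def linearTerm (μ : Measure ℝ) (x : ℝ) (K : ℝ → ℝ) (R : ℝ → Vec d) (h : ℝ) (n : ℕ)
    (xs : ℕ → ℝ) : Vec d :=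
  (1 / (n : ℝ)) • ∑ i ∈ Finset.range n, designInfluence μ x K R h (xs i)

/-- The average norm of the kernel-weighted basis over the sample. -/
def averageWeight (x : ℝ) (K : ℝ → ℝ) (R : ℝ → Vec d) (h : ℝ) (n : ℕ) (xs : ℕ → ℝ) : ℝ :=
  (1 / (n : ℝ)) * ∑ i ∈ Finset.range n, ‖weightedBasis x K R h (xs i)‖

lemma vec_sum_apply {ι : Type*} (s : Finset ι) (g : ι → Vec d) (k : Fin d) :
    (∑ i ∈ s, g i) k = ∑ i ∈ s, g i k := by
  simp

lemma matrixNorm_sq (A : Matrix (Fin d) (Fin d) ℝ) : matrixNorm A ^ 2 = ∑ k, ∑ l, A k l ^ 2 :=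
  Real.sq_sqrt (Finset.sum_nonneg fun _ _ => Finset.sum_nonneg fun _ _ => sq_nonneg _)

lemma averageWeight_nonneg (n : ℕ) (xs : ℕ → ℝ) : 0 ≤ averageWeight x K R h n xs :=
  mul_nonneg (by positivity) (Finset.sum_nonneg fun _ _ => norm_nonneg _)

lemma LocalDesign.integral_averageWeight_le (hD : LocalDesign μ x K R h C)
    (hX : ∀ i, Measurable (X i)) (hlaw : ∀ i, P.map (X i) = μ) {n : ℕ} (hn : 0 < n) :
    Integrable (fun ω => averageWeight x K R h n (fun i => X i ω)) P ∧
      ∫ ω, averageWeight x K R h n (fun i => X i ω) ∂P ≤ C ^ 3 := by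
  have hm := hD.measurable_weightedBasis.norm
  have hi : ∀ i, Integrable (fun ω => ‖weightedBasis x K R h (X i ω)‖) P := fun i =>
    integrable_of_abs_le (hm.comp (hX i)) (b := C ^ 2 / h) fun ω => by
      simpa using hD.norm_weightedBasis_le_const (X i ω)
  refine ⟨(integrable_finsetSum _ fun i _ => hi i).const_mul _, ?_⟩
  simp only [averageWeight]
  rw [integral_const_mul, integral_finsetSum _ fun i _ => hi i]
  simp only [integral_comp_law hX hlaw hm.stronglyMeasurable, Finset.sum_const,
    Finset.card_range, nsmul_eq_mul]
  refine le_trans (le_of_eq ?_) hD.integral_norm_weightedBasis_le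
  field_simp

lemma LocalDesign.integral_norm_sq_linearTerm_le (hD : LocalDesign μ x K R h C)
    (hX : ∀ i, Measurable (X i)) (hind : iIndepFun X P) (hlaw : ∀ i, P.map (X i) = μ)
    {n : ℕ} (hn : 0 < n) :
    Integrable (fun ω => ‖linearTerm μ x K R h n (fun i => X i ω)‖ ^ 2) P ∧
      ∫ ω, ‖linearTerm μ x K R h n (fun i => X i ω)‖ ^ 2 ∂P ≤ d * C ^ 6 * (1 / n) := by
  have hcoord : ∀ ω (k : Fin d), linearTerm μ x K R h n (fun i => X i ω) k
      = (1 / (n : ℝ)) * ∑ i ∈ Finset.range n, designInfluence μ x K R h (X i ω) k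
        - ∫ a, designInfluence μ x K R h a k ∂μ := fun ω k => by
    rw [hD.integral_designInfluence_apply, sub_zero]
    simp [linearTerm]
  have hmeas : ∀ k : Fin d, Measurable fun ω => linearTerm μ x K R h n (fun i => X i ω) k :=
    fun k => by
      simp only [hcoord]
      exact ((Finset.measurable_fun_sum _ fun i _ =>
        (hD.measurable_designInfluence_apply k).comp (hX i)).const_mul _).sub_const _
  have hbd : ∀ ω (k : Fin d), |linearTerm μ x K R h n (fun i => X i ω) k| ≤ C ^ 3 := fun ω k => by
    rw [hcoord, hD.integral_designInfluence_apply, sub_zero, abs_mul, abs_of_nonneg (by positivity),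
      one_div, inv_mul_le_iff₀ (by positivity)]
    refine (Finset.abs_sum_le_sum_abs _ _).trans ?_
    refine (Finset.sum_le_sum fun i _ => hD.abs_designInfluence_apply_le (X i ω) k).trans ?_
    simp
  have hint : ∀ k : Fin d, Integrable
      (fun ω => linearTerm μ x K R h n (fun i => X i ω) k ^ 2) P := fun k =>
    integrable_of_abs_le ((hmeas k).pow_const 2) (b := (C ^ 3) ^ 2) fun ω => by
      rw [abs_pow]; exact pow_le_pow_left₀ (abs_nonneg _) (hbd ω k) 2
  simp only [EuclideanSpace.real_norm_sq_eq]
  refine ⟨integrable_finsetSum _ fun k _ => hint k, ?_⟩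
  rw [integral_finsetSum _ fun k _ => hint k]
  calc ∑ k : Fin d, ∫ ω, linearTerm μ x K R h n (fun i => X i ω) k ^ 2 ∂P
      ≤ ∑ k : Fin d, (1 / (n : ℝ)) * C ^ 6 := by
        refine Finset.sum_le_sum fun k _ => ?_
        simp only [hcoord]
        refine (integral_sq_average_sub_le hX hind hlaw (hD.measurable_designInfluence_apply k)
          (fun a => hD.abs_designInfluence_apply_le a k) hn).trans ?_
        gcongr
        refine (integral_mono_of_nonneg (ae_of_all _ fun a => sq_nonneg _)
          (integrable_const ((C ^ 3) ^ 2)) (ae_of_all _ fun a => ?_)).trans (le_of_eq ?_)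
        · simp only
          rw [← sq_abs]
          exact pow_le_pow_left₀ (abs_nonneg _) (hD.abs_designInfluence_apply_le a k) 2
        · simp; ring
    _ = d * C ^ 6 * (1 / n) := by simp; ring

lemma gamHat_apply (hΥ : ∀ u, mv (Matrix.diagonal (Υ h)) (R u) = R (u / h)) (n : ℕ)
    (xs : ℕ → ℝ) (k l : Fin d) :
    GamHat x K R Υ h n xs k l = (1 / (n : ℝ)) * ∑ i ∈ Finset.range n,
      kernelWeight K h x (xs i) * (R ((xs i - x) / h) k * R ((xs i - x) / h) l) := by
  have h1 : ∀ u (k : Fin d), R (u / h) k = Υ h k * R u k := fun u k => by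
    rw [← hΥ u]; simp [mv, Matrix.mulVec_diagonal]
  simp only [GamHat, Matrix.smul_apply, Matrix.sum_apply, smul_eq_mul, Matrix.mul_diagonal,
    Matrix.diagonal_mul, Matrix.vecMulVec_apply, h1]
  congr 1
  refine Finset.sum_congr rfl fun i _ => ?_
  ring

lemma LocalDesign.integral_matrixNorm_sq_le (hD : LocalDesign μ x K R h C)
    (hS : LocalSubstitution μ x f K h)
    (hΥ : ∀ u, mv (Matrix.diagonal (Υ h)) (R u) = R (u / h))
    (hX : ∀ i, Measurable (X i)) (hind : iIndepFun X P) (hlaw : ∀ i, P.map (X i) = μ)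
    {n : ℕ} (hn : 0 < n) :
    Integrable (fun ω => matrixNorm (GamHat x K R Υ h n (fun i => X i ω)
        - Gam μ x K R f h) ^ 2) P ∧
      ∫ ω, matrixNorm (GamHat x K R Υ h n (fun i => X i ω) - Gam μ x K R f h) ^ 2 ∂P
        ≤ d ^ 2 * C ^ 7 * (1 / (n * h)) := by
  have h0 := hD.bandwidth_pos
  have hC := hD.const_pos
  let φ : Fin d → Fin d → ℝ → ℝ := fun k l y =>
    kernelWeight K h x y * (R ((y - x) / h) k * R ((y - x) / h) l)
  have hRm : ∀ k : Fin d, Measurable fun y => R ((y - x) / h) k := fun k =>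
    (measurable_pi_apply k).comp ((WithLp.measurable_ofLp 2 _).comp
      (hD.measurable_basis.comp (by fun_prop)))
  have hφm : ∀ k l, Measurable (φ k l) := fun k l =>
    hD.measurable_kernelWeight.mul ((hRm k).mul (hRm l))
  have hφ : ∀ k l y, |φ k l y| ≤ (Set.Icc (x - h) (x + h)).indicator (fun _ => C ^ 3 / h) y := by
    intro k l y
    by_cases hy : y ∈ Set.Icc (x - h) (x + h)
    · have hk : ∀ k, |R ((y - x) / h) k| ≤ C := fun k =>
        (PiLp.norm_apply_le _ k).trans (hD.norm_basis_le hy)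
      rw [Set.indicator_of_mem hy, abs_mul, abs_mul, abs_of_nonneg (hD.kernelWeight_nonneg y)]
      calc _ ≤ C / h * (C * C) := mul_le_mul (hD.kernelWeight_le y)
            (mul_le_mul (hk k) (hk l) (abs_nonneg _) hC.le) (by positivity) (by positivity)
        _ = C ^ 3 / h := by ring
    · rw [Set.indicator_of_notMem hy]
      simp [φ, hD.kernelWeight_eq_zero hy]
  have hφb : ∀ k l y, |φ k l y| ≤ C ^ 3 / h := fun k l y =>
    (hφ k l y).trans (Set.indicator_le_self' (fun _ _ => by positivity) y)
  have hφ2 : ∀ k l, ∫ y, φ k l y ^ 2 ∂μ ≤ C ^ 7 / h := fun k l => by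
    refine (hD.integral_le_of_le_indicator (c := (C ^ 3 / h) ^ 2) (fun y => sq_nonneg _)
      (by positivity) fun y => ?_).trans (le_of_eq ?_)
    · have := hφ k l y
      rw [← sq_abs]
      by_cases hy : y ∈ Set.Icc (x - h) (x + h)
      · rw [Set.indicator_of_mem hy] at this ⊢
        gcongr
      · rw [Set.indicator_of_notMem hy] at this ⊢
        rw [le_antisymm this (abs_nonneg _)]; norm_num
    · field_simp
  have hentry : ∀ ω k l, (GamHat x K R Υ h n (fun i => X i ω) - Gam μ x K R f h) k l
      = (1 / (n : ℝ)) * ∑ i ∈ Finset.range n, φ k l (X i ω) - ∫ y, φ k l y ∂μ := fun ω k l => by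
    rw [Matrix.sub_apply, gamHat_apply hΥ, hS.gam_apply]
  have hsq : ∀ ω, matrixNorm (GamHat x K R Υ h n (fun i => X i ω) - Gam μ x K R f h) ^ 2
      = ∑ k, ∑ l, ((1 / (n : ℝ)) * ∑ i ∈ Finset.range n, φ k l (X i ω)
        - ∫ y, φ k l y ∂μ) ^ 2 := fun ω => by
    simp only [matrixNorm_sq, hentry]
  have hint : ∀ k l, Integrable (fun ω => ((1 / (n : ℝ)) * ∑ i ∈ Finset.range n, φ k l (X i ω)
        - ∫ y, φ k l y ∂μ) ^ 2) P := fun k l => by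
    refine integrable_of_abs_le ((((Finset.measurable_fun_sum _ fun i _ =>
      (hφm k l).comp (hX i)).const_mul _).sub_const _).pow_const 2)
      (b := (C ^ 3 / h + |∫ y, φ k l y ∂μ|) ^ 2) fun ω => ?_
    rw [abs_pow]
    refine pow_le_pow_left₀ (abs_nonneg _) ((abs_sub _ _).trans (add_le_add_left ?_ _)) 2
    rw [abs_mul, abs_of_nonneg (by positivity : (0 : ℝ) ≤ 1 / n), one_div,
      inv_mul_le_iff₀ (by positivity)]
    refine (Finset.abs_sum_le_sum_abs _ _).trans ?_
    refine (Finset.sum_le_sum fun i _ => hφb k l (X i ω)).trans ?_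
    simp
  simp only [hsq]
  refine ⟨integrable_finsetSum _ fun k _ => integrable_finsetSum _ fun l _ => hint k l, ?_⟩
  rw [integral_finsetSum _ fun k _ => integrable_finsetSum _ fun l _ => hint k l]
  calc _ ≤ ∑ k : Fin d, ∑ l : Fin d, (1 / (n : ℝ)) * (C ^ 7 / h) := by
        refine Finset.sum_le_sum fun k _ => ?_
        rw [integral_finsetSum _ fun l _ => hint k l]
        refine Finset.sum_le_sum fun l _ => ?_
        refine (integral_sq_average_sub_le hX hind hlaw (hφm k l) (hφb k l) hn).trans ?_
        gcongr
        exact hφ2 k l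
    _ = d ^ 2 * C ^ 7 * (1 / (n * h)) := by simp; field_simp

lemma LocalDesign.integral_norm_sq_quadraticTerm_le (hD : LocalDesign μ x K R h C)
    (hS : LocalSubstitution μ x f K h)
    (hΥ : ∀ u, mv (Matrix.diagonal (Υ h)) (R u) = R (u / h))
    (hX : ∀ i, Measurable (X i)) (hind : iIndepFun X P) (hlaw : ∀ i, P.map (X i) = μ)
    {n : ℕ} (hn : 0 < n) :
    Integrable (fun ω => ‖quadraticTerm μ x f K R Υ h n (fun i => X i ω)‖ ^ 2) P ∧
      ∫ ω, ‖quadraticTerm μ x f K R Υ h n (fun i => X i ω)‖ ^ 2 ∂P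
        ≤ 2 * d * C ^ 5 * (1 / (n ^ 2 * h)) := by
  have h0 := hD.bandwidth_pos
  have hC := hD.const_pos
  let ψ : Fin d → ℝ → ℝ → ℝ := fun k a y => centredInd μ a y * weightedBasis x K R h y k
  let W : Fin d → ℝ → ℝ → ℝ := fun k a y => ψ k a y - designInfluence μ x K R h a k
  have hψm : ∀ k, Measurable (Function.uncurry (ψ k)) := fun k =>
    measurable_centredInd.mul ((hD.measurable_weightedBasis_apply k).comp measurable_snd)
  have hWm : ∀ k, Measurable (Function.uncurry (W k)) := fun k =>
    (hψm k).sub ((hD.measurable_designInfluence_apply k).comp measurable_fst)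
  have hψG : ∀ k a y, |ψ k a y| ≤ ‖weightedBasis x K R h y‖ := fun k a y => by
    rw [abs_mul]
    exact (mul_le_of_le_one_left (abs_nonneg _) (abs_centredInd_le a y)).trans
      (PiLp.norm_apply_le (weightedBasis x K R h y) k)
  have hψb : ∀ k a y, |ψ k a y| ≤ C ^ 2 / h := fun k a y =>
    (hψG k a y).trans (hD.norm_weightedBasis_le_const y)
  have hWb : ∀ k a y, |W k a y| ≤ C ^ 2 / h + C ^ 3 := fun k a y =>
    (abs_sub _ _).trans (add_le_add (hψb k a y) (hD.abs_designInfluence_apply_le a k))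
  have hψi : ∀ k a, Integrable (ψ k a) μ := fun k a =>
    integrable_of_abs_le ((hψm k).of_uncurry_left (x := a)) (hψb k a)
  have hW1 : ∀ k y, ∫ a, W k a y ∂μ = 0 := fun k y => by
    have e1 : ∫ a, ψ k a y ∂μ = 0 := by
      simp only [ψ]; rw [integral_mul_const, integral_centredInd, zero_mul]
    simp only [W]
    rw [integral_sub (integrable_of_abs_le ((hψm k).of_uncurry_right (y := y))
      fun a => hψb k a y) (integrable_of_abs_le (hD.measurable_designInfluence_apply k)
      fun a => hD.abs_designInfluence_apply_le a k), e1,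
      hD.integral_designInfluence_apply, sub_zero]
  have hW2 : ∀ k a, ∫ y, W k a y ∂μ = 0 := fun k a => by
    simp only [W]
    rw [integral_sub (hψi k a) (integrable_const _), integral_const, hD.designInfluence_apply]
    simp [ψ]
  -- Centring in the second argument lowers the second moment.
  have hWsq : ∀ k a, ∫ y, W k a y ^ 2 ∂μ ≤ C ^ 5 / h := fun k a => by
    have hm := (hψm k).of_uncurry_left (x := a)
    have e1 : ∫ y, W k a y ^ 2 ∂μ = Var[ψ k a; μ] := by
      rw [variance_eq_integral hm.aemeasurable]
      simp only [W, hD.designInfluence_apply, ψ]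
    rw [e1]
    refine (variance_le_expectation_sq hm.aestronglyMeasurable).trans ?_
    refine le_trans ?_ hD.integral_norm_sq_weightedBasis_le
    refine integral_mono_of_nonneg (ae_of_all _ fun y => sq_nonneg _)
      (integrable_of_abs_le (hD.measurable_weightedBasis.norm.pow_const 2)
        (b := (C ^ 2 / h) ^ 2) fun y => ?_) (ae_of_all _ fun y => ?_)
    · rw [abs_pow, abs_norm]
      exact pow_le_pow_left₀ (norm_nonneg _) (hD.norm_weightedBasis_le_const y) 2
    · simp only [Pi.pow_apply]
      rw [← sq_abs]
      exact pow_le_pow_left₀ (abs_nonneg _) (hψG k a y) 2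
  have hcoord : ∀ ω (k : Fin d), quadraticTerm μ x f K R Υ h n (fun i => X i ω) k
      = (1 / (n : ℝ) ^ 2) * ∑ i ∈ Finset.range n, ∑ j ∈ (Finset.range n).erase i,
          W k (X i ω) (X j ω) := fun ω k => by
    simp only [quadraticTerm, PiLp.smul_apply, vec_sum_apply, smul_eq_mul, PiLp.sub_apply, hΥ,
      hS.influence_eq h0, W, ψ, centredInd, weightedBasis]
    congr 1
    refine Finset.sum_congr rfl fun i _ => Finset.sum_congr rfl fun j _ => ?_
    ring
  have hint : ∀ k : Fin d, Integrable (fun ω => ((1 / (n : ℝ) ^ 2) *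
      ∑ i ∈ Finset.range n, ∑ j ∈ (Finset.range n).erase i, W k (X i ω) (X j ω)) ^ 2) P :=
    fun k => by
      have hm : Measurable fun ω => (1 / (n : ℝ) ^ 2) *
          ∑ i ∈ Finset.range n, ∑ j ∈ (Finset.range n).erase i, W k (X i ω) (X j ω) :=
        (Finset.measurable_fun_sum _ fun i _ => Finset.measurable_fun_sum _ fun j _ =>
          (hWm k).comp ((hX i).prodMk (hX j))).const_mul _
      refine integrable_of_abs_le (hm.pow_const 2) (b := (1 / (n : ℝ) ^ 2 *
        ∑ i ∈ Finset.range n, ∑ j ∈ (Finset.range n).erase i, (C ^ 2 / h + C ^ 3)) ^ 2)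
        fun ω => ?_
      rw [abs_pow, abs_mul, abs_of_nonneg (by positivity : (0 : ℝ) ≤ 1 / (n : ℝ) ^ 2)]
      gcongr
      refine (Finset.abs_sum_le_sum_abs _ _).trans (Finset.sum_le_sum fun i _ => ?_)
      exact (Finset.abs_sum_le_sum_abs _ _).trans (Finset.sum_le_sum fun j _ => hWb k _ _)
  simp only [EuclideanSpace.real_norm_sq_eq, hcoord]
  refine ⟨integrable_finsetSum _ fun k _ => hint k, ?_⟩
  rw [integral_finsetSum _ fun k _ => hint k]
  calc _ ≤ ∑ k : Fin d, (1 / (n : ℝ) ^ 2) ^ 2 * (2 * (n : ℝ) ^ 2 * (C ^ 5 / h)) := by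
        refine Finset.sum_le_sum fun k _ => ?_
        simp only [mul_pow]
        rw [integral_const_mul]
        gcongr
        refine (integral_sq_degenerate_le hX hind hlaw (hWm k) (hWb k) (hW1 k) (hW2 k) n).trans ?_
        gcongr
        refine (integral_mono_of_nonneg (ae_of_all _ fun a => integral_nonneg fun y =>
          sq_nonneg _) (integrable_const (C ^ 5 / h)) (ae_of_all _ fun a => hWsq k a)).trans ?_
        simp
    _ = 2 * d * C ^ 5 * (1 / (n ^ 2 * h)) := by simp; field_simp

omit [IsProbabilityMeasure μ] in
lemma norm_leaveInBias_le (hΥ : ∀ u, mv (Matrix.diagonal (Υ h)) (R u) = R (u / h)) (n : ℕ)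
    (xs : ℕ → ℝ) :
    ‖leaveInBias μ x K R Υ h n xs‖ ≤ (1 / (n : ℝ)) * averageWeight x K R h n xs := by
  have : leaveInBias μ x K R Υ h n xs = (1 / (n : ℝ)) • ((1 / (n : ℝ)) •
      ∑ j ∈ Finset.range n, (1 - cdf μ (xs j)) • weightedBasis x K R h (xs j)) := by
    simp only [leaveInBias, hΥ, weightedBasis, smul_smul]
    congr 1; ring
  rw [this, norm_smul, norm_smul, Real.norm_of_nonneg (by positivity), averageWeight]
  gcongr
  refine (norm_sum_le _ _).trans (Finset.sum_le_sum fun j _ => ?_)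
  rw [norm_smul]
  refine mul_le_of_le_one_left (norm_nonneg _) ?_
  rw [Real.norm_eq_abs, abs_le]
  constructor <;> linarith [cdf_nonneg μ (xs j), cdf_le_one μ (xs j)]

omit [IsProbabilityMeasure μ] in
lemma approxError_nonneg (θ : Vec d) (h : ℝ) : 0 ≤ approxError μ x R θ h := by
  apply Real.sSup_nonneg
  rintro _ ⟨y, _, rfl⟩
  exact abs_nonneg _

omit [IsProbabilityMeasure μ] in
lemma abs_le_approxError (hR : ∀ u₀, ∃ C : ℝ, ∀ᶠ u in 𝓝 u₀, ‖R u‖ ≤ C) (θ : Vec d) {y : ℝ}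
    (hy : y ∈ μ.support) (hyh : |y - x| ≤ h) :
    |cdf μ y - inner ℝ (R (y - x)) θ| ≤ approxError μ x R θ h := by
  obtain ⟨B, hB⟩ := exists_bound_of_locally_bounded hR (isCompact_Icc (a := -h) (b := h))
  refine le_csSup ⟨1 + B * ‖θ‖, ?_⟩ ⟨y, ⟨hy, hyh⟩, rfl⟩
  rintro _ ⟨z, ⟨_, hz⟩, rfl⟩
  refine (abs_sub _ _).trans (add_le_add ?_ ?_)
  · rw [abs_of_nonneg (cdf_nonneg μ z)]; exact cdf_le_one μ z
  · refine (abs_real_inner_le_norm _ _).trans ?_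
    gcongr
    exact hB _ (abs_le.1 hz)

omit [IsProbabilityMeasure μ] in
/-- The approximation error of the distribution function, weighted by the kernel, at a point of
the support. -/
lemma LocalDesign.norm_smul_weightedBasis_le (hD : LocalDesign μ x K R h C)
    (hR : ∀ u₀, ∃ C : ℝ, ∀ᶠ u in 𝓝 u₀, ‖R u‖ ≤ C) (θ : Vec d) {y : ℝ} (hy : y ∈ μ.support) :
    ‖(cdf μ y - inner ℝ (R (y - x)) θ) • weightedBasis x K R h y‖
      ≤ approxError μ x R θ h * ‖weightedBasis x K R h y‖ := by
  rw [norm_smul]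
  by_cases hyI : y ∈ Set.Icc (x - h) (x + h)
  · gcongr
    exact abs_le_approxError hR θ hy (abs_le.2 ⟨by linarith [hyI.1], by linarith [hyI.2]⟩)
  · simp [weightedBasis, hD.kernelWeight_eq_zero hyI]

omit [IsProbabilityMeasure μ] in
lemma LocalDesign.norm_approxBias_le (hD : LocalDesign μ x K R h C)
    (hΥ : ∀ u, mv (Matrix.diagonal (Υ h)) (R u) = R (u / h))
    (hR : ∀ u₀, ∃ C : ℝ, ∀ᶠ u in 𝓝 u₀, ‖R u‖ ≤ C) (θ : Vec d) (n : ℕ)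
    {xs : ℕ → ℝ} (hxs : ∀ i, xs i ∈ μ.support) :
    ‖approxBias μ x K R Υ θ h n xs‖ ≤ approxError μ x R θ h * averageWeight x K R h n xs := by
  have : approxBias μ x K R Υ θ h n xs = (1 / (n : ℝ)) • ∑ j ∈ Finset.range n,
      (cdf μ (xs j) - inner ℝ (R (xs j - x)) θ) • weightedBasis x K R h (xs j) := by
    simp only [approxBias, hΥ, weightedBasis, smul_smul]
  rw [this, norm_smul, Real.norm_of_nonneg (by positivity), averageWeight, mul_left_comm]
  gcongr
  rw [Finset.mul_sum]
  exact (norm_sum_le _ _).trans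
    (Finset.sum_le_sum fun j _ => hD.norm_smul_weightedBasis_le hR θ (hxs j))

omit [IsProbabilityMeasure P] [IsProbabilityMeasure μ] in
lemma ae_mem_support (hX : ∀ i, Measurable (X i)) (hlaw : ∀ i, P.map (X i) = μ) :
    ∀ᵐ ω ∂P, ∀ i, X i ω ∈ μ.support := by
  rw [ae_all_iff]
  intro i
  have h1 : ∀ᵐ y ∂(P.map (X i)), y ∈ μ.support := by
    rw [hlaw i]; exact Measure.support_mem_ae
  exact ae_of_ae_map (hX i).aemeasurable h1

end Statistics

/-! ### Matrices with spectrum bounded below, and the standardizing matrix -/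

section LinearAlgebra

variable {d : ℕ}

lemma mv_mul (A B : Matrix (Fin d) (Fin d) ℝ) (v : Vec d) : mv (A * B) v = mv A (mv B v) := by
  simp [mv, Matrix.mulVec_mulVec]

lemma mv_one (v : Vec d) : mv (1 : Matrix (Fin d) (Fin d) ℝ) v = v := by
  simp [mv]

lemma mv_sub (A : Matrix (Fin d) (Fin d) ℝ) (v w : Vec d) : mv A (v - w) = mv A v - mv A w := by
  simp [mv, Matrix.mulVec_sub]

lemma sub_mv (A B : Matrix (Fin d) (Fin d) ℝ) (v : Vec d) : mv (A - B) v = mv A v - mv B v := by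
  simp [mv, Matrix.sub_mulVec]

lemma mv_smul (A : Matrix (Fin d) (Fin d) ℝ) (s : ℝ) (v : Vec d) : mv A (s • v) = s • mv A v := by
  simp [mv, Matrix.mulVec_smul]

lemma mv_sum (A : Matrix (Fin d) (Fin d) ℝ) {ι : Type*} (s : Finset ι) (g : ι → Vec d) :
    mv A (∑ i ∈ s, g i) = ∑ i ∈ s, mv A (g i) := by
  simp [mv, Matrix.mulVec_sum]

lemma mv_apply (A : Matrix (Fin d) (Fin d) ℝ) (v : Vec d) (k : Fin d) :
    mv A v k = ∑ l, A k l * v l := rfl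

lemma continuous_mv (A : Matrix (Fin d) (Fin d) ℝ) : Continuous (mv A) :=
  (PiLp.continuous_toLp 2 _).comp ((A.mulVecLin.continuous_of_finiteDimensional).comp
    (PiLp.continuous_ofLp 2 _))

lemma inner_mv (A : Matrix (Fin d) (Fin d) ℝ) (u v : Vec d) :
    inner ℝ u (mv A v) = WithLp.ofLp u ⬝ᵥ (A *ᵥ WithLp.ofLp v) := by
  simp [mv, EuclideanSpace.inner_eq_star_dotProduct, dotProduct_comm]

lemma inner_mv_transpose (A : Matrix (Fin d) (Fin d) ℝ) (u v : Vec d) :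
    inner ℝ (mv A u) v = inner ℝ u (mv Aᵀ v) := by
  rw [real_inner_comm, inner_mv, inner_mv, Matrix.dotProduct_mulVec, Matrix.mulVec_transpose,
    dotProduct_comm]

lemma norm_mv_le (A : Matrix (Fin d) (Fin d) ℝ) (v : Vec d) : ‖mv A v‖ ≤ matrixNorm A * ‖v‖ := by
  have h0 : 0 ≤ matrixNorm A := Real.sqrt_nonneg _
  refine le_of_sq_le_sq ?_ (by positivity)
  rw [mul_pow, matrixNorm_sq, EuclideanSpace.real_norm_sq_eq, EuclideanSpace.real_norm_sq_eq,
    Finset.sum_mul]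
  refine Finset.sum_le_sum fun k _ => ?_
  rw [mv_apply]
  exact Finset.sum_mul_sq_le_sq_mul_sq _ _ _

lemma posSemidef_sub_of_le_spectrum {A : Matrix (Fin d) (Fin d) ℝ} (hA : A.IsHermitian) {c : ℝ}
    (hc : ∀ l ∈ spectrum ℝ A, c ≤ l) : (A - algebraMap ℝ _ c).PosSemidef := by
  rw [Matrix.posSemidef_iff_isHermitian_and_spectrum_nonneg]
  refine ⟨hA.sub ?_, ?_⟩
  · rw [Matrix.algebraMap_eq_diagonal]
    exact Matrix.isHermitian_diagonal _
  · rw [← spectrum.sub_singleton_eq]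
    rintro _ ⟨l, hl, _, rfl, rfl⟩
    simpa using hc l hl

/-- A symmetric matrix with spectrum in `[c, ∞)` has quadratic form at least `c`. -/
lemma le_inner_mv_of_le_spectrum {A : Matrix (Fin d) (Fin d) ℝ} (hA : A.IsHermitian) {c : ℝ}
    (hc : ∀ l ∈ spectrum ℝ A, c ≤ l) (v : Vec d) : c * ‖v‖ ^ 2 ≤ inner ℝ v (mv A v) := by
  have h := (posSemidef_sub_of_le_spectrum hA hc).dotProduct_mulVec_nonneg (WithLp.ofLp v)
  have h1 : inner ℝ v (mv (A - algebraMap ℝ _ c) v) = inner ℝ v (mv A v) - c * ‖v‖ ^ 2 := by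
    have : mv (algebraMap ℝ (Matrix (Fin d) (Fin d) ℝ) c) v = c • v := by
      rw [Algebra.algebraMap_eq_smul_one]
      simp [mv, Matrix.smul_mulVec]
    rw [sub_mv, this, inner_sub_right, real_inner_smul_right, real_inner_self_eq_norm_sq]
  have h2 : 0 ≤ inner ℝ v (mv (A - algebraMap ℝ _ c) v) := by
    rw [inner_mv]; simpa using h
  linarith

lemma posDef_of_le_inner_mv {A : Matrix (Fin d) (Fin d) ℝ} (hA : A.IsHermitian) {c : ℝ}
    (hc : 0 < c) (h : ∀ v : Vec d, c * ‖v‖ ^ 2 ≤ inner ℝ v (mv A v)) : A.PosDef := by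
  refine Matrix.PosDef.of_dotProduct_mulVec_pos hA fun v hv => ?_
  have h1 := h (WithLp.toLp 2 v)
  rw [inner_mv] at h1
  have h2 : 0 < ‖(WithLp.toLp 2 v : Vec d)‖ := by
    rw [norm_pos_iff]
    intro h0
    exact hv (by simpa using h0)
  have : 0 < c * ‖(WithLp.toLp 2 v : Vec d)‖ ^ 2 := by positivity
  simpa using lt_of_lt_of_le this h1

lemma spectrum_pos_of_posDef {A : Matrix (Fin d) (Fin d) ℝ} (hA : A.PosDef) :
    ∀ l ∈ spectrum ℝ A, 0 < l := by
  intro l hl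
  rw [hA.1.spectrum_real_eq_range_eigenvalues] at hl
  obtain ⟨i, rfl⟩ := hl
  exact hA.eigenvalues_pos i

lemma isHermitian_invSqrt (A : Matrix (Fin d) (Fin d) ℝ) : (invSqrt A).IsHermitian :=
  cfc_predicate (R := ℝ) _ A

lemma invSqrt_mul_mul_invSqrt {A : Matrix (Fin d) (Fin d) ℝ} (hA : A.PosDef) :
    invSqrt A * A * invSqrt A = 1 := by
  have hpos := spectrum_pos_of_posDef hA
  have hsa : IsSelfAdjoint A := hA.1
  have hcont : ContinuousOn (fun t : ℝ => t ^ (-(1 / 2) : ℝ)) (spectrum ℝ A) := fun t ht =>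
    (Real.continuousAt_rpow_const _ _ (Or.inl (hpos t ht).ne')).continuousWithinAt
  have hid : cfc (fun t : ℝ => t) A = A := cfc_id' ℝ A hsa
  calc invSqrt A * A * invSqrt A
      = invSqrt A * cfc (fun t : ℝ => t) A * invSqrt A := by rw [hid]
    _ = cfc (fun t : ℝ => t ^ (-(1 / 2) : ℝ) * t * t ^ (-(1 / 2) : ℝ)) A := by
        rw [cfc_mul (fun t : ℝ => t ^ (-(1 / 2) : ℝ) * t) _ A (hcont.mul continuousOn_id) hcont,
          cfc_mul _ (fun t : ℝ => t) A hcont continuousOn_id]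
        rfl
    _ = cfc (fun _ : ℝ => (1 : ℝ)) A := by
        refine cfc_congr fun t ht => ?_
        have ht0 := hpos t ht
        rw [mul_right_comm, ← Real.rpow_add ht0]
        norm_num
        rw [Real.rpow_neg_one, inv_mul_cancel₀ ht0.ne']
    _ = 1 := cfc_const_one ℝ A hsa

/-- The matrix `(Γ⁻¹ Σ Γ⁻¹)^{-1/2} Γ⁻¹`, which turns the linear term into a vector with identity
covariance. -/
def whitening (G S : Matrix (Fin d) (Fin d) ℝ) : Matrix (Fin d) (Fin d) ℝ :=
  invSqrt (G⁻¹ * S * G⁻¹) * G⁻¹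

lemma whitening_mul_mul_transpose {G S : Matrix (Fin d) (Fin d) ℝ} (hG : G.PosDef)
    (hS : S.PosDef) : whitening G S * S * (whitening G S)ᵀ = 1 := by
  have hGi : (G⁻¹)ᵀ = G⁻¹ := by
    have := hG.inv.1
    rwa [Matrix.IsHermitian, Matrix.conjTranspose_eq_transpose_of_trivial] at this
  have hAi := isHermitian_invSqrt (G⁻¹ * S * G⁻¹)
  rw [Matrix.IsHermitian, Matrix.conjTranspose_eq_transpose_of_trivial] at hAi
  have hA : (G⁻¹ * S * G⁻¹).PosDef := by
    have := hS.conjTranspose_mul_mul_same (B := G⁻¹)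
      (Matrix.mulVec_injective_of_isUnit hG.inv.isUnit)
    rwa [Matrix.conjTranspose_eq_transpose_of_trivial, hGi] at this
  rw [whitening, Matrix.transpose_mul, hAi, hGi, ← invSqrt_mul_mul_invSqrt hA]
  simp only [Matrix.mul_assoc]

lemma norm_transpose_mv_sq_le {M S : Matrix (Fin d) (Fin d) ℝ} (hM : M * S * Mᵀ = 1) {c : ℝ}
    (h : ∀ v : Vec d, c * ‖v‖ ^ 2 ≤ inner ℝ v (mv S v)) (v : Vec d) :
    c * ‖mv Mᵀ v‖ ^ 2 ≤ ‖v‖ ^ 2 := by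
  refine (h _).trans (le_of_eq ?_)
  rw [inner_mv_transpose, Matrix.transpose_transpose, ← mv_mul, ← mv_mul, hM, mv_one,
    real_inner_self_eq_norm_sq]

/-- The standardizing matrix has operator norm at most `c^{-1/2}` when `Σ ≥ c`. -/
lemma norm_mv_le_of_whitening {M S : Matrix (Fin d) (Fin d) ℝ} (hM : M * S * Mᵀ = 1) {c : ℝ}
    (hc : 0 < c) (h : ∀ v : Vec d, c * ‖v‖ ^ 2 ≤ inner ℝ v (mv S v)) (v : Vec d) :
    ‖mv M v‖ ≤ (Real.sqrt c)⁻¹ * ‖v‖ := by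
  have hs : 0 < Real.sqrt c := Real.sqrt_pos.2 hc
  have hT : ∀ w : Vec d, ‖mv Mᵀ w‖ ≤ (Real.sqrt c)⁻¹ * ‖w‖ := fun w => by
    rw [← div_eq_inv_mul, le_div_iff₀ hs]
    refine le_of_sq_le_sq ?_ (norm_nonneg _)
    rw [mul_pow, Real.sq_sqrt hc.le, mul_comm]
    exact norm_transpose_mv_sq_le hM h w
  rcases eq_or_lt_of_le (norm_nonneg (mv M v)) with h0 | h0
  · rw [← h0]; positivity
  refine le_of_mul_le_mul_right ?_ h0
  calc ‖mv M v‖ * ‖mv M v‖ = inner ℝ v (mv Mᵀ (mv M v)) := by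
        rw [← inner_mv_transpose, real_inner_self_eq_norm_mul_norm]
    _ ≤ ‖v‖ * ‖mv Mᵀ (mv M v)‖ := real_inner_le_norm _ _
    _ ≤ ‖v‖ * ((Real.sqrt c)⁻¹ * ‖mv M v‖) := by gcongr; exact hT _
    _ = (Real.sqrt c)⁻¹ * ‖v‖ * ‖mv M v‖ := by ring

end LinearAlgebra

/-! ### Normal equations of the two estimators -/

section NormalEquations

variable {d : ℕ}

lemma eq_zero_of_forall_quadratic_nonneg {a b : ℝ} (h : ∀ s : ℝ, 0 ≤ s ^ 2 * a - s * b) :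
    b = 0 := by
  by_contra hb
  have hb2 : 0 < b ^ 2 := by positivity
  have ha : 0 < |a| + 1 := by positivity
  have h1 := h (b / (|a| + 1))
  have h2 : (b / (|a| + 1)) ^ 2 * a - b / (|a| + 1) * b
      = (b ^ 2 / (|a| + 1)) * (a / (|a| + 1) - 1) := by field_simp
  rw [h2] at h1
  have h3 : a / (|a| + 1) < 1 := by rw [div_lt_one ha]; linarith [le_abs_self a]
  have h4 : 0 < b ^ 2 / (|a| + 1) := by positivity
  nlinarith

/-- The normal equations of weighted least squares over a measure `ν`. -/
lemma integral_residual_eq_zero {ν : Measure ℝ} {φ w : ℝ → ℝ} {r : ℝ → Vec d} {t : Vec d}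
    (h0 : ∀ t, Integrable (fun u => (φ u - inner ℝ (r u) t) ^ 2 * w u) ν)
    (h1 : ∀ t v, Integrable (fun u => (φ u - inner ℝ (r u) t) * w u * inner ℝ (r u) v) ν)
    (h2 : ∀ v, Integrable (fun u => inner ℝ (r u) v ^ 2 * w u) ν)
    (ht : IsMinOn (fun t => ∫ u, (φ u - inner ℝ (r u) t) ^ 2 * w u ∂ν) Set.univ t) (v : Vec d) :
    ∫ u, (φ u - inner ℝ (r u) t) * w u * inner ℝ (r u) v ∂ν = 0 := by
  have key : ∀ s : ℝ, 0 ≤ s ^ 2 * (∫ u, inner ℝ (r u) v ^ 2 * w u ∂ν)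
      - s * (2 * ∫ u, (φ u - inner ℝ (r u) t) * w u * inner ℝ (r u) v ∂ν) := fun s => by
    have hmin := isMinOn_univ_iff.1 ht (t + s • v)
    have hexp : ∫ u, (φ u - inner ℝ (r u) (t + s • v)) ^ 2 * w u ∂ν
        = ∫ u, (φ u - inner ℝ (r u) t) ^ 2 * w u ∂ν
          + (s ^ 2 * (∫ u, inner ℝ (r u) v ^ 2 * w u ∂ν)
          - s * (2 * ∫ u, (φ u - inner ℝ (r u) t) * w u * inner ℝ (r u) v ∂ν)) := by
      rw [← integral_const_mul, ← integral_const_mul, ← integral_const_mul, ← integral_sub,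
        ← integral_add (h0 t)]
      · refine integral_congr_ae (ae_of_all _ fun u => ?_)
        simp only [inner_add_right, real_inner_smul_right]
        ring
      · exact ((h2 v).const_mul _).sub (((h1 t v).const_mul _).const_mul _)
      · exact (h2 v).const_mul _
      · exact ((h1 t v).const_mul _).const_mul _
    rw [hexp] at hmin
    linarith
  have := eq_zero_of_forall_quadratic_nonneg key
  linarith

end NormalEquations

section Estimators

variable {d : ℕ} {μ : Measure ℝ} [IsProbabilityMeasure μ] {x : ℝ} {f K : ℝ → ℝ}
  {R : ℝ → Vec d} {Υ : ℝ → Fin d → ℝ} {h C : ℝ}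

/-- The score of the weighted regression of `F̂` on the rescaled basis at the parameter `θ`. -/
def sampleScore (x : ℝ) (K : ℝ → ℝ) (R : ℝ → Vec d) (θ : Vec d) (h : ℝ) (n : ℕ)
    (xs : ℕ → ℝ) : Vec d :=
  (1 / (n : ℝ)) • ∑ j ∈ Finset.range n,
    (empCDF n xs (xs j) - inner ℝ (R (xs j - x)) θ) • weightedBasis x K R h (xs j)

/-- The integral of the approximation error against the design; the bias of the local `L²`
estimator. -/
def designBias (μ : Measure ℝ) (x : ℝ) (K : ℝ → ℝ) (R : ℝ → Vec d) (θ : Vec d) (h : ℝ) : Vec d :=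
  ∫ y, (cdf μ y - inner ℝ (R (y - x)) θ) • weightedBasis x K R h y ∂μ

lemma diagonal_mul_inv (hΥ0 : ∀ k, 0 < Υ h k) :
    Matrix.diagonal (Υ h) * (Matrix.diagonal (Υ h))⁻¹ = 1 := by
  apply Matrix.mul_nonsing_inv
  rw [Matrix.det_diagonal]
  exact (Finset.prod_ne_zero_iff.2 fun k _ => (hΥ0 k).ne').isUnit

lemma inner_diagonal_mv (v w : Vec d) :
    inner ℝ (mv (Matrix.diagonal (Υ h)) v) w = inner ℝ v (mv (Matrix.diagonal (Υ h)) w) := by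
  rw [inner_mv_transpose, Matrix.diagonal_transpose]

lemma inner_basis_eq (hΥ0 : ∀ k, 0 < Υ h k)
    (hΥ : ∀ u, mv (Matrix.diagonal (Υ h)) (R u) = R (u / h)) (u : ℝ) (v : Vec d) :
    inner ℝ (R u) v = inner ℝ (R (u / h)) (mv (Matrix.diagonal (Υ h))⁻¹ v) := by
  rw [← hΥ, inner_diagonal_mv, ← mv_mul, diagonal_mul_inv hΥ0, mv_one]

lemma regression_normal_equation {n : ℕ} {xs : ℕ → ℝ} {t : Vec d}
    (ht : IsMinOn (localRegressionCriterion x K R h n xs) Set.univ t) (v : Vec d) :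
    ∑ i ∈ Finset.range n, (empCDF n xs (xs i) - inner ℝ (R (xs i - x)) t)
      * kernelWeight K h x (xs i) * inner ℝ (R (xs i - x)) v = 0 := by
  have hi : ∀ g : ℝ → ℝ, Integrable g (∑ i ∈ Finset.range n, Measure.dirac (xs i)) := fun g =>
    integrable_finsetSum_measure.2 fun i _ => integrable_dirac (by simp)
  have hint : ∀ g : ℝ → ℝ, ∫ u, g u ∂(∑ i ∈ Finset.range n, Measure.dirac (xs i))
      = ∑ i ∈ Finset.range n, g (xs i) := fun g => by
    rw [integral_finsetSum_measure fun i _ => integrable_dirac (by simp)]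
    simp
  rw [← hint (fun u => (empCDF n xs u - inner ℝ (R (u - x)) t)
      * kernelWeight K h x u * inner ℝ (R (u - x)) v)]
  refine integral_residual_eq_zero (fun _ => hi _) (fun _ _ => hi _) (fun _ => hi _) ?_ v
  simp only [hint]
  exact ht

omit [IsProbabilityMeasure μ] in
lemma gamHat_mv (hΥ : ∀ u, mv (Matrix.diagonal (Υ h)) (R u) = R (u / h)) (n : ℕ) (xs : ℕ → ℝ)
    (v : Vec d) : mv (GamHat x K R Υ h n xs) v = (1 / (n : ℝ)) • ∑ i ∈ Finset.range n,
      inner ℝ (R ((xs i - x) / h)) v • weightedBasis x K R h (xs i) := by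
  ext k
  simp only [mv_apply, gamHat_apply hΥ, PiLp.smul_apply, vec_sum_apply, smul_eq_mul, weightedBasis,
    PiLp.inner_apply, RCLike.inner_apply, conj_trivial, Finset.mul_sum, Finset.sum_mul]
  rw [Finset.sum_comm]
  refine Finset.sum_congr rfl fun i _ => Finset.sum_congr rfl fun l _ => ?_
  ring

/-- The normal equations of the local regression estimator, rescaled. -/
lemma gamHat_mv_eq_sampleScore (hΥ0 : ∀ k, 0 < Υ h k)
    (hΥ : ∀ u, mv (Matrix.diagonal (Υ h)) (R u) = R (u / h)) (θ : Vec d) {n : ℕ} {xs : ℕ → ℝ}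
    {t : Vec d} (ht : IsMinOn (localRegressionCriterion x K R h n xs) Set.univ t) :
    mv (GamHat x K R Υ h n xs) (mv (Matrix.diagonal (Υ h))⁻¹ (t - θ))
      = sampleScore x K R θ h n xs := by
  rw [gamHat_mv hΥ, sampleScore]
  congr 1
  rw [← sub_eq_zero, ← Finset.sum_sub_distrib]
  refine ext_inner_right ℝ fun e => ?_
  rw [inner_zero_left, sum_inner, ← neg_eq_zero, ← Finset.sum_neg_distrib,
    ← regression_normal_equation ht (mv (Matrix.diagonal (Υ h)) e)]
  refine Finset.sum_congr rfl fun i _ => ?_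
  rw [← inner_diagonal_mv, hΥ, ← inner_basis_eq hΥ0 hΥ, inner_sub_left, real_inner_smul_left,
    real_inner_smul_left, weightedBasis, real_inner_smul_left, inner_sub_right]
  ring

omit [IsProbabilityMeasure μ] in
lemma empCDF_sub_cdf {n : ℕ} (hn : 0 < n) (xs : ℕ → ℝ) (u : ℝ) :
    empCDF n xs u - cdf μ u = (1 / (n : ℝ)) * ∑ i ∈ Finset.range n, centredInd μ (xs i) u := by
  simp only [empCDF, centredInd, Finset.sum_sub_distrib, Finset.sum_const, Finset.card_range,
    nsmul_eq_mul]
  field_simp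

omit [IsProbabilityMeasure μ] in
/-- Decomposition of the score into the linear term, the degenerate U-statistic and the two
biases. The diagonal of the double sum over observations gives the leave-in bias and removes the
fraction `1/n` of the linear term. -/
lemma sampleScore_eq (hS : LocalSubstitution μ x f K h) (h0 : 0 < h)
    (hΥ : ∀ u, mv (Matrix.diagonal (Υ h)) (R u) = R (u / h)) (θ : Vec d) {n : ℕ} (hn : 0 < n)
    (xs : ℕ → ℝ) :
    sampleScore x K R θ h n xs = linearTerm μ x K R h n xs
      + (quadraticTerm μ x f K R Υ h n xs + leaveInBias μ x K R Υ h n xs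
        + approxBias μ x K R Υ θ h n xs - (1 / (n : ℝ)) • linearTerm μ x K R h n xs) := by
  set G := weightedBasis x K R h with hG
  set I := designInfluence μ x K R h with hI
  have hn0 : (n : ℝ) ≠ 0 := by positivity
  have hA : approxBias μ x K R Υ θ h n xs = (1 / (n : ℝ)) • ∑ j ∈ Finset.range n,
      (cdf μ (xs j) - inner ℝ (R (xs j - x)) θ) • G (xs j) := by
    simp only [approxBias, hΥ, hG, weightedBasis, smul_smul]
  have hB : leaveInBias μ x K R Υ h n xs = (1 / (n : ℝ) ^ 2) • ∑ j ∈ Finset.range n,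
      centredInd μ (xs j) (xs j) • G (xs j) := by
    simp only [leaveInBias, hΥ, hG, weightedBasis, smul_smul, centredInd, indLe, le_refl, if_true]
  have hQ : quadraticTerm μ x f K R Υ h n xs = (1 / (n : ℝ) ^ 2) •
      (∑ i ∈ Finset.range n, ∑ j ∈ (Finset.range n).erase i, centredInd μ (xs i) (xs j) • G (xs j)
        - ((n : ℝ) - 1) • ∑ i ∈ Finset.range n, I (xs i)) := by
    simp only [quadraticTerm, hΥ, hG, hI, weightedBasis, smul_smul, centredInd, hS.influence_eq h0,
      Finset.sum_sub_distrib, Finset.sum_const, Finset.smul_sum]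
    congr 2
    refine Finset.sum_congr rfl fun i hi => ?_
    rw [Finset.card_erase_of_mem hi, Finset.card_range, ← Nat.cast_smul_eq_nsmul ℝ,
      Nat.cast_sub hn, Nat.cast_one]
  have hdouble : ∑ j ∈ Finset.range n, (empCDF n xs (xs j) - cdf μ (xs j)) • G (xs j)
      = (1 / (n : ℝ)) • (∑ i ∈ Finset.range n, ∑ j ∈ (Finset.range n).erase i,
          centredInd μ (xs i) (xs j) • G (xs j)
        + ∑ j ∈ Finset.range n, centredInd μ (xs j) (xs j) • G (xs j)) := by
    rw [← Finset.sum_add_distrib]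
    have : ∀ i ∈ Finset.range n,
        ∑ j ∈ (Finset.range n).erase i, centredInd μ (xs i) (xs j) • G (xs j)
        + centredInd μ (xs i) (xs i) • G (xs i)
        = ∑ j ∈ Finset.range n, centredInd μ (xs i) (xs j) • G (xs j) := fun i hi =>
      Finset.sum_erase_add _ _ hi
    rw [Finset.sum_congr rfl this, Finset.sum_comm, Finset.smul_sum]
    refine Finset.sum_congr rfl fun j _ => ?_
    rw [empCDF_sub_cdf hn, mul_smul, Finset.sum_smul]
  have hscore : sampleScore x K R θ h n xs
      = (1 / (n : ℝ)) • ∑ j ∈ Finset.range n, (empCDF n xs (xs j) - cdf μ (xs j)) • G (xs j)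
        + approxBias μ x K R Υ θ h n xs := by
    rw [hA, ← smul_add, ← Finset.sum_add_distrib, sampleScore]
    congr 1
    refine Finset.sum_congr rfl fun j _ => ?_
    rw [← add_smul, sub_add_sub_cancel]
  rw [hscore, hdouble, hQ, hB, linearTerm]
  match_scalars <;> field_simp
  ring

namespace LocalDesign

lemma integrable_mul_kernelWeight (hD : LocalDesign μ x K R h C) {ψ : ℝ → ℝ} (hψ : Measurable ψ)
    {b : ℝ} (hb : ∀ y ∈ Set.Icc (x - h) (x + h), |ψ y| ≤ b) :
    Integrable (fun y => ψ y * kernelWeight K h x y) μ := by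
  have h0 := hD.bandwidth_pos
  have hC := hD.const_pos
  refine integrable_of_abs_le (hψ.mul hD.measurable_kernelWeight) (b := |b| * (C / h)) fun y => ?_
  rw [abs_mul, abs_of_nonneg (hD.kernelWeight_nonneg y)]
  by_cases hy : y ∈ Set.Icc (x - h) (x + h)
  · exact mul_le_mul ((hb y hy).trans (le_abs_self b)) (hD.kernelWeight_le y)
      (hD.kernelWeight_nonneg y) (abs_nonneg _)
  · rw [hD.kernelWeight_eq_zero hy, mul_zero]; positivity

lemma gam_mv (hD : LocalDesign μ x K R h C) (hS : LocalSubstitution μ x f K h) (v e : Vec d) :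
    inner ℝ (mv (Gam μ x K R f h) v) e
      = ∫ y, inner ℝ (R ((y - x) / h)) v * inner ℝ (R ((y - x) / h)) e
          * kernelWeight K h x y ∂μ := by
  have hRm : ∀ k : Fin d, Measurable fun y => R ((y - x) / h) k := fun k =>
    (measurable_pi_apply k).comp ((WithLp.measurable_ofLp 2 _).comp
      (hD.measurable_basis.comp (by fun_prop)))
  have hint : ∀ k l : Fin d, Integrable (fun y =>
      kernelWeight K h x y * (R ((y - x) / h) k * R ((y - x) / h) l) * (v l * e k)) μ :=
    fun k l => by
    have := (hD.integrable_mul_kernelWeight ((hRm k).mul (hRm l)) (b := C * C) fun y hy => by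
      rw [Pi.mul_apply, abs_mul]
      have hk : ∀ k, |R ((y - x) / h) k| ≤ C := fun k =>
        (PiLp.norm_apply_le _ k).trans (hD.norm_basis_le hy)
      exact mul_le_mul (hk k) (hk l) (abs_nonneg _) hD.const_pos.le).mul_const (v l * e k)
    refine this.congr (ae_of_all _ fun y => ?_)
    simp only [Pi.mul_apply]
    ring
  have hsum : ∀ y, inner ℝ (R ((y - x) / h)) v * inner ℝ (R ((y - x) / h)) e
        * kernelWeight K h x y = ∑ k, ∑ l,
          kernelWeight K h x y * (R ((y - x) / h) k * R ((y - x) / h) l) * (v l * e k) :=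
    fun y => by
    simp only [PiLp.inner_apply, RCLike.inner_apply, conj_trivial]
    rw [mul_comm (∑ i, _), Finset.sum_mul_sum, Finset.sum_mul]
    refine Finset.sum_congr rfl fun k _ => ?_
    rw [Finset.sum_mul]
    refine Finset.sum_congr rfl fun l _ => ?_
    ring
  simp only [hsum]
  rw [integral_finsetSum _ fun k _ => integrable_finsetSum _ fun l _ => hint k l]
  simp only [PiLp.inner_apply, RCLike.inner_apply, conj_trivial, mv_apply]
  refine Finset.sum_congr rfl fun k _ => ?_
  rw [integral_finsetSum _ fun l _ => hint k l, Finset.mul_sum]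
  refine Finset.sum_congr rfl fun l _ => ?_
  rw [integral_mul_const, ← hS.gam_apply]
  ring

lemma integrable_bias (hD : LocalDesign μ x K R h C)
    (hR : ∀ u₀, ∃ C : ℝ, ∀ᶠ u in 𝓝 u₀, ‖R u‖ ≤ C) (θ : Vec d) :
    Integrable (fun y => (cdf μ y - inner ℝ (R (y - x)) θ) • weightedBasis x K R h y) μ := by
  have hm : Measurable fun y => (cdf μ y - inner ℝ (R (y - x)) θ) • weightedBasis x K R h y :=
    (((monotone_cdf μ).measurable).sub ((hD.measurable_basis.comp (by fun_prop)).inner_const)).smul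
      hD.measurable_weightedBasis
  refine Integrable.of_bound hm.aestronglyMeasurable (approxError μ x R θ h * (C ^ 2 / h)) ?_
  filter_upwards [Measure.support_mem_ae (μ := μ)] with y hy
  refine (hD.norm_smul_weightedBasis_le hR θ hy).trans ?_
  gcongr
  · exact approxError_nonneg θ h
  · exact hD.norm_weightedBasis_le_const y

lemma norm_designBias_le (hD : LocalDesign μ x K R h C)
    (hR : ∀ u₀, ∃ C : ℝ, ∀ᶠ u in 𝓝 u₀, ‖R u‖ ≤ C) (θ : Vec d) :
    ‖designBias μ x K R θ h‖ ≤ approxError μ x R θ h * C ^ 3 := by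
  have hi : Integrable (fun y => ‖weightedBasis x K R h y‖) μ :=
    integrable_of_abs_le hD.measurable_weightedBasis.norm (b := C ^ 2 / h) fun y => by
      rw [abs_norm]; exact hD.norm_weightedBasis_le_const y
  calc ‖designBias μ x K R θ h‖
      ≤ ∫ y, ‖(cdf μ y - inner ℝ (R (y - x)) θ) • weightedBasis x K R h y‖ ∂μ :=
        norm_integral_le_integral_norm _
    _ ≤ ∫ y, approxError μ x R θ h * ‖weightedBasis x K R h y‖ ∂μ := by
        refine integral_mono_of_nonneg (ae_of_all _ fun y => norm_nonneg _) (hi.const_mul _) ?_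
        filter_upwards [Measure.support_mem_ae (μ := μ)] with y hy
        exact hD.norm_smul_weightedBasis_le hR θ hy
    _ ≤ approxError μ x R θ h * C ^ 3 := by
        rw [integral_const_mul]
        exact mul_le_mul_of_nonneg_left hD.integral_norm_weightedBasis_le (approxError_nonneg θ h)

/-- The normal equations of the local `L²` estimator with design `F`, rescaled. -/
lemma gam_mv_eq_linearTerm_add (hD : LocalDesign μ x K R h C) (hS : LocalSubstitution μ x f K h)
    (hR : ∀ u₀, ∃ C : ℝ, ∀ᶠ u in 𝓝 u₀, ‖R u‖ ≤ C) (hΥ0 : ∀ k, 0 < Υ h k)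
    (hΥ : ∀ u, mv (Matrix.diagonal (Υ h)) (R u) = R (u / h)) (θ : Vec d) {n : ℕ} (hn : 0 < n)
    {xs : ℕ → ℝ} {t : Vec d} (ht : IsMinOn (localL2Criterion μ μ x K R h n xs) Set.univ t) :
    mv (Gam μ x K R f h) (mv (Matrix.diagonal (Υ h))⁻¹ (t - θ))
      = linearTerm μ x K R h n xs + designBias μ x K R θ h := by
  obtain ⟨B, hB⟩ := exists_bound_of_locally_bounded hR (isCompact_Icc (a := -h) (b := h))
  have hBR : ∀ (t : Vec d), ∀ y ∈ Set.Icc (x - h) (x + h), |inner ℝ (R (y - x)) t| ≤ B * ‖t‖ :=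
    fun t y hy => (abs_real_inner_le_norm _ _).trans (mul_le_mul_of_nonneg_right
      (hB _ ⟨by linarith [hy.1], by linarith [hy.2]⟩) (norm_nonneg _))
  have hRm : ∀ t : Vec d, Measurable fun y => inner ℝ (R (y - x)) t := fun t =>
    (hD.measurable_basis.comp (by fun_prop)).inner_const
  have hEm : Measurable (empCDF n xs) := by
    refine (Finset.measurable_fun_sum _ fun i _ => ?_).const_mul _
    exact Measurable.ite (measurableSet_le measurable_const measurable_id) measurable_const
      measurable_const
  have hEb : ∀ u, |empCDF n xs u| ≤ 1 := fun u => by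
    rw [empCDF, abs_mul, abs_of_nonneg (by positivity), one_div, inv_mul_le_iff₀ (by positivity)]
    refine (Finset.abs_sum_le_sum_abs _ _).trans ?_
    refine (Finset.sum_le_sum (g := fun _ => 1) fun i _ => ?_).trans (by simp)
    unfold indLe; split_ifs <;> simp
  have hresb : ∀ (t : Vec d), ∀ y ∈ Set.Icc (x - h) (x + h),
      |empCDF n xs y - inner ℝ (R (y - x)) t| ≤ 1 + B * ‖t‖ := fun t y hy =>
    (abs_sub _ _).trans (add_le_add (hEb y) (hBR t y hy))
  have hi1 : ∀ t v : Vec d, Integrable (fun u => (empCDF n xs u - inner ℝ (R (u - x)) t)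
      * kernelWeight K h x u * inner ℝ (R (u - x)) v) μ := fun t v => by
    refine (hD.integrable_mul_kernelWeight ((hEm.sub (hRm t)).mul (hRm v))
      (b := (1 + B * ‖t‖) * (B * ‖v‖)) fun y hy => ?_).congr (ae_of_all _ fun y => ?_)
    · simp only [Pi.mul_apply, Pi.sub_apply]
      rw [abs_mul]
      exact mul_le_mul (hresb t y hy) (hBR v y hy) (abs_nonneg _)
        ((abs_nonneg _).trans (hresb t y hy))
    · simp only [Pi.mul_apply, Pi.sub_apply]; ring
  have hsupp : μ.restrict μ.support = μ :=
    Measure.restrict_eq_self_of_ae_mem Measure.support_mem_ae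
  have hnormal := integral_residual_eq_zero (ν := μ) (φ := empCDF n xs)
    (w := kernelWeight K h x) (r := fun u => R (u - x)) (t := t)
    (fun t => hD.integrable_mul_kernelWeight ((hEm.sub (hRm t)).pow_const 2)
      (b := (1 + B * ‖t‖) ^ 2) fun y hy => by
        rw [abs_pow]; exact pow_le_pow_left₀ (abs_nonneg _) (hresb t y hy) 2)
    hi1
    (fun v => hD.integrable_mul_kernelWeight ((hRm v).pow_const 2)
      (b := (B * ‖v‖) ^ 2) fun y hy => by
        rw [abs_pow]; exact pow_le_pow_left₀ (abs_nonneg _) (hBR v y hy) 2)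
    (by
      have hmin : IsMinOn (fun t => ∫ u in μ.support, (empCDF n xs u - inner ℝ (R (u - x)) t) ^ 2
        * kernelWeight K h x u ∂μ) Set.univ t := ht
      rwa [hsupp] at hmin)
  have hL : linearTerm μ x K R h n xs + designBias μ x K R θ h
      = ∫ y, (empCDF n xs y - inner ℝ (R (y - x)) θ) • weightedBasis x K R h y ∂μ := by
    have hsplit : ∀ y, (empCDF n xs y - inner ℝ (R (y - x)) θ) • weightedBasis x K R h y
        = (1 / (n : ℝ)) • (∑ i ∈ Finset.range n, centredInd μ (xs i) y • weightedBasis x K R h y)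
          + (cdf μ y - inner ℝ (R (y - x)) θ) • weightedBasis x K R h y := fun y => by
      rw [← Finset.sum_smul, smul_smul, ← empCDF_sub_cdf hn, ← add_smul, sub_add_sub_cancel]
    simp only [hsplit]
    rw [integral_add, integral_smul, integral_finsetSum]
    · rfl
    · exact fun i _ => hD.integrable_centredInd_smul _
    · exact (integrable_finsetSum _ fun i _ => hD.integrable_centredInd_smul _).fun_smul _
    · exact hD.integrable_bias hR θ
  have hLi : Integrable (fun y => (empCDF n xs y - inner ℝ (R (y - x)) θ)
      • weightedBasis x K R h y) μ := by
    have hm : Measurable fun y => (empCDF n xs y - inner ℝ (R (y - x)) θ)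
        • weightedBasis x K R h y := (hEm.sub (hRm θ)).smul hD.measurable_weightedBasis
    refine Integrable.of_bound hm.aestronglyMeasurable ((1 + B * ‖θ‖) * (C ^ 2 / h))
      (ae_of_all _ fun y => ?_)
    rw [norm_smul]
    by_cases hy : y ∈ Set.Icc (x - h) (x + h)
    · exact mul_le_mul (hresb θ y hy) (hD.norm_weightedBasis_le_const y) (norm_nonneg _)
        ((abs_nonneg _).trans (hresb θ y hy))
    · have hx : x ∈ Set.Icc (x - h) (x + h) :=
        ⟨by linarith [hD.bandwidth_pos], by linarith [hD.bandwidth_pos]⟩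
      rw [weightedBasis, hD.kernelWeight_eq_zero hy, zero_smul, norm_zero, mul_zero]
      exact mul_nonneg ((abs_nonneg _).trans (hresb θ x hx))
        (div_nonneg (sq_nonneg _) hD.bandwidth_pos.le)
  refine ext_inner_right ℝ fun e => ?_
  rw [hD.gam_mv hS, hL, real_inner_comm, ← integral_inner hLi]
  have hn := hnormal (mv (Matrix.diagonal (Υ h)) e)
  have hi2 := hi1 t (mv (Matrix.diagonal (Υ h)) e)
  have hi3 := hi1 θ (mv (Matrix.diagonal (Υ h)) e)
  have e1 : ∀ y, inner ℝ e ((empCDF n xs y - inner ℝ (R (y - x)) θ) • weightedBasis x K R h y)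
      = (empCDF n xs y - inner ℝ (R (y - x)) θ) * kernelWeight K h x y
        * inner ℝ (R (y - x)) (mv (Matrix.diagonal (Υ h)) e) := fun y => by
    rw [← inner_diagonal_mv, hΥ, weightedBasis, real_inner_smul_right, real_inner_smul_right,
      real_inner_comm (R ((y - x) / h)) e]
    ring
  have e2 : ∀ y, inner ℝ (R ((y - x) / h)) (mv (Matrix.diagonal (Υ h))⁻¹ (t - θ))
        * inner ℝ (R ((y - x) / h)) e * kernelWeight K h x y
      = (empCDF n xs y - inner ℝ (R (y - x)) θ) * kernelWeight K h x y
        * inner ℝ (R (y - x)) (mv (Matrix.diagonal (Υ h)) e)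
        - (empCDF n xs y - inner ℝ (R (y - x)) t) * kernelWeight K h x y
        * inner ℝ (R (y - x)) (mv (Matrix.diagonal (Υ h)) e) := fun y => by
    rw [← inner_diagonal_mv, hΥ, ← inner_basis_eq hΥ0 hΥ, inner_sub_right]
    ring
  simp only [e1, e2]
  rw [integral_sub hi3 hi2, hn, sub_zero]

end LocalDesign

end Estimators

/-! ### A central limit theorem for row-wise i.i.d. bounded arrays -/

section CLT

variable {Ω : Type*} [MeasurableSpace Ω] {P : Measure Ω} [IsProbabilityMeasure P]
  {d : ℕ} {μ : Measure ℝ} [IsProbabilityMeasure μ] {X : ℕ → Ω → ℝ}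

lemma norm_exp_mul_I_sub_taylor_le {y : ℝ} (hy : |y| ≤ 1) :
    ‖Complex.exp (y * Complex.I) - (1 + y * Complex.I - y ^ 2 / 2)‖ ≤ |y| ^ 3 := by
  have hn : ‖(y : ℂ) * Complex.I‖ = |y| := by simp
  have h := Complex.exp_bound (x := (y : ℂ) * Complex.I) (by rw [hn]; exact hy) (n := 3)
    (by norm_num)
  have hs : ∑ m ∈ Finset.range 3, ((y : ℂ) * Complex.I) ^ m / (m.factorial : ℂ)
      = 1 + y * Complex.I - y ^ 2 / 2 := by
    simp [Finset.sum_range_succ, mul_pow]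
    ring
  rw [hs, hn] at h
  refine h.trans (mul_le_of_le_one_right (by positivity) ?_)
  norm_num [Nat.factorial]

/-- Second-order expansion of the characteristic function of a small bounded centred variable. -/
lemma norm_integral_exp_sub_le {Y : ℝ → ℝ} (hY : Measurable Y) {ε v : ℝ} (hε : ε ≤ 1)
    (hb : ∀ a, |Y a| ≤ ε) (h1 : ∫ a, Y a ∂μ = 0) (h2 : ∫ a, Y a ^ 2 ∂μ = v) :
    ‖∫ a, Complex.exp (Y a * Complex.I) ∂μ - (1 - v / 2)‖ ≤ ε * v := by
  have hY2 : ∀ a, |Y a ^ 2| ≤ ε ^ 2 := fun a => by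
    rw [abs_pow]; exact pow_le_pow_left₀ (abs_nonneg _) (hb a) 2
  have hi1 : Integrable (fun a => (Y a : ℂ)) μ := (integrable_of_abs_le hY hb).ofReal
  have hi2r : Integrable (fun a => Y a ^ 2) μ := integrable_of_abs_le (hY.pow_const 2) hY2
  have hi2 : Integrable (fun a => ((Y a ^ 2 : ℝ) : ℂ)) μ := hi2r.ofReal
  have hpoly : Integrable (fun a => 1 + (Y a : ℂ) * Complex.I - ((Y a ^ 2 : ℝ) : ℂ) / 2) μ :=
    ((integrable_const _).add (hi1.mul_const _)).sub (hi2.div_const _)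
  have hexp : Integrable (fun a => Complex.exp (Y a * Complex.I)) μ := by
    refine Integrable.of_bound (by fun_prop) 1 (ae_of_all _ fun a => ?_)
    rw [Complex.norm_exp_ofReal_mul_I]
  have hval : ∫ a, (1 + (Y a : ℂ) * Complex.I - ((Y a ^ 2 : ℝ) : ℂ) / 2) ∂μ = 1 - v / 2 := by
    have hlin : Integrable (fun a => 1 + (Y a : ℂ) * Complex.I) μ :=
      (integrable_const _).add (hi1.mul_const _)
    rw [integral_sub hlin (hi2.div_const _),
      integral_add (integrable_const _) (hi1.mul_const _), integral_mul_const, integral_div,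
      integral_complex_ofReal, integral_complex_ofReal, h1, h2]
    simp
  rw [← hval, ← integral_sub hexp hpoly]
  calc _ ≤ ∫ a, ε * Y a ^ 2 ∂μ := by
        refine norm_integral_le_of_norm_le (hi2r.const_mul _) (ae_of_all _ fun a => ?_)
        have h := norm_exp_mul_I_sub_taylor_le ((hb a).trans hε)
        push_cast
        refine h.trans ?_
        rw [pow_succ' |Y a| 2, sq_abs]
        exact mul_le_mul_of_nonneg_right (hb a) (sq_nonneg _)
    _ = ε * v := by rw [integral_const_mul, h2]

/-- Sums of i.i.d. rows with identity covariance and a bound that is negligible against `√n` are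
asymptotically standard normal. -/
theorem tendstoInDistribution_stdGaussian_of_rows (hX : ∀ i, Measurable (X i))
    (hind : iIndepFun X P) (hlaw : ∀ i, P.map (X i) = μ) {ζ : ℕ → ℝ → Vec d}
    (hζ : ∀ n, Measurable (ζ n)) {b : ℕ → ℝ}
    (hmean : ∀ᶠ n in atTop, ∀ t : Vec d, ∫ a, inner ℝ (ζ n a) t ∂μ = 0)
    (hcov : ∀ᶠ n in atTop, ∀ t : Vec d, ∫ a, inner ℝ (ζ n a) t ^ 2 ∂μ = ‖t‖ ^ 2)
    (hbd : ∀ᶠ n in atTop, ∀ a, ‖ζ n a‖ ≤ b n)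
    (hb : Tendsto (fun n : ℕ => (Real.sqrt n)⁻¹ * b n) atTop (𝓝 0)) :
    TendstoInDistribution
      (fun (n : ℕ) ω => (Real.sqrt n)⁻¹ • ∑ i ∈ Finset.range n, ζ n (X i ω))
      atTop id (fun _ => P) (stdGaussian (Vec d)) where
  forall_aemeasurable n := by
    have := hζ n
    exact Measurable.aemeasurable (by fun_prop)
  aemeasurable_limit := aemeasurable_id
  tendsto := by
    refine ProbabilityMeasure.tendsto_iff_tendsto_charFun.2 fun t => ?_
    simp only [ProbabilityMeasure.coe_mk, Measure.map_id, charFun_stdGaussian]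
    have hchar : ∀ n : ℕ, charFun (P.map fun ω =>
        (Real.sqrt n)⁻¹ • ∑ i ∈ Finset.range n, ζ n (X i ω)) t
        = (1 + (∫ a, Complex.exp (((Real.sqrt n)⁻¹ * inner ℝ (ζ n a) t : ℝ) * Complex.I) ∂μ
          - 1)) ^ n := fun n => by
      have hm : Measurable fun a => (Real.sqrt n)⁻¹ • ζ n a := by
        have := hζ n
        fun_prop
      have hrow : iIndepFun (fun i ω => (Real.sqrt n)⁻¹ • ζ n (X i ω)) P :=
        hind.comp (fun _ a => (Real.sqrt n)⁻¹ • ζ n a) fun _ => hm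
      simp only [Finset.smul_sum]
      have hrm : ∀ i, AEMeasurable (fun ω => (Real.sqrt n)⁻¹ • ζ n (X i ω)) P := fun i =>
        (hm.comp (hX i)).aemeasurable
      rw [iIndepFun.charFun_map_fun_finsetSum_eq_prod (fun i _ => hrm i) (hrow.restrict _),
        Finset.prod_apply]
      have : ∀ i, charFun (P.map fun ω => (Real.sqrt n)⁻¹ • ζ n (X i ω)) t
          = ∫ a, Complex.exp (((Real.sqrt n)⁻¹ * inner ℝ (ζ n a) t : ℝ) * Complex.I) ∂μ := by
        intro i
        rw [charFun_apply, integral_map (hrm i) (by fun_prop)]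
        simp only [real_inner_smul_left]
        refine integral_comp_law (φ := fun a =>
          Complex.exp (((Real.sqrt n)⁻¹ * inner ℝ (ζ n a) t : ℝ) * Complex.I)) hX hlaw ?_ i
        have := hζ n
        exact Measurable.stronglyMeasurable (by fun_prop)
      simp [this]
    simp only [hchar]
    refine Complex.tendsto_one_add_pow_exp_of_tendsto ?_
    have hlim : Tendsto (fun n : ℕ => (Real.sqrt n)⁻¹ * b n * ‖t‖) atTop (𝓝 0) := by
      simpa using hb.mul_const ‖t‖
    have hlim2 : Tendsto (fun n : ℕ => (Real.sqrt n)⁻¹ * b n * ‖t‖ * ‖t‖ ^ 2) atTop (𝓝 0) := by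
      simpa using hlim.mul_const (‖t‖ ^ 2)
    rw [tendsto_iff_norm_sub_tendsto_zero]
    refine squeeze_zero' (Eventually.of_forall fun n => norm_nonneg _) ?_ hlim2
    filter_upwards [hmean, hcov, hbd, hlim.eventually (ge_mem_nhds one_pos),
      eventually_gt_atTop 0] with n h1 h2 h3 h4 hn
    have hn0 : (0 : ℝ) < n := by exact_mod_cast hn
    have hnC : (n : ℂ) ≠ 0 := by exact_mod_cast hn.ne'
    have hm : Measurable fun a => (Real.sqrt n)⁻¹ * inner ℝ (ζ n a) t :=
      ((hζ n).inner_const).const_mul _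
    have hsq : ((Real.sqrt n)⁻¹) ^ 2 = (n : ℝ)⁻¹ := by
      rw [inv_pow, Real.sq_sqrt hn0.le]
    have key := norm_integral_exp_sub_le (μ := μ) hm (v := (n : ℝ)⁻¹ * ‖t‖ ^ 2) h4
      (fun a => by
        rw [abs_mul, abs_of_nonneg (by positivity), mul_assoc]
        gcongr
        exact (abs_real_inner_le_norm _ _).trans (by gcongr; exact h3 a))
      (by rw [integral_const_mul, h1, mul_zero])
      (by simp only [mul_pow]; rw [integral_const_mul, h2, hsq])
    have e : (n : ℂ) * (∫ a, Complex.exp (((Real.sqrt n)⁻¹ * inner ℝ (ζ n a) t : ℝ)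
          * Complex.I) ∂μ - 1) - (-(‖t‖ : ℂ) ^ 2 / 2)
        = n * (∫ a, Complex.exp (((Real.sqrt n)⁻¹ * inner ℝ (ζ n a) t : ℝ)
          * Complex.I) ∂μ - (1 - (((n : ℝ)⁻¹ * ‖t‖ ^ 2 : ℝ) : ℂ) / 2)) := by
      generalize ∫ a, Complex.exp (((Real.sqrt n)⁻¹ * inner ℝ (ζ n a) t : ℝ) * Complex.I) ∂μ = J
      push_cast
      field_simp
      ring
    rw [e, norm_mul, Complex.norm_natCast]
    calc (n : ℝ) * _ ≤ n * ((Real.sqrt n)⁻¹ * b n * ‖t‖ * ((n : ℝ)⁻¹ * ‖t‖ ^ 2)) := by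
          gcongr
      _ = (Real.sqrt n)⁻¹ * b n * ‖t‖ * ‖t‖ ^ 2 := by field_simp

end CLT

/-! ### Standardization -/

section Standardization

variable {d : ℕ} {μ : Measure ℝ} [IsProbabilityMeasure μ] {x : ℝ} {f K : ℝ → ℝ}
  {R : ℝ → Vec d} {Υ : ℝ → Fin d → ℝ} {h C c : ℝ}

omit [IsProbabilityMeasure μ] in
lemma LocalSubstitution.isHermitian_gam (hS : LocalSubstitution μ x f K h) :
    (Gam μ x K R f h).IsHermitian := by
  refine Matrix.IsHermitian.ext fun k l => ?_
  simp only [star_trivial, hS.gam_apply, mul_comm (R _ k)]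

lemma LocalDesign.isHermitian_sig (hD : LocalDesign μ x K R h C)
    (hS : LocalSubstitution μ x f K h) : (Sig μ x K R f h).IsHermitian := by
  refine Matrix.IsHermitian.ext fun k l => ?_
  simp only [star_trivial, hS.sig_apply hD, mul_comm (designInfluence μ x K R h _ k)]

lemma LocalDesign.le_inner_sig_mv (hD : LocalDesign μ x K R h C)
    (hS : LocalSubstitution μ x f K h) (hc : ∀ l ∈ spectrum ℝ (h⁻¹ • Sig μ x K R f h), c ≤ l)
    (v : Vec d) : c * h * ‖v‖ ^ 2 ≤ inner ℝ v (mv (Sig μ x K R f h) v) := by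
  have h0 := hD.bandwidth_pos
  have hH : (h⁻¹ • Sig μ x K R f h).IsHermitian := by
    have := hD.isHermitian_sig (f := f) hS
    rw [Matrix.IsHermitian, Matrix.conjTranspose_smul, this, star_trivial]
  have h1 := le_inner_mv_of_le_spectrum hH hc v
  have h2 : mv (h⁻¹ • Sig μ x K R f h) v = h⁻¹ • mv (Sig μ x K R f h) v := by
    simp [mv, Matrix.smul_mulVec]
  rw [h2, real_inner_smul_right, inv_mul_eq_div, le_div_iff₀ h0] at h1
  linarith

lemma LocalDesign.integrable_designInfluence_apply (hD : LocalDesign μ x K R h C) (k : Fin d) :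
    Integrable (fun a => designInfluence μ x K R h a k) μ :=
  integrable_of_abs_le (hD.measurable_designInfluence_apply k)
    fun a => hD.abs_designInfluence_apply_le a k

lemma LocalDesign.integral_inner_designInfluence (hD : LocalDesign μ x K R h C) (v : Vec d) :
    ∫ a, inner ℝ (designInfluence μ x K R h a) v ∂μ = 0 := by
  simp only [PiLp.inner_apply, RCLike.inner_apply, conj_trivial]
  rw [integral_finsetSum _ fun k _ => (hD.integrable_designInfluence_apply k).const_mul _]
  simp only [integral_const_mul, hD.integral_designInfluence_apply, mul_zero, Finset.sum_const_zero]

lemma LocalDesign.integral_inner_designInfluence_sq (hD : LocalDesign μ x K R h C)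
    (hS : LocalSubstitution μ x f K h) (v : Vec d) :
    ∫ a, inner ℝ (designInfluence μ x K R h a) v ^ 2 ∂μ
      = inner ℝ v (mv (Sig μ x K R f h) v) := by
  have hint : ∀ k l : Fin d, Integrable (fun a => v k * v l *
      (designInfluence μ x K R h a k * designInfluence μ x K R h a l)) μ := fun k l => by
    refine (integrable_of_abs_le ((hD.measurable_designInfluence_apply k).mul
      (hD.measurable_designInfluence_apply l)) (b := C ^ 3 * C ^ 3) fun a => ?_).const_mul _
    have hC := hD.const_pos
    rw [Pi.mul_apply, abs_mul]
    exact mul_le_mul (hD.abs_designInfluence_apply_le a k) (hD.abs_designInfluence_apply_le a l)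
      (abs_nonneg _) (by positivity)
  have hsum : ∀ a, inner ℝ (designInfluence μ x K R h a) v ^ 2 = ∑ k, ∑ l, v k * v l *
      (designInfluence μ x K R h a k * designInfluence μ x K R h a l) := fun a => by
    simp only [PiLp.inner_apply, RCLike.inner_apply, conj_trivial, sq, Finset.sum_mul_sum]
    exact Finset.sum_congr rfl fun k _ => Finset.sum_congr rfl fun l _ => by ring
  simp only [hsum]
  rw [integral_finsetSum _ fun k _ => integrable_finsetSum _ fun l _ => hint k l]
  simp only [PiLp.inner_apply, RCLike.inner_apply, conj_trivial, mv_apply]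
  refine Finset.sum_congr rfl fun k _ => ?_
  rw [integral_finsetSum _ fun l _ => hint k l, Finset.sum_mul]
  refine Finset.sum_congr rfl fun l _ => ?_
  rw [integral_const_mul, ← hS.sig_apply hD]
  ring

/-- The matrix that standardizes the linear term at bandwidth `h`. -/
def standardizer (μ : Measure ℝ) (x : ℝ) (f K : ℝ → ℝ) (R : ℝ → Vec d) (h : ℝ) :
    Matrix (Fin d) (Fin d) ℝ :=
  whitening (Gam μ x K R f h) (Sig μ x K R f h)

omit [IsProbabilityMeasure μ] in
lemma standardized_eq (hG : (Gam μ x K R f h).PosDef) (θ t : Vec d) (n : ℕ) :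
    standardized μ x f K R Υ θ h n t = Real.sqrt n • mv (standardizer μ x f K R h)
      (mv (Gam μ x K R f h) (mv (Matrix.diagonal (Υ h))⁻¹ (t - θ))) := by
  have hdet : IsUnit (Gam μ x K R f h).det := (Matrix.isUnit_iff_isUnit_det _).1 hG.isUnit
  rw [standardized, ← mv_mul, ← mv_mul, standardizer, whitening,
    Matrix.nonsing_inv_mul_cancel_right _ _ hdet]

end Standardization

/-! ### Convergence in probability -/

section InProbability

variable {Ω : Type*} [MeasurableSpace Ω] {P : Measure Ω} {E : Type*} [NormedAddCommGroup E]

lemma IsBigOP.tendstoInMeasure_zero {V : ℕ → Ω → E} {Z : ℕ → Ω → ℝ} {z : ℕ → ℝ}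
    (hZ : IsBigOP P Z z) (hz : Tendsto z atTop (𝓝 0)) {B : ℕ → Set Ω}
    (hB : Tendsto (fun n => P (B n)) atTop (𝓝 0))
    (hV : ∀ᶠ n in atTop, ∀ᵐ ω ∂P, ω ∉ B n → ‖V n ω‖ ≤ Z n ω) :
    TendstoInMeasure P V atTop fun _ => 0 := by
  rw [tendstoInMeasure_iff_norm]
  intro ε hε
  have hlim := (hZ.tendsto_measure_zero hz hε).add hB
  rw [add_zero] at hlim
  refine tendsto_of_tendsto_of_tendsto_of_le_of_le' tendsto_const_nhds hlim
    (Eventually.of_forall fun n => zero_le) ?_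
  filter_upwards [hV] with n hn
  refine (measure_mono_ae ?_).trans (measure_union_le _ _)
  filter_upwards [hn] with ω hω h1
  by_cases hb : ω ∈ B n
  · exact Or.inr hb
  · left
    have h2 : ε ≤ ‖V n ω - 0‖ := h1
    rw [sub_zero] at h2
    exact h2.trans ((hω hb).trans (le_abs_self _))

lemma tendstoInMeasure_sub_zero {U V W : ℕ → Ω → E}
    (hU : TendstoInMeasure P (fun n ω => U n ω - W n ω) atTop fun _ => 0)
    (hV : TendstoInMeasure P (fun n ω => V n ω - W n ω) atTop fun _ => 0) :
    TendstoInMeasure P (fun n ω => U n ω - V n ω) atTop fun _ => 0 := by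
  rw [tendstoInMeasure_iff_norm] at hU hV ⊢
  intro ε hε
  have hlim := (hU (ε / 2) (by positivity)).add (hV (ε / 2) (by positivity))
  rw [add_zero] at hlim
  refine tendsto_of_tendsto_of_tendsto_of_le_of_le tendsto_const_nhds hlim
    (fun n => zero_le) fun n => ?_
  refine (measure_mono fun ω hω => ?_).trans (measure_union_le _ _)
  simp only [sub_zero, Set.mem_ofPred_eq, Set.mem_union] at hω ⊢
  by_contra! hc
  have : U n ω - V n ω = (U n ω - W n ω) - (V n ω - W n ω) := by abel
  rw [this] at hω
  linarith [norm_sub_le (U n ω - W n ω) (V n ω - W n ω), hc.1, hc.2]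

end InProbability

/-! ### The estimators and the linear term -/

section Linearization

variable {d : ℕ} {μ : Measure ℝ} [IsProbabilityMeasure μ] {x : ℝ} {f K : ℝ → ℝ}
  {R : ℝ → Vec d} {Υ : ℝ → Fin d → ℝ} {h C c : ℝ}

/-- What the distribution theory uses at bandwidth `h`: moment bounds, the substitution, the
scaling of the basis, and eigenvalues of `Γ_h` and `h⁻¹ Σ_h` bounded below by `c`. -/
structure RegularBandwidth (μ : Measure ℝ) (x : ℝ) (f K : ℝ → ℝ) (R : ℝ → Vec d)
    (Υ : ℝ → Fin d → ℝ) (C c h : ℝ) : Prop where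
  design : LocalDesign μ x K R h C
  substitution : LocalSubstitution μ x f K h
  locallyBounded : ∀ u₀, ∃ C : ℝ, ∀ᶠ u in 𝓝 u₀, ‖R u‖ ≤ C
  scaling_pos : ∀ k, 0 < Υ h k
  scaling : ∀ u, mv (Matrix.diagonal (Υ h)) (R u) = R (u / h)
  lower_pos : 0 < c
  gam_spectrum : ∀ l ∈ spectrum ℝ (Gam μ x K R f h), c ≤ l
  sig_spectrum : ∀ l ∈ spectrum ℝ (h⁻¹ • Sig μ x K R f h), c ≤ l

/-- The part of the score that is negligible against its linear term. -/
def scoreRemainder (μ : Measure ℝ) (x : ℝ) (f K : ℝ → ℝ) (R : ℝ → Vec d) (Υ : ℝ → Fin d → ℝ)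
    (θ : Vec d) (h : ℝ) (n : ℕ) (xs : ℕ → ℝ) : Vec d :=
  quadraticTerm μ x f K R Υ h n xs + leaveInBias μ x K R Υ h n xs
    + approxBias μ x K R Υ θ h n xs - (1 / (n : ℝ)) • linearTerm μ x K R h n xs

/-- The standardized linear term. -/
def standardizedLinear (μ : Measure ℝ) (x : ℝ) (f K : ℝ → ℝ) (R : ℝ → Vec d) (h : ℝ) (n : ℕ)
    (xs : ℕ → ℝ) : Vec d :=
  Real.sqrt n • mv (standardizer μ x f K R h) (linearTerm μ x K R h n xs)

namespace RegularBandwidth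

omit [IsProbabilityMeasure μ] in
lemma le_inner_gam_mv (hB : RegularBandwidth μ x f K R Υ C c h) (v : Vec d) :
    c * ‖v‖ ^ 2 ≤ inner ℝ v (mv (Gam μ x K R f h) v) :=
  le_inner_mv_of_le_spectrum hB.substitution.isHermitian_gam hB.gam_spectrum v

omit [IsProbabilityMeasure μ] in
lemma posDef_gam (hB : RegularBandwidth μ x f K R Υ C c h) : (Gam μ x K R f h).PosDef :=
  posDef_of_le_inner_mv hB.substitution.isHermitian_gam hB.lower_pos hB.le_inner_gam_mv

lemma le_inner_sig_mv (hB : RegularBandwidth μ x f K R Υ C c h) (v : Vec d) :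
    c * h * ‖v‖ ^ 2 ≤ inner ℝ v (mv (Sig μ x K R f h) v) :=
  hB.design.le_inner_sig_mv hB.substitution hB.sig_spectrum v

omit [IsProbabilityMeasure μ] in
lemma mul_bandwidth_pos (hB : RegularBandwidth μ x f K R Υ C c h) : 0 < c * h :=
  mul_pos hB.lower_pos hB.design.bandwidth_pos

lemma posDef_sig (hB : RegularBandwidth μ x f K R Υ C c h) : (Sig μ x K R f h).PosDef :=
  posDef_of_le_inner_mv (hB.design.isHermitian_sig hB.substitution) hB.mul_bandwidth_pos
    hB.le_inner_sig_mv

lemma standardizer_cov (hB : RegularBandwidth μ x f K R Υ C c h) :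
    standardizer μ x f K R h * Sig μ x K R f h * (standardizer μ x f K R h)ᵀ = 1 :=
  whitening_mul_mul_transpose hB.posDef_gam hB.posDef_sig

lemma norm_standardizer_mv_le (hB : RegularBandwidth μ x f K R Υ C c h) (v : Vec d) :
    ‖mv (standardizer μ x f K R h) v‖ ≤ (Real.sqrt (c * h))⁻¹ * ‖v‖ :=
  norm_mv_le_of_whitening hB.standardizer_cov hB.mul_bandwidth_pos hB.le_inner_sig_mv v

lemma norm_sqrt_smul_standardizer_mv_le (hB : RegularBandwidth μ x f K R Υ C c h) (n : ℕ)
    (v : Vec d) :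
    ‖Real.sqrt n • mv (standardizer μ x f K R h) v‖ ≤ Real.sqrt (n / (c * h)) * ‖v‖ := by
  rw [norm_smul, Real.norm_of_nonneg (Real.sqrt_nonneg _), Real.sqrt_div (Nat.cast_nonneg n),
    div_eq_mul_inv, mul_assoc]
  gcongr
  exact hB.norm_standardizer_mv_le v

omit [IsProbabilityMeasure μ] in
lemma norm_le_of_gam_mv (hB : RegularBandwidth μ x f K R Υ C c h) (v : Vec d) :
    c * ‖v‖ ≤ ‖mv (Gam μ x K R f h) v‖ := by
  rcases eq_or_lt_of_le (norm_nonneg v) with h0 | h0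
  · rw [← h0, mul_zero]; exact norm_nonneg _
  refine le_of_mul_le_mul_right ?_ h0
  calc c * ‖v‖ * ‖v‖ = c * ‖v‖ ^ 2 := by ring
    _ ≤ inner ℝ v (mv (Gam μ x K R f h) v) := hB.le_inner_gam_mv v
    _ ≤ ‖v‖ * ‖mv (Gam μ x K R f h) v‖ := real_inner_le_norm _ _
    _ = ‖mv (Gam μ x K R f h) v‖ * ‖v‖ := mul_comm _ _

/-- The local regression estimator differs from its linear term by the score remainder and the
estimation error of the Gram matrix, both magnified by at most `√(n / (c h))`. -/
lemma norm_standardized_sub_le (hB : RegularBandwidth μ x f K R Υ C c h) (θ : Vec d) {n : ℕ}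
    (hn : 0 < n) {xs : ℕ → ℝ} {t : Vec d}
    (ht : IsMinOn (localRegressionCriterion x K R h n xs) Set.univ t)
    (hΔ : matrixNorm (GamHat x K R Υ h n xs - Gam μ x K R f h) ≤ c / 2) :
    ‖standardized μ x f K R Υ θ h n t - standardizedLinear μ x f K R h n xs‖
      ≤ (1 + 2 / c) * (Real.sqrt (n / (c * h)) * (‖scoreRemainder μ x f K R Υ θ h n xs‖
        + matrixNorm (GamHat x K R Υ h n xs - Gam μ x K R f h)
          * (‖linearTerm μ x K R h n xs‖ + ‖scoreRemainder μ x f K R Υ θ h n xs‖))) := by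
  have hc := hB.lower_pos
  set Δ := matrixNorm (GamHat x K R Υ h n xs - Gam μ x K R f h) with hΔdef
  set D := mv (Matrix.diagonal (Υ h))⁻¹ (t - θ) with hD
  set Lin := linearTerm μ x K R h n xs with hL
  set E := scoreRemainder μ x f K R Υ θ h n xs with hE
  have hΔ0 : 0 ≤ Δ := Real.sqrt_nonneg _
  have hscore : mv (GamHat x K R Υ h n xs) D = Lin + E := by
    rw [hD, gamHat_mv_eq_sampleScore hB.scaling_pos hB.scaling θ ht,
      sampleScore_eq hB.substitution hB.design.bandwidth_pos hB.scaling θ hn, hE, scoreRemainder]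
  have hG : mv (Gam μ x K R f h) D
      = Lin + E - mv (GamHat x K R Υ h n xs - Gam μ x K R f h) D := by
    rw [sub_mv, hscore]; abel
  have hnormD : ‖D‖ ≤ 2 / c * (‖Lin‖ + ‖E‖) := by
    have h1 := hB.norm_le_of_gam_mv D
    have h2 : ‖mv (Gam μ x K R f h) D‖ ≤ (‖Lin‖ + ‖E‖) + Δ * ‖D‖ := by
      rw [hG]
      refine (norm_sub_le _ _).trans (add_le_add (norm_add_le _ _) (norm_mv_le _ _))
    have h3 : Δ * ‖D‖ ≤ c / 2 * ‖D‖ := by gcongr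
    rw [div_mul_eq_mul_div, le_div_iff₀ hc]
    linarith
  have hdiff : standardized μ x f K R Υ θ h n t - standardizedLinear μ x f K R h n xs
      = Real.sqrt n • mv (standardizer μ x f K R h)
        (E - mv (GamHat x K R Υ h n xs - Gam μ x K R f h) D) := by
    rw [standardized_eq hB.posDef_gam, standardizedLinear, ← smul_sub, ← mv_sub, ← hD, hG]
    congr 2
    abel
  rw [hdiff]
  refine (hB.norm_sqrt_smul_standardizer_mv_le n _).trans ?_
  rw [mul_left_comm]
  refine mul_le_mul_of_nonneg_left ?_ (Real.sqrt_nonneg _)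
  calc ‖E - mv (GamHat x K R Υ h n xs - Gam μ x K R f h) D‖
      ≤ ‖E‖ + Δ * (2 / c * (‖Lin‖ + ‖E‖)) := by
        refine (norm_sub_le _ _).trans (add_le_add le_rfl ((norm_mv_le _ _).trans ?_))
        gcongr
    _ ≤ (1 + 2 / c) * (‖E‖ + Δ * (‖Lin‖ + ‖E‖)) := by
        have h1 : 0 ≤ 2 / c * ‖E‖ := by positivity
        have h2 : 0 ≤ Δ * (‖Lin‖ + ‖E‖) := by positivity
        linarith

lemma norm_standardized_sub_le_of_localL2 (hB : RegularBandwidth μ x f K R Υ C c h) (θ : Vec d)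
    {n : ℕ} (hn : 0 < n) {xs : ℕ → ℝ} {t : Vec d}
    (ht : IsMinOn (localL2Criterion μ μ x K R h n xs) Set.univ t) :
    ‖standardized μ x f K R Υ θ h n t - standardizedLinear μ x f K R h n xs‖
      ≤ C ^ 3 * (Real.sqrt (n / (c * h)) * approxError μ x R θ h) := by
  have hG := hB.design.gam_mv_eq_linearTerm_add hB.substitution hB.locallyBounded hB.scaling_pos
    hB.scaling θ hn ht
  rw [standardized_eq hB.posDef_gam, standardizedLinear, ← smul_sub, ← mv_sub, hG,
    add_sub_cancel_left]
  refine (hB.norm_sqrt_smul_standardizer_mv_le n _).trans ?_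
  rw [mul_left_comm]
  refine mul_le_mul_of_nonneg_left ?_ (Real.sqrt_nonneg _)
  rw [mul_comm]
  exact hB.design.norm_designBias_le hB.locallyBounded θ

end RegularBandwidth

end Linearization

/-! ### Rates -/

section Rates

lemma tendsto_mul_bandwidth {h : ℕ → ℝ} (hpos : ∀ n, 0 < h n) (h0 : Tendsto h atTop (𝓝 0))
    (hrate : Tendsto (fun n : ℕ => (n : ℝ) * h n ^ 2) atTop atTop) :
    Tendsto (fun n : ℕ => (n : ℝ) * h n) atTop atTop := by
  refine tendsto_atTop_mono' _ ?_ hrate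
  filter_upwards [h0.eventually (ge_mem_nhds one_pos)] with n hn
  have := hpos n
  gcongr
  nlinarith

lemma tendsto_sqrt_one_div {a : ℕ → ℝ} (ha : Tendsto a atTop atTop) (c : ℝ) :
    Tendsto (fun n => Real.sqrt (c * (1 / a n))) atTop (𝓝 0) := by
  have h1 : Tendsto (fun n => c * (1 / a n)) atTop (𝓝 0) := by
    simpa using (tendsto_inv_atTop_zero.comp ha).const_mul c
  have h2 := (Real.continuous_sqrt.tendsto 0).comp h1
  rwa [Real.sqrt_zero] at h2

/-- The rate of the score remainder: that of the degenerate U-statistic plus those of the two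
biases. -/
def remainderRate (h ϱ : ℕ → ℝ) (n : ℕ) : ℝ :=
  Real.sqrt (1 / ((n : ℝ) ^ 2 * h n)) + 1 / (n : ℝ) + ϱ n

variable {h ϱ : ℕ → ℝ} {c : ℝ}

lemma tendsto_sqrt_mul_approxError (hpos : ∀ n, 0 < h n) (hϱ : ∀ n, 0 ≤ ϱ n) (hc : 0 < c)
    (hbias : Tendsto (fun n : ℕ => (n : ℝ) * ϱ n ^ 2 / h n) atTop (𝓝 0)) :
    Tendsto (fun n : ℕ => Real.sqrt (n / (c * h n)) * ϱ n) atTop (𝓝 0) := by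
  have h1 : Tendsto (fun n : ℕ => Real.sqrt (c⁻¹ * ((n : ℝ) * ϱ n ^ 2 / h n))) atTop (𝓝 0) := by
    have := hbias.const_mul c⁻¹
    rw [mul_zero] at this
    have h2 := (Real.continuous_sqrt.tendsto 0).comp this
    rwa [Real.sqrt_zero] at h2
  refine h1.congr fun n => ?_
  have := hpos n
  rw [← Real.sqrt_sq (hϱ n), ← Real.sqrt_mul (by positivity), Real.sqrt_sq (hϱ n)]
  congr 1
  field_simp

lemma tendsto_sqrt_mul_remainderRate (hpos : ∀ n, 0 < h n) (hϱ : ∀ n, 0 ≤ ϱ n) (hc : 0 < c)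
    (h0 : Tendsto h atTop (𝓝 0))
    (hrate : Tendsto (fun n : ℕ => (n : ℝ) * h n ^ 2) atTop atTop)
    (hbias : Tendsto (fun n : ℕ => (n : ℝ) * ϱ n ^ 2 / h n) atTop (𝓝 0)) :
    Tendsto (fun n : ℕ => Real.sqrt (n / (c * h n)) * remainderRate h ϱ n) atTop (𝓝 0) := by
  have h1 := tendsto_sqrt_one_div hrate c⁻¹
  have h2 := tendsto_sqrt_one_div (tendsto_mul_bandwidth hpos h0 hrate) c⁻¹
  have h3 := tendsto_sqrt_mul_approxError hpos hϱ hc hbias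
  have hsum := (h1.add h2).add h3
  simp only [add_zero] at hsum
  refine hsum.congr' ?_
  filter_upwards [eventually_gt_atTop 0] with n hn
  have hn0 : (0 : ℝ) < n := by exact_mod_cast hn
  have := hpos n
  have e2 : (1 / (n : ℝ)) = Real.sqrt ((1 / (n : ℝ)) ^ 2) := (Real.sqrt_sq (by positivity)).symm
  rw [remainderRate, mul_add, mul_add, ← Real.sqrt_mul (by positivity)]
  conv_rhs => rw [e2]
  rw [← Real.sqrt_mul (by positivity)]
  congr 3 <;> field_simp

lemma tendsto_error_rate (hpos : ∀ n, 0 < h n) (hϱ : ∀ n, 0 ≤ ϱ n) (hc : 0 < c)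
    (h0 : Tendsto h atTop (𝓝 0))
    (hrate : Tendsto (fun n : ℕ => (n : ℝ) * h n ^ 2) atTop atTop)
    (hbias : Tendsto (fun n : ℕ => (n : ℝ) * ϱ n ^ 2 / h n) atTop (𝓝 0)) :
    Tendsto (fun n : ℕ => Real.sqrt (n / (c * h n)) * (remainderRate h ϱ n
      + Real.sqrt (1 / ((n : ℝ) * h n)) * (Real.sqrt (1 / (n : ℝ)) + remainderRate h ϱ n)))
      atTop (𝓝 0) := by
  have h1 := tendsto_sqrt_mul_remainderRate hpos hϱ hc h0 hrate hbias
  have h2 := tendsto_sqrt_one_div (tendsto_mul_bandwidth hpos h0 hrate) 1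
  have h3 := tendsto_sqrt_one_div hrate c⁻¹
  have hsum := (h1.add h3).add (h2.mul h1)
  simp only [add_zero, mul_zero, one_mul] at hsum
  refine hsum.congr' ?_
  filter_upwards [eventually_gt_atTop 0] with n hn
  have hn0 : (0 : ℝ) < n := by exact_mod_cast hn
  have := hpos n
  have e : Real.sqrt (c⁻¹ * (1 / ((n : ℝ) * h n ^ 2)))
      = Real.sqrt (n / (c * h n)) * (Real.sqrt (1 / ((n : ℝ) * h n))
        * Real.sqrt (1 / (n : ℝ))) := by
    rw [← Real.sqrt_mul (by positivity), ← Real.sqrt_mul (by positivity)]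
    congr 1
    field_simp
  rw [e]
  ring

end Rates

/-! ### Asymptotics along the bandwidth sequence -/

section Asymptotics

variable {Ω : Type*} [MeasurableSpace Ω] {P : Measure Ω} [IsProbabilityMeasure P]
  {d : ℕ} {μ : Measure ℝ} [IsProbabilityMeasure μ] {X : ℕ → Ω → ℝ} {x : ℝ} {f K : ℝ → ℝ}
  {R : ℝ → Vec d} {Υ : ℝ → Fin d → ℝ} {θ : Vec d} {C c : ℝ} {h : ℕ → ℝ}

lemma PointwiseAssumption.exists_regularBandwidth (hA : PointwiseAssumption μ x f K R Υ)
    (hpos : ∀ n, 0 < h n) (h0 : Tendsto h atTop (𝓝 0)) :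
    ∃ C c : ℝ, ∀ᶠ n in atTop, RegularBandwidth μ x f K R Υ C c (h n) := by
  obtain ⟨C, δ, -, hδ, hD⟩ := hA.exists_localDesign
  obtain ⟨c, hc, hspec⟩ := hA.eigenvalues
  have hlim : Tendsto h atTop (𝓝[>] 0) :=
    tendsto_nhdsWithin_iff.2 ⟨h0, Eventually.of_forall hpos⟩
  refine ⟨C, c, ?_⟩
  filter_upwards [hlim.eventually hspec, h0.eventually (gt_mem_nhds hδ)] with n hn hn2
  exact ⟨(hD _ (hpos n) hn2).1, (hD _ (hpos n) hn2).2, hA.basis_locallyBounded,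
    hA.scaling_pos _ (hpos n), hA.scaling _ (hpos n), hc, hn.1, hn.2⟩

lemma isBigOP_gamHat (hX : ∀ i, Measurable (X i)) (hind : iIndepFun X P)
    (hlaw : ∀ i, P.map (X i) = μ)
    (hB : ∀ᶠ n in atTop, RegularBandwidth μ x f K R Υ C c (h n)) :
    IsBigOP P (fun n ω => matrixNorm (GamHat x K R Υ (h n) n (fun i => X i ω)
      - Gam μ x K R f (h n))) (fun n => Real.sqrt (1 / ((n : ℝ) * h n))) := by
  refine isBigOP_of_integral_sq_le (d ^ 2 * C ^ 7) ?_ ?_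
  · filter_upwards [hB, eventually_gt_atTop 0] with n hn h0
    have := hn.design.bandwidth_pos
    positivity
  · filter_upwards [hB, eventually_gt_atTop 0] with n hn h0
    have := hn.design.bandwidth_pos
    rw [Real.sq_sqrt (by positivity)]
    exact hn.design.integral_matrixNorm_sq_le hn.substitution hn.scaling hX hind hlaw h0

lemma isBigOP_averageWeight (hX : ∀ i, Measurable (X i)) (hlaw : ∀ i, P.map (X i) = μ)
    (hB : ∀ᶠ n in atTop, RegularBandwidth μ x f K R Υ C c (h n)) :
    IsBigOP P (fun n ω => averageWeight x K R (h n) n (fun i => X i ω)) (fun _ => 1) := by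
  refine isBigOP_of_integral_le (C ^ 3) (fun n ω => averageWeight_nonneg _ _)
    (Eventually.of_forall fun _ => one_pos) ?_
  filter_upwards [hB, eventually_gt_atTop 0] with n hn h0
  rw [mul_one]
  exact hn.design.integral_averageWeight_le hX hlaw h0

lemma isBigOP_leaveInBias (hX : ∀ i, Measurable (X i)) (hlaw : ∀ i, P.map (X i) = μ)
    (hB : ∀ᶠ n in atTop, RegularBandwidth μ x f K R Υ C c (h n)) :
    IsBigOP P (fun n ω => ‖leaveInBias μ x K R Υ (h n) n (fun i => X i ω)‖)
      (fun n => 1 / (n : ℝ)) := by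
  have h1 := (isBigOP_const P (a := fun n : ℕ => 1 / (n : ℝ)) fun n => by positivity).mul
    (isBigOP_averageWeight hX hlaw hB) fun n => by positivity
  simp only [mul_one] at h1
  refine h1.mono ?_
  filter_upwards [hB] with n hn
  refine ae_of_all _ fun ω => ?_
  rw [abs_norm]
  exact (norm_leaveInBias_le hn.scaling _ _).trans (le_abs_self _)

lemma isBigOP_approxBias (hX : ∀ i, Measurable (X i)) (hlaw : ∀ i, P.map (X i) = μ)
    (hB : ∀ᶠ n in atTop, RegularBandwidth μ x f K R Υ C c (h n)) :
    IsBigOP P (fun n ω => ‖approxBias μ x K R Υ θ (h n) n (fun i => X i ω)‖)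
      (fun n => approxError μ x R θ (h n)) := by
  have h1 := (isBigOP_const P (a := fun n => approxError μ x R θ (h n))
    fun n => approxError_nonneg _ _).mul (isBigOP_averageWeight hX hlaw hB)
    fun n => approxError_nonneg _ _
  simp only [mul_one] at h1
  refine h1.mono ?_
  filter_upwards [hB] with n hn
  filter_upwards [ae_mem_support hX hlaw] with ω hω
  rw [abs_norm]
  exact (hn.design.norm_approxBias_le hn.scaling hn.locallyBounded θ n hω).trans (le_abs_self _)

lemma isBigOP_quadraticTerm (hX : ∀ i, Measurable (X i)) (hind : iIndepFun X P)
    (hlaw : ∀ i, P.map (X i) = μ)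
    (hB : ∀ᶠ n in atTop, RegularBandwidth μ x f K R Υ C c (h n)) :
    IsBigOP P (fun n ω => ‖quadraticTerm μ x f K R Υ (h n) n (fun i => X i ω)‖)
      (fun n => Real.sqrt (1 / ((n : ℝ) ^ 2 * h n))) := by
  refine isBigOP_of_integral_sq_le (2 * d * C ^ 5) ?_ ?_
  · filter_upwards [hB, eventually_gt_atTop 0] with n hn h0
    have := hn.design.bandwidth_pos
    positivity
  · filter_upwards [hB, eventually_gt_atTop 0] with n hn h0
    have := hn.design.bandwidth_pos
    rw [Real.sq_sqrt (by positivity)]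
    exact hn.design.integral_norm_sq_quadraticTerm_le hn.substitution hn.scaling hX hind hlaw h0

lemma isBigOP_linearTerm (hX : ∀ i, Measurable (X i)) (hind : iIndepFun X P)
    (hlaw : ∀ i, P.map (X i) = μ)
    (hB : ∀ᶠ n in atTop, RegularBandwidth μ x f K R Υ C c (h n)) :
    IsBigOP P (fun n ω => ‖linearTerm μ x K R (h n) n (fun i => X i ω)‖)
      (fun n => Real.sqrt (1 / (n : ℝ))) := by
  refine isBigOP_of_integral_sq_le (d * C ^ 6) ?_ ?_
  · filter_upwards [eventually_gt_atTop 0] with n h0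
    positivity
  · filter_upwards [hB, eventually_gt_atTop 0] with n hn h0
    rw [Real.sq_sqrt (by positivity)]
    exact hn.design.integral_norm_sq_linearTerm_le hX hind hlaw h0

lemma remainderRate_nonneg {ϱ : ℕ → ℝ} (hϱ : ∀ n, 0 ≤ ϱ n) (n : ℕ) :
    0 ≤ remainderRate h ϱ n :=
  add_nonneg (add_nonneg (Real.sqrt_nonneg _) (by positivity)) (hϱ n)

lemma isBigOP_scoreRemainder (hX : ∀ i, Measurable (X i)) (hind : iIndepFun X P)
    (hlaw : ∀ i, P.map (X i) = μ)
    (hB : ∀ᶠ n in atTop, RegularBandwidth μ x f K R Υ C c (h n)) :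
    IsBigOP P (fun n ω => ‖scoreRemainder μ x f K R Υ θ (h n) n (fun i => X i ω)‖)
      (remainderRate h fun n => approxError μ x R θ (h n)) := by
  have hs : ∀ n : ℕ, 0 ≤ Real.sqrt (1 / ((n : ℝ) ^ 2 * h n)) := fun n => Real.sqrt_nonneg _
  have hi : ∀ n : ℕ, 0 ≤ 1 / (n : ℝ) := fun n => by positivity
  have hϱ : ∀ n, 0 ≤ approxError μ x R θ (h n) := fun n => approxError_nonneg _ _
  have hquad := (isBigOP_quadraticTerm hX hind hlaw hB).mono_rate one_pos
    (b := remainderRate h fun n => approxError μ x R θ (h n))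
    (Eventually.of_forall fun n => by
      rw [remainderRate]; linarith [hi n, hϱ n])
  have hleave := (isBigOP_leaveInBias hX hlaw hB).mono_rate one_pos
    (b := remainderRate h fun n => approxError μ x R θ (h n))
    (Eventually.of_forall fun n => by
      rw [remainderRate]; linarith [hs n, hϱ n])
  have happrox := (isBigOP_approxBias (θ := θ) hX hlaw hB).mono_rate one_pos
    (b := remainderRate h fun n => approxError μ x R θ (h n))
    (Eventually.of_forall fun n => by
      rw [remainderRate]; linarith [hs n, hi n])
  have hlin := ((isBigOP_const P hi).mul (isBigOP_linearTerm hX hind hlaw hB) hi).mono_rate one_pos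
    (b := remainderRate h fun n => approxError μ x R θ (h n)) (by
      filter_upwards [eventually_ge_atTop 1] with n hn
      have hn1 : (1 : ℝ) ≤ n := by exact_mod_cast hn
      have h1 : Real.sqrt (1 / (n : ℝ)) ≤ 1 := by
        rw [Real.sqrt_le_iff, one_pow, div_le_one (by positivity)]
        exact ⟨zero_le_one, hn1⟩
      have h2 := mul_le_mul_of_nonneg_left h1 (hi n)
      rw [remainderRate]
      linarith [hs n, hϱ n])
  refine (((hquad.add hleave).add happrox).add hlin).mono
    (Eventually.of_forall fun n => ae_of_all _ fun ω => ?_)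
  rw [abs_norm]
  refine le_trans ?_ (le_abs_self _)
  refine (norm_sub_le _ _).trans (add_le_add ((norm_add_le _ _).trans
    (add_le_add (norm_add_le _ _) le_rfl)) ?_)
  rw [norm_smul, Real.norm_of_nonneg (hi n)]

/-- The standardized linear term is asymptotically standard normal: its covariance is the identity
and its summands are of order `1/√(n h)`. -/
lemma tendstoInDistribution_standardizedLinear (hX : ∀ i, Measurable (X i)) (hind : iIndepFun X P)
    (hlaw : ∀ i, P.map (X i) = μ) (hK : Measurable K) (hR : Measurable R)
    (hB : ∀ᶠ n in atTop, RegularBandwidth μ x f K R Υ C c (h n))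
    (hrate : Tendsto (fun n : ℕ => (n : ℝ) * h n) atTop atTop) :
    TendstoInDistribution
      (fun n ω => standardizedLinear μ x f K R (h n) n (fun i => X i ω))
      atTop id (fun _ => P) (stdGaussian (Vec d)) := by
  let ζ : ℕ → ℝ → Vec d := fun n a =>
    mv (standardizer μ x f K R (h n)) (designInfluence μ x K R (h n) a)
  have hinner : ∀ n a (t : Vec d), inner ℝ (ζ n a) t
      = inner ℝ (designInfluence μ x K R (h n) a) (mv (standardizer μ x f K R (h n))ᵀ t) :=
    fun n a t => inner_mv_transpose _ _ _
  have hlim : Tendsto (fun n : ℕ => (Real.sqrt n)⁻¹ * ((Real.sqrt (c * h n))⁻¹ * C ^ 3))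
      atTop (𝓝 0) := by
    have h1 := (tendsto_sqrt_one_div hrate c⁻¹).mul_const (C ^ 3)
    rw [zero_mul] at h1
    refine h1.congr fun n => ?_
    rw [← mul_assoc, ← Real.sqrt_inv, ← Real.sqrt_inv, ← Real.sqrt_mul (by positivity)]
    congr 2
    rw [mul_inv, one_div, mul_inv]
    ring
  have key := tendstoInDistribution_stdGaussian_of_rows hX hind hlaw (ζ := ζ)
    (b := fun n => (Real.sqrt (c * h n))⁻¹ * C ^ 3)
    (fun n => (continuous_mv _).measurable.comp (measurable_designInfluence hK hR (h n) x))
    (hB.mono fun n hn t => by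
      simp only [hinner]
      exact hn.design.integral_inner_designInfluence _)
    (hB.mono fun n hn t => by
      simp only [hinner]
      rw [hn.design.integral_inner_designInfluence_sq hn.substitution, inner_mv_transpose,
        Matrix.transpose_transpose, ← mv_mul, ← mv_mul, hn.standardizer_cov, mv_one,
        real_inner_self_eq_norm_sq])
    (hB.mono fun n hn a => (hn.norm_standardizer_mv_le _).trans
      (mul_le_mul_of_nonneg_left (hn.design.norm_designInfluence_le a) (by positivity)))
    hlim
  have heq : ∀ (n : ℕ) ω, (Real.sqrt n)⁻¹ • ∑ i ∈ Finset.range n, ζ n (X i ω)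
      = standardizedLinear μ x f K R (h n) n (fun i => X i ω) := fun n ω => by
    rw [standardizedLinear, linearTerm, mv_smul, mv_sum, smul_smul]
    congr 1
    rw [mul_one_div, ← Real.sqrt_div_self]
  simpa only [heq] using key

omit [IsProbabilityMeasure μ] in
lemma continuous_standardized (h : ℝ) (n : ℕ) :
    Continuous (standardized μ x f K R Υ θ h n) := by
  unfold standardized
  have hconst : Continuous fun _ : Vec d => Real.sqrt n := continuous_const
  exact hconst.smul ((continuous_mv _).comp (continuous_sub_right θ))

end Asymptotics

end LocalDistribution

end

open LocalDistribution in
theorem mainTheorem1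
    {Ω : Type*} [MeasurableSpace Ω] (P : Measure Ω) [IsProbabilityMeasure P]
    (μ : Measure ℝ) [IsProbabilityMeasure μ]
    -- the observations: a random sample from `μ`
    (X : ℕ → Ω → ℝ) (hX_meas : ∀ i, Measurable (X i)) (hX_indep : iIndepFun X P)
    (hX_law : ∀ i, P.map (X i) = μ)
    -- evaluation point, density, kernel, basis, scaling, approximating parameter
    {d : ℕ} (x : ℝ) (f K : ℝ → ℝ) (R : ℝ → LocalDistribution.Vec d) (Υ : ℝ → Fin d → ℝ)
    (θ : LocalDistribution.Vec d)
    (hA : LocalDistribution.PointwiseAssumption μ x f K R Υ)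
    -- bandwidths
    (h : ℕ → ℝ) (hh_pos : ∀ n, 0 < h n) (hh_zero : Tendsto h atTop (𝓝 0))
    (hh_rate : Tendsto (fun n : ℕ => (n : ℝ) * h n ^ 2) atTop atTop)
    (hh_bias : Tendsto
      (fun n : ℕ => (n : ℝ) * LocalDistribution.approxError μ x R θ (h n) ^ 2 / h n) atTop (𝓝 0))
    -- the local regression estimator and the infeasible local `L²` estimator with design `F`
    (θhat θhatF : ℕ → Ω → LocalDistribution.Vec d)
    (hθhat_meas : ∀ n, AEMeasurable (θhat n) P) (hθhatF_meas : ∀ n, AEMeasurable (θhatF n) P)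
    (hθhat : ∀ n, ∀ᵐ ω ∂P, IsMinOn
      (LocalDistribution.localRegressionCriterion x K R (h n) n (fun i => X i ω))
      Set.univ (θhat n ω))
    (hθhatF : ∀ n, ∀ᵐ ω ∂P, IsMinOn
      (LocalDistribution.localL2Criterion μ μ x K R (h n) n (fun i => X i ω))
      Set.univ (θhatF n ω)) :
    -- (i) the sample Gram matrix
    LocalDistribution.IsBigOP P
      (fun n ω => LocalDistribution.matrixNorm
        (LocalDistribution.GamHat x K R Υ (h n) n (fun i => X i ω)
          - LocalDistribution.Gam μ x K R f (h n)))
      (fun n => Real.sqrt (1 / ((n : ℝ) * h n))) ∧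
    -- (ii) leave-in bias and approximation bias
    LocalDistribution.IsBigOP P
      (fun n ω => ‖LocalDistribution.leaveInBias μ x K R Υ (h n) n (fun i => X i ω)‖)
      (fun n => 1 / (n : ℝ)) ∧
    LocalDistribution.IsBigOP P
      (fun n ω => ‖LocalDistribution.approxBias μ x K R Υ θ (h n) n (fun i => X i ω)‖)
      (fun n => LocalDistribution.approxError μ x R θ (h n)) ∧
    -- (iii) the quadratic remainder
    LocalDistribution.IsBigOP P
      (fun n ω => ‖LocalDistribution.quadraticTerm μ x f K R Υ (h n) n (fun i => X i ω)‖)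
      (fun n => Real.sqrt (1 / ((n : ℝ) ^ 2 * h n))) ∧
    -- (iv) asymptotic equivalence and asymptotic normality
    TendstoInMeasure P
      (fun n ω => LocalDistribution.standardized μ x f K R Υ θ (h n) n (θhat n ω)
        - LocalDistribution.standardized μ x f K R Υ θ (h n) n (θhatF n ω))
      atTop (fun _ => 0) ∧
    TendstoInDistribution
      (fun n ω => LocalDistribution.standardized μ x f K R Υ θ (h n) n (θhat n ω))
      atTop id (fun _ => P) (stdGaussian (LocalDistribution.Vec d)) := by
  obtain ⟨C, c, hB⟩ := hA.exists_regularBandwidth hh_pos hh_zero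
  obtain ⟨n₀, hn₀⟩ := hB.exists
  have hc := hn₀.lower_pos
  have hϱ : ∀ n, 0 ≤ approxError μ x R θ (h n) := fun n => approxError_nonneg _ _
  have hgam := isBigOP_gamHat hX_meas hX_indep hX_law hB
  have hlin := isBigOP_linearTerm hX_meas hX_indep hX_law hB
  have hrem := isBigOP_scoreRemainder (θ := θ) hX_meas hX_indep hX_law hB
  have hnh := tendsto_mul_bandwidth hh_pos hh_zero hh_rate
  have hs : ∀ n : ℕ, 0 ≤ Real.sqrt (n / (c * h n)) := fun n => Real.sqrt_nonneg _
  have hquot : TendstoInMeasure P (fun n ω => standardized μ x f K R Υ θ (h n) n (θhat n ω)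
      - standardizedLinear μ x f K R (h n) n (fun i => X i ω)) atTop fun _ => 0 := by
    have hlin' := hlin.mono_rate one_pos (b := fun n => Real.sqrt (1 / (n : ℝ))
        + remainderRate h (fun n => approxError μ x R θ (h n)) n)
      (Eventually.of_forall fun n => by linarith [remainderRate_nonneg (h := h) hϱ n])
    have hrem' := hrem.mono_rate one_pos (b := fun n => Real.sqrt (1 / (n : ℝ))
        + remainderRate h (fun n => approxError μ x R θ (h n)) n)
      (Eventually.of_forall fun n => by linarith [Real.sqrt_nonneg (1 / (n : ℝ))])
    have hprod := hgam.mul (hlin'.add hrem') fun n => Real.sqrt_nonneg _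
    have hprod' := hprod.mono_rate one_pos
      (b := fun n => remainderRate h (fun n => approxError μ x R θ (h n)) n
        + Real.sqrt (1 / ((n : ℝ) * h n)) * (Real.sqrt (1 / (n : ℝ))
          + remainderRate h (fun n => approxError μ x R θ (h n)) n))
      (Eventually.of_forall fun n => by linarith [remainderRate_nonneg (h := h) hϱ n])
    have hrem'' := hrem.mono_rate one_pos
      (b := fun n => remainderRate h (fun n => approxError μ x R θ (h n)) n
        + Real.sqrt (1 / ((n : ℝ) * h n)) * (Real.sqrt (1 / (n : ℝ))
          + remainderRate h (fun n => approxError μ x R θ (h n)) n))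
      (Eventually.of_forall fun n => by
        have := remainderRate_nonneg (h := h) hϱ n
        have h1 : 0 ≤ Real.sqrt (1 / ((n : ℝ) * h n)) * (Real.sqrt (1 / (n : ℝ))
          + remainderRate h (fun n => approxError μ x R θ (h n)) n) := by positivity
        linarith)
    have hκ : (0 : ℝ) ≤ 1 + 2 / c := by positivity
    have hZ := (isBigOP_const P (a := fun _ => 1 + 2 / c) fun _ => hκ).mul
      ((isBigOP_const P hs).mul (hrem''.add hprod') hs) fun _ => hκ
    have hz := (tendsto_error_rate hh_pos hϱ hc hh_zero hh_rate hh_bias).const_mul (1 + 2 / c)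
    rw [mul_zero] at hz
    -- On the complement of this event the sample Gram matrix inherits the lower bound of `Γ_h`.
    have hbad := hgam.tendsto_measure_zero (by simpa using tendsto_sqrt_one_div hnh 1)
      (half_pos hc)
    refine hZ.tendstoInMeasure_zero hz hbad ?_
    filter_upwards [hB, eventually_gt_atTop 0] with n hn h0
    filter_upwards [hθhat n] with ω hω hgood
    have hΔ := not_le.1 hgood
    exact hn.norm_standardized_sub_le θ h0 hω ((le_abs_self _).trans hΔ.le)
  have hquotF : TendstoInMeasure P (fun n ω => standardized μ x f K R Υ θ (h n) n (θhatF n ω)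
      - standardizedLinear μ x f K R (h n) n (fun i => X i ω)) atTop fun _ => 0 := by
    have hC := hn₀.design.const_pos
    have hz := (tendsto_sqrt_mul_approxError hh_pos hϱ hc hh_bias).const_mul (C ^ 3)
    rw [mul_zero] at hz
    have hZ := isBigOP_const P (a := fun n : ℕ =>
      C ^ 3 * (Real.sqrt (n / (c * h n)) * approxError μ x R θ (h n))) fun n =>
        mul_nonneg (by positivity) (mul_nonneg (hs n) (hϱ n))
    refine hZ.tendstoInMeasure_zero hz (B := fun _ => ∅) (by simp) ?_
    filter_upwards [hB, eventually_gt_atTop 0] with n hn h0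
    filter_upwards [hθhatF n] with ω hω _
    exact hn.norm_standardized_sub_le_of_localL2 θ h0 hω
  have hclt := tendstoInDistribution_standardizedLinear hX_meas hX_indep hX_law
    hA.kernel_measurable hA.basis_measurable hB hnh
  refine ⟨hgam, isBigOP_leaveInBias hX_meas hX_law hB, isBigOP_approxBias hX_meas hX_law hB,
    isBigOP_quadraticTerm hX_meas hX_indep hX_law hB, tendstoInMeasure_sub_zero hquot hquotF,
    tendstoInDistribution_of_tendstoInMeasure_sub _ _ hclt hquot fun n =>
      (continuous_standardized (h n) n).measurable.comp_aemeasurable (hθhat_meas n)⟩
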